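/- Let $G$ be a discrete group. Let $\varpi$ be the universal representation of $G$ (the direct sum of all cyclic unitary representations), and let $C^*(G)$ be the norm-closed linear span of $\varpi(G)$. The Fourier--Stieltjes algebra $B(G)$ is the algebra of all matrix coefficients $\pi_{\xi,\eta}(s)=\langle\pi(s)\xi,\eta\rangle$ of unitary representations $\pi$ of $G$, with pointwise operations and norm $\|u\|=\inf\{\|\xi\|\,\|\eta\| : u=\pi_{\xi,\eta}\}$; it carries the operator space structure and the weak* topology of $B(G)=C^*(G)^*$, where $u\in B(G)$ corresponds to the functional with $\varpi(s)\mapsto u(s)$. The Fourier algebra $A(G)$ is the norm closure in $B(G)$ of the span of the matrix coefficients of the left regular representation $\lambda$ on $\ell^2(G)$; $\rho$ denotes the right regular representation. A completely contractive dual Banach algebra $A$ is operator Connes-amenable if every weak*-continuous, completely bounded derivation $D\colon A\to E$ into a normal dual completely bounded $A$-bimodule $E$ is inner; here $E$ is the dual of an operator space, the module actions are jointly completely bounded and weak*-continuous in the variable from $E$, and normality means that $a\mapsto a\cdot x$ and $a\mapsto x\cdot a$ are weak*-continuous for all $x\in E$. The group $G$ has the factorization property if the representation $(s,t)\mapsto\lambda(s)\rho(t)$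 of $G\times G$ on $\ell^2(G)$ extends to a $*$-representation of $C^*(G)\otimes_{\min}C^*(G)$, i.e. if there is a $*$-representation $\Phi$ with $\Phi(\varpi(s)\otimes\varpi(t))=\lambda(s)\rho(t)$ for all $s,t\in G$. 1. If $B$ is a weak*-closed (not necessarily unital) subalgebra of $B(G)$ with $A(G)\subseteq B$, equipped with the inherited operator space structure and weak* topology, and $B$ is operator Connes-amenable, then $G$ has the factorization property. 2. $G$ has the factorization property if and only if the indicator function $1_\Delta$ of the diagonal $\Delta\subseteq G\times G$ extends to a state on $C^*(G)\otimes_{\min}C^*(G)$, i.e. there is a state $\varphi$ with $\varphi(\varpi(s)\otimes\varpi(t))=1_\Delta(s,t)$ for all $s,t\in G$. 3. In particular, if $G$ does not have the factorization property, then $B(G)$ is not operator Connes-amenable. -/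

import Mathlib

open scoped Matrix.Norms.L2Operator TensorProduct InnerProductSpace ComplexOrder Topology

universe u v w

noncomputable section

/-! ### Operator spaces -/

/-- A choice of a number `matNorm x` for every square matrix `x` over `V` (indexed by an
arbitrary finite type): the data of an operator space structure. Scalar matrices always carry
the operator norm on `ℓ²`. -/
class MatrixNorms (V : Type*) where
  matNorm : ∀ {ι : Type} [Fintype ι] [DecidableEq ι], Matrix ι ι V → ℝ

open MatrixNorms (matNorm)

/-- Ruan's axioms for an abstract operator space structure on a normed space `V`. Together they
imply that every `matNorm` is a norm; `M₁(V)` carries the given norm of `V`. -/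
class IsOperatorSpace (V : Type*) [NormedAddCommGroup V] [NormedSpace ℂ V] [MatrixNorms V] :
    Prop where
  matNorm_add_le : ∀ {ι : Type} [Fintype ι] [DecidableEq ι] (x y : Matrix ι ι V),
    matNorm (x + y) ≤ matNorm x + matNorm y
  matNorm_smul : ∀ {ι : Type} [Fintype ι] [DecidableEq ι] (c : ℂ) (x : Matrix ι ι V),
    matNorm (c • x) = ‖c‖ * matNorm x
  matNorm_one_by_one : ∀ v : V, matNorm (Matrix.of fun _ _ : Unit => v) = ‖v‖
  /-- `‖α x β‖ ≤ ‖α‖ ‖x‖ ‖β‖` for (rectangular) scalar matrices `α`, `β`. -/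
  matNorm_mul_mul_le : ∀ {ι κ : Type} [Fintype ι] [DecidableEq ι] [Fintype κ] [DecidableEq κ]
    (α : Matrix κ ι ℂ) (x : Matrix ι ι V) (β : Matrix ι κ ℂ),
    matNorm (Matrix.of fun k l => ∑ i, ∑ j, (α k i * β j l) • x i j) ≤ ‖α‖ * matNorm x * ‖β‖
  /-- `‖x ⊕ y‖ = max ‖x‖ ‖y‖`. -/
  matNorm_fromBlocks : ∀ {ι κ : Type} [Fintype ι] [DecidableEq ι] [Fintype κ] [DecidableEq κ]
    (x : Matrix ι ι V) (y : Matrix κ κ V),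
    matNorm (Matrix.fromBlocks x 0 0 y) = max (matNorm x) (matNorm y)

/-- The dual operator space structure: `M_ι(V*)` is normed as the space of completely bounded
maps `V → M_ι(ℂ)`, i.e. `[φ i j]` gets the completely bounded norm of `x ↦ [φ i j x]`. -/
instance instMatrixNormsStrongDual (V : Type*) [NormedAddCommGroup V] [NormedSpace ℂ V]
    [MatrixNorms V] : MatrixNorms (StrongDual ℂ V) where
  matNorm {ι} _ _ φ := sInf {C : ℝ | 0 ≤ C ∧ ∀ (n : ℕ) (x : Matrix (Fin n) (Fin n) V),
    ‖(Matrix.of fun p q : ι × Fin n => φ p.1 q.1 (x p.2 q.2) :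
      Matrix (ι × Fin n) (ι × Fin n) ℂ)‖ ≤ C * matNorm x}

/-- The weak* topology `σ(V*, V)` on the dual of `V`. -/
@[reducible] def weakStar (V : Type*) [NormedAddCommGroup V] [NormedSpace ℂ V] :
    TopologicalSpace (StrongDual ℂ V) :=
  TopologicalSpace.induced (fun φ => StrongDual.toWeakDual φ) inferInstance

/-- Complete boundedness of a linear map. -/
def IsCompletelyBounded {V W : Type*} [AddCommGroup V] [Module ℂ V] [AddCommGroup W] [Module ℂ W]
    [MatrixNorms V] [MatrixNorms W] (f : V →ₗ[ℂ] W) : Prop :=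
  ∃ C : ℝ, ∀ (n : ℕ) (x : Matrix (Fin n) (Fin n) V), matNorm (x.map f) ≤ C * matNorm x

/-- (Joint) complete boundedness of a bilinear map `V × W → X`, i.e. complete boundedness of its
linearization on the operator space projective tensor product of `V` and `W`. -/
def IsJointlyCompletelyBounded {V W X : Type*} [AddCommGroup V] [Module ℂ V]
    [AddCommGroup W] [Module ℂ W] [AddCommGroup X] [Module ℂ X]
    [MatrixNorms V] [MatrixNorms W] [MatrixNorms X] (f : V →ₗ[ℂ] W →ₗ[ℂ] X) : Prop :=
  ∃ C : ℝ, ∀ (m n : ℕ) (x : Matrix (Fin m) (Fin m) V) (y : Matrix (Fin n) (Fin n) W),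
    matNorm (Matrix.of fun p q : Fin m × Fin n => f (x p.1 q.1) (y p.2 q.2))
      ≤ C * matNorm x * matNorm y

/-! ### Operator Connes-amenability -/

/-- A dual completely bounded `A`-bimodule: the dual `F*` of an operator space `F` with jointly
completely bounded, commuting left and right actions of `A` such that every `a` acts from either
side by a weak*-continuous map. -/
structure DualOperatorBimodule (A : Type*) [NonUnitalRing A] [Module ℂ A] [MatrixNorms A]
    (F : Type*) [NormedAddCommGroup F] [NormedSpace ℂ F] [MatrixNorms F] where
  /-- `left a x = a · x` -/
  left : A →ₗ[ℂ] StrongDual ℂ F →ₗ[ℂ] StrongDual ℂ F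
  /-- `right a x = x · a` -/
  right : A →ₗ[ℂ] StrongDual ℂ F →ₗ[ℂ] StrongDual ℂ F
  left_mul : ∀ a b x, left (a * b) x = left a (left b x)
  right_mul : ∀ a b x, right (a * b) x = right b (right a x)
  left_right : ∀ a b x, left a (right b x) = right b (left a x)
  left_cb : IsJointlyCompletelyBounded left
  right_cb : IsJointlyCompletelyBounded right
  left_weakStar : ∀ a, Continuous[weakStar F, weakStar F] (left a)
  right_weakStar : ∀ a, Continuous[weakStar F, weakStar F] (right a)

/-- The bimodule is normal: for every `x` the maps `a ↦ a · x` and `a ↦ x · a` are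
weak*-continuous, where `τ` is the weak* topology of `A`. -/
def DualOperatorBimodule.IsNormal {A : Type*} [NonUnitalRing A] [Module ℂ A] [MatrixNorms A]
    (τ : TopologicalSpace A)
    {F : Type*} [NormedAddCommGroup F] [NormedSpace ℂ F] [MatrixNorms F]
    (E : DualOperatorBimodule A F) : Prop :=
  ∀ x, Continuous[τ, weakStar F] (fun a => E.left a x) ∧
    Continuous[τ, weakStar F] (fun a => E.right a x)

/-- Operator Connes-amenability of a completely contractive dual Banach algebra `A`, which enters
through its algebra structure, its matrix norms and its weak* topology `τ`: every weak*-continuous,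
completely bounded derivation from `A` into a normal dual completely bounded `A`-bimodule is
inner. -/
def OperatorConnesAmenable (A : Type v) [NonUnitalRing A] [Module ℂ A] [MatrixNorms A]
    (τ : TopologicalSpace A) : Prop :=
  ∀ (F : Type w) [NormedAddCommGroup F] [NormedSpace ℂ F] [CompleteSpace F] [MatrixNorms F]
    [IsOperatorSpace F] (E : DualOperatorBimodule A F), E.IsNormal τ →
    ∀ D : A →ₗ[ℂ] StrongDual ℂ F,
      (∀ a b, D (a * b) = E.left a (D b) + E.right b (D a)) →
      IsCompletelyBounded D → Continuous[τ, weakStar F] D →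
      ∃ x : StrongDual ℂ F, ∀ a, D a = E.left a x - E.right a x

/-! ### Concrete operator algebras -/

section Concrete

variable {H : Type*} [NormedAddCommGroup H] [InnerProductSpace ℂ H]
variable {K : Type*} [NormedAddCommGroup K] [InnerProductSpace ℂ K]

/-- The operator on the Hilbert space `H^ι` given by a matrix of operators on `H`. -/
def opMatrix {ι : Type*} [Fintype ι] (a : Matrix ι ι (H →L[ℂ] H)) :
    PiLp 2 (fun _ : ι => H) →L[ℂ] PiLp 2 (fun _ : ι => H) :=
  ((PiLp.continuousLinearEquiv 2 ℂ fun _ : ι => H).symm.toContinuousLinearMap).comp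
    ((ContinuousLinearMap.pi fun i => ∑ j, (a i j).comp (ContinuousLinearMap.proj j)).comp
      (PiLp.continuousLinearEquiv 2 ℂ fun _ : ι => H).toContinuousLinearMap)

variable [CompleteSpace H] in
/-- The operator space structure of a concrete C*-algebra `A ⊆ B(H)`: `M_ι(A) ⊆ B(H^ι)`. -/
instance instMatrixNormsStarSubalgebra (A : StarSubalgebra ℂ (H →L[ℂ] H)) : MatrixNorms A where
  matNorm x := ‖opMatrix (x.map fun a => (a : H →L[ℂ] H))‖

variable (H K) in
/-- The Hilbert space tensor product. -/
def HilbertTensor : Type _ := UniformSpace.Completion (H ⊗[ℂ] K)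

instance : NormedAddCommGroup (HilbertTensor H K) :=
  inferInstanceAs (NormedAddCommGroup (UniformSpace.Completion (H ⊗[ℂ] K)))

instance : InnerProductSpace ℂ (HilbertTensor H K) :=
  inferInstanceAs (InnerProductSpace ℂ (UniformSpace.Completion (H ⊗[ℂ] K)))

instance : CompleteSpace (HilbertTensor H K) :=
  inferInstanceAs (CompleteSpace (UniformSpace.Completion (H ⊗[ℂ] K)))

variable (H K) in
/-- The canonical isometric embedding of the algebraic tensor product. -/
def HilbertTensor.incl : H ⊗[ℂ] K →ₗᵢ[ℂ] HilbertTensor H K :=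
  UniformSpace.Completion.toComplₗᵢ

theorem HilbertTensor.denseRange_incl : DenseRange (HilbertTensor.incl H K) :=
  UniformSpace.Completion.denseRange_coe

/-- The operator `a ⊗ b` on the Hilbert space tensor product. -/
def opTensor (a : H →L[ℂ] H) (b : K →L[ℂ] K) : HilbertTensor H K →L[ℂ] HilbertTensor H K :=
  (TensorProduct.mapL a b).completion

theorem opTensor_incl (a : H →L[ℂ] H) (b : K →L[ℂ] K) (x : H ⊗[ℂ] K) :
    opTensor a b (HilbertTensor.incl H K x)
      = HilbertTensor.incl H K (TensorProduct.mapL a b x) :=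
  ContinuousLinearMap.completion_apply_coe (TensorProduct.mapL a b) x

variable [CompleteSpace H] [CompleteSpace K]

/-- The minimal (spatial) tensor product of two concrete C*-algebras: the C*-algebra on the
Hilbert space tensor product generated by the elementary tensors `a ⊗ b`. -/
def minTensor (A : StarSubalgebra ℂ (H →L[ℂ] H)) (B : StarSubalgebra ℂ (K →L[ℂ] K)) :
    StarSubalgebra ℂ (HilbertTensor H K →L[ℂ] HilbertTensor H K) :=
  (StarAlgebra.adjoin ℂ {T | ∃ a ∈ A, ∃ b ∈ B, T = opTensor a b}).topologicalClosure

/-- The elementary tensor `a ⊗ b` in the minimal tensor product. -/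
def minTmul {A : StarSubalgebra ℂ (H →L[ℂ] H)} {B : StarSubalgebra ℂ (K →L[ℂ] K)}
    (a : A) (b : B) : minTensor A B :=
  ⟨opTensor a b, StarSubalgebra.le_topologicalClosure _
    (StarAlgebra.subset_adjoin ℂ _ ⟨a, a.2, b, b.2, rfl⟩)⟩

/-- A state: a positive linear functional of norm one. -/
def IsState {A : StarSubalgebra ℂ (H →L[ℂ] H)} (φ : StrongDual ℂ A) : Prop :=
  (∀ a : A, 0 ≤ φ (star a * a)) ∧ ‖φ‖ = 1

end Concrete

/-! ### Unitary representations of a discrete group -/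

/-- A unitary representation of the discrete group `G` on `H`. -/
abbrev UnitaryRep (G : Type*) [Group G] (H : Type*) [NormedAddCommGroup H]
    [InnerProductSpace ℂ H] : Type _ := G →* (H ≃ₗᵢ[ℂ] H)

section Reps

variable {G : Type*} [Group G]
variable {H : Type*} [NormedAddCommGroup H] [InnerProductSpace ℂ H]
variable {K : Type*} [NormedAddCommGroup K] [InnerProductSpace ℂ K]

/-- `π(s)` as a bounded operator. -/
def UnitaryRep.op (π : UnitaryRep G H) (s : G) : H →L[ℂ] H :=
  (π s).toContinuousLinearEquiv.toContinuousLinearMap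

@[simp]
theorem UnitaryRep.op_apply (π : UnitaryRep G H) (s : G) (x : H) : UnitaryRep.op π s x = π s x :=
  rfl

/-- The matrix coefficient `s ↦ ⟨π(s) ξ, η⟩`; Mathlib's inner product is linear in the second
variable. -/
def UnitaryRep.coeff (π : UnitaryRep G H) (ξ η : H) (s : G) : ℂ := ⟪η, π s ξ⟫_ℂ

/-- A group homomorphism into the isometric bounded operators is a unitary representation. -/
def UnitaryRep.ofIsometric (f : G →* (H →L[ℂ] H)) (hf : ∀ s x, ‖f s x‖ = ‖x‖) :
    UnitaryRep G H where
  toFun s :=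
    { toFun := f s
      map_add' := map_add (f s)
      map_smul' := map_smul (f s)
      invFun := f s⁻¹
      left_inv := fun x => by
        rw [← mul_apply_eq_comp, ← map_mul]; simp
      right_inv := fun x => by
        rw [← mul_apply_eq_comp, ← map_mul]; simp
      norm_map' := hf s }
  map_one' := by ext x; simp
  map_mul' s t := by ext x; simp

@[simp]
theorem UnitaryRep.ofIsometric_apply (f : G →* (H →L[ℂ] H)) (hf : ∀ s x, ‖f s x‖ = ‖x‖)
    (s : G) (x : H) : UnitaryRep.ofIsometric f hf s x = f s x := rfl

/-- The Hilbert space direct sum of a family of unitary representations. -/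
def UnitaryRep.hilbertSum {I : Type*} {E : I → Type*} [∀ i, NormedAddCommGroup (E i)]
    [∀ i, InnerProductSpace ℂ (E i)] (π : ∀ i, UnitaryRep G (E i)) :
    UnitaryRep G (lp E 2) :=
  UnitaryRep.ofIsometric
    { toFun := fun s => lp.mapCLM 2 (fun i => UnitaryRep.op (π i) s) zero_le_one fun i =>
        ContinuousLinearMap.opNorm_le_bound _ zero_le_one fun x => by simp
      map_one' := by ext x i; simp
      map_mul' := fun s t => by ext x i; simp }
    (fun s x => by
      rw [lp.norm_eq_tsum_rpow (by simp), lp.norm_eq_tsum_rpow (by simp)]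
      simp)

/-- The concrete C*-algebra generated by a unitary representation. -/
def UnitaryRep.cstar [CompleteSpace H] (π : UnitaryRep G H) : StarSubalgebra ℂ (H →L[ℂ] H) :=
  (StarAlgebra.adjoin ℂ (Set.range (UnitaryRep.op π))).topologicalClosure

/-- `π(s)` as an element of the C*-algebra generated by `π`. -/
def UnitaryRep.cstarOf [CompleteSpace H] (π : UnitaryRep G H) (s : G) : UnitaryRep.cstar π :=
  ⟨UnitaryRep.op π s, StarSubalgebra.le_topologicalClosure _
    (StarAlgebra.subset_adjoin ℂ _ ⟨s, rfl⟩)⟩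

/-- The direct sum of two unitary representations. -/
def UnitaryRep.prod (π : UnitaryRep G H) (σ : UnitaryRep G K) : UnitaryRep G (WithLp 2 (H × K)) :=
  UnitaryRep.ofIsometric
    { toFun := fun s =>
        ((WithLp.prodContinuousLinearEquiv 2 ℂ H K).symm.toContinuousLinearMap).comp
          (((UnitaryRep.op π s).prodMap (UnitaryRep.op σ s)).comp
            (WithLp.prodContinuousLinearEquiv 2 ℂ H K).toContinuousLinearMap)
      map_one' := by
        ext x
        exact WithLp.ofLp_injective 2 (Prod.ext (by simp) (by simp))
      map_mul' := fun s t => by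
        ext x
        exact WithLp.ofLp_injective 2 (Prod.ext (by simp) (by simp)) }
    (fun s x => by simp [WithLp.prod_norm_eq_of_L2])

theorem UnitaryRep.prod_coeff (π : UnitaryRep G H) (σ : UnitaryRep G K) (ξ η : H) (ξ' η' : K)
    (s : G) :
    UnitaryRep.coeff (UnitaryRep.prod π σ) (WithLp.toLp 2 (ξ, ξ')) (WithLp.toLp 2 (η, η')) s
      = UnitaryRep.coeff π ξ η s + UnitaryRep.coeff σ ξ' η' s := by
  simp [UnitaryRep.coeff, UnitaryRep.prod, WithLp.prod_inner_apply]

/-- The (inner) tensor product of two unitary representations. -/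
def UnitaryRep.tensor (π : UnitaryRep G H)
    (σ : UnitaryRep G K) : UnitaryRep G (HilbertTensor H K) :=
  UnitaryRep.ofIsometric
    { toFun := fun s => opTensor (UnitaryRep.op π s) (UnitaryRep.op σ s)
      map_one' := by
        refine ContinuousLinearMap.coeFn_injective ?_
        refine HilbertTensor.denseRange_incl.equalizer (by fun_prop) (by fun_prop) ?_
        funext x
        have h : TensorProduct.mapL (UnitaryRep.op π 1) (UnitaryRep.op σ 1)
            = ContinuousLinearMap.id ℂ (H ⊗[ℂ] K) := by
          rw [← TensorProduct.mapL_id_id]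
          congr 1 <;> ext x <;> simp
        simp only [Function.comp_apply, opTensor_incl, h]
        rfl
      map_mul' := fun s t => by
        refine ContinuousLinearMap.coeFn_injective ?_
        refine HilbertTensor.denseRange_incl.equalizer (by fun_prop) (by fun_prop) ?_
        funext x
        have h : TensorProduct.mapL (UnitaryRep.op π (s * t)) (UnitaryRep.op σ (s * t))
            = TensorProduct.mapL (UnitaryRep.op π s) (UnitaryRep.op σ s)
              * TensorProduct.mapL (UnitaryRep.op π t) (UnitaryRep.op σ t) := by
          rw [← TensorProduct.mapL_mul]
          congr 1 <;> ext x <;> simp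
        simp only [Function.comp_apply, mul_apply_eq_comp, opTensor_incl, h] }
    (fun s x => by
      refine HilbertTensor.denseRange_incl.induction_on x
        (isClosed_eq (by fun_prop) (by fun_prop)) fun x => ?_
      simp only [MonoidHom.coe_mk, OneHom.coe_mk, opTensor_incl,
        LinearIsometry.norm_map]
      rw [TensorProduct.mapL_apply]
      exact TensorProduct.norm_map (π s).toLinearIsometry (σ s).toLinearIsometry x)

theorem UnitaryRep.tensor_coeff (π : UnitaryRep G H)
    (σ : UnitaryRep G K) (ξ η : H) (ξ' η' : K) (s : G) :
    UnitaryRep.coeff (UnitaryRep.tensor π σ) (HilbertTensor.incl H K (ξ ⊗ₜ[ℂ] ξ'))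
      (HilbertTensor.incl H K (η ⊗ₜ[ℂ] η')) s
      = UnitaryRep.coeff π ξ η s * UnitaryRep.coeff σ ξ' η' s := by
  simp only [UnitaryRep.coeff, UnitaryRep.tensor, UnitaryRep.ofIsometric_apply,
    MonoidHom.coe_mk, OneHom.coe_mk, opTensor_incl, LinearIsometry.inner_map_map]
  simp

/-- The restriction of a unitary representation to an invariant subspace. -/
def UnitaryRep.sub (π : UnitaryRep G H) (M : Submodule ℂ H) (hM : ∀ s, ∀ x ∈ M, π s x ∈ M) :
    UnitaryRep G M :=
  UnitaryRep.ofIsometric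
    { toFun := fun s => ((UnitaryRep.op π s).comp M.subtypeL).codRestrict M fun x => hM s x x.2
      map_one' := ContinuousLinearMap.ext fun x => Subtype.ext (by
        change π 1 (x : H) = x
        simp)
      map_mul' := fun s t => ContinuousLinearMap.ext fun x => Subtype.ext (by
        change π (s * t) (x : H) = π s (π t x)
        simp) }
    (fun s x => (π s).norm_map x)

@[simp]
theorem UnitaryRep.coe_sub_apply (π : UnitaryRep G H) (M : Submodule ℂ H)
    (hM : ∀ s, ∀ x ∈ M, π s x ∈ M) (s : G) (x : M) :
    (UnitaryRep.sub π M hM s x : H) = π s x := rfl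

/-- `ξ` is a cyclic vector for `π`: the linear span of its orbit is dense. -/
def UnitaryRep.IsCyclicVector (π : UnitaryRep G H) (ξ : H) : Prop :=
  (Submodule.span ℂ (Set.range fun s => π s ξ)).topologicalClosure = ⊤

/-- The closed linear span of the orbit of `ξ`. -/
def UnitaryRep.cyclicSubspace (π : UnitaryRep G H) (ξ : H) : Submodule ℂ H :=
  (Submodule.span ℂ (Set.range fun s => π s ξ)).topologicalClosure

theorem UnitaryRep.self_mem_cyclicSubspace (π : UnitaryRep G H) (ξ : H) :
    ξ ∈ UnitaryRep.cyclicSubspace π ξ :=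
  Submodule.le_topologicalClosure _ (Submodule.subset_span ⟨1, by simp⟩)

theorem UnitaryRep.cyclicSubspace_invariant (π : UnitaryRep G H) (ξ : H) (s : G) :
    ∀ x ∈ UnitaryRep.cyclicSubspace π ξ, π s x ∈ UnitaryRep.cyclicSubspace π ξ := by
  intro x hx
  refine map_mem_closure (π s).continuous hx fun y hy => ?_
  induction hy using Submodule.span_induction with
  | mem y hy =>
    obtain ⟨t, rfl⟩ := hy
    exact Submodule.subset_span ⟨s * t, by simp⟩
  | zero => simp
  | add y z _ _ hy hz => simpa using add_mem hy hz
  | smul c y _ hy => simpa using Submodule.smul_mem _ c hy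

theorem UnitaryRep.isCyclicVector_sub (π : UnitaryRep G H) (ξ : H) :
    UnitaryRep.IsCyclicVector
      (UnitaryRep.sub π (UnitaryRep.cyclicSubspace π ξ) (UnitaryRep.cyclicSubspace_invariant π ξ))
      ⟨ξ, UnitaryRep.self_mem_cyclicSubspace π ξ⟩ := by
  refine eq_top_iff.2 fun x _ => ?_
  refine closure_subtype.2 ?_
  have hx : (x : H) ∈ closure (Submodule.span ℂ (Set.range fun s => π s ξ) : Set H) := x.2
  refine closure_mono (fun y hy => ?_) hx
  have := Submodule.map_span (UnitaryRep.cyclicSubspace π ξ).subtype (Set.range fun s =>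
    UnitaryRep.sub π (UnitaryRep.cyclicSubspace π ξ) (UnitaryRep.cyclicSubspace_invariant π ξ) s
      ⟨ξ, UnitaryRep.self_mem_cyclicSubspace π ξ⟩)
  rw [← Set.range_comp] at this
  have hy' : y ∈ Submodule.map (UnitaryRep.cyclicSubspace π ξ).subtype _ := this ▸ hy
  exact hy'


end Reps

section Group

variable (G : Type u) [Group G]

/-- A cyclic unitary representation of `G` on a Hilbert space. -/
structure CyclicRep : Type (u + 1) where
  /-- the underlying Hilbert space -/
  carrier : Type u
  [normed : NormedAddCommGroup carrier]
  [inner : InnerProductSpace ℂ carrier]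
  [complete : CompleteSpace carrier]
  /-- the representation -/
  rep : UnitaryRep G carrier
  cyclic : ∃ ξ, UnitaryRep.IsCyclicVector rep ξ

attribute [instance] CyclicRep.normed CyclicRep.inner CyclicRep.complete

/-- The universal representation of `G`: the direct sum of all its cyclic representations. -/
def universalRep : UnitaryRep G (lp (fun σ : CyclicRep G => σ.carrier) 2) :=
  UnitaryRep.hilbertSum fun σ : CyclicRep G => σ.rep

/-- The full group C*-algebra `C*(G)`. -/
abbrev fullCStar := UnitaryRep.cstar (universalRep G)

/-- The canonical image `ϖ(s)` of `s ∈ G` in `C*(G)`. -/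
abbrev fullCStarOf (s : G) : fullCStar G := UnitaryRep.cstarOf (universalRep G) s

/-! ### The Fourier-Stieltjes algebra and the Fourier algebra -/

variable {G} in
/-- `f` is the coefficient `π_{ξ,η}` of some unitary representation, and `r = ‖ξ‖ ‖η‖`. -/
def IsCoeffWithNorm (f : G → ℂ) (r : ℝ) : Prop :=
  ∃ (H : Type u) (_ : NormedAddCommGroup H) (_ : InnerProductSpace ℂ H) (_ : CompleteSpace H)
    (π : UnitaryRep G H) (ξ η : H), f = UnitaryRep.coeff π ξ η ∧ r = ‖ξ‖ * ‖η‖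

/-- The Fourier-Stieltjes algebra `B(G)`: all matrix coefficients of unitary representations,
with pointwise operations. -/
def fourierStieltjes : Subalgebra ℂ (G → ℂ) where
  carrier := {f | ∃ r, IsCoeffWithNorm f r}
  mul_mem' := by
    rintro _ _ ⟨_, H, _, _, _, π, ξ, η, rfl, _⟩ ⟨_, K, _, _, _, σ, ξ', η', rfl, _⟩
    exact ⟨_, HilbertTensor H K, inferInstance, inferInstance, inferInstance,
      UnitaryRep.tensor π σ, HilbertTensor.incl H K (ξ ⊗ₜ[ℂ] ξ'),
      HilbertTensor.incl H K (η ⊗ₜ[ℂ] η'),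
      funext fun s => (UnitaryRep.tensor_coeff π σ ξ η ξ' η' s).symm, rfl⟩
  add_mem' := by
    rintro _ _ ⟨_, H, _, _, _, π, ξ, η, rfl, _⟩ ⟨_, K, _, _, _, σ, ξ', η', rfl, _⟩
    exact ⟨_, WithLp 2 (H × K), inferInstance, inferInstance, inferInstance,
      UnitaryRep.prod π σ, WithLp.toLp 2 (ξ, ξ'), WithLp.toLp 2 (η, η'),
      funext fun s => (UnitaryRep.prod_coeff π σ ξ η ξ' η' s).symm, rfl⟩
  algebraMap_mem' c :=
    ⟨_, EuclideanSpace ℂ PUnit.{u + 1}, inferInstance, inferInstance, inferInstance, 1,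
      EuclideanSpace.single PUnit.unit c, EuclideanSpace.single PUnit.unit 1,
      by ext s; simp [UnitaryRep.coeff, EuclideanSpace.inner_single_left], rfl⟩

variable {G}

/-- The norm of `B(G)`: the infimum of `‖ξ‖ ‖η‖` over all `π`, `ξ`, `η` with `f = π_{ξ,η}`. -/
def fsNorm (f : fourierStieltjes G) : ℝ := sInf {r | IsCoeffWithNorm (f : G → ℂ) r}

/-- Every `f ∈ B(G)` defines a bounded functional on `C*(G)` with `ϖ(s) ↦ f(s)`; there is exactly
one because the `ϖ(s)` span a dense subspace. -/
theorem exists_functional (f : fourierStieltjes G) :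
    ∃ φ : StrongDual ℂ (fullCStar G), ∀ s, φ (fullCStarOf G s) = (f : G → ℂ) s := by
  classical
  obtain ⟨f, _, H, _, _, _, π, ξ, η, rfl, _⟩ := f
  let M := UnitaryRep.cyclicSubspace π ξ
  have : CompleteSpace M := (Submodule.isClosed_topologicalClosure _).completeSpace_coe
  let σ : CyclicRep G := ⟨M, UnitaryRep.sub π M (UnitaryRep.cyclicSubspace_invariant π ξ), _,
    UnitaryRep.isCyclicVector_sub π ξ⟩
  let ξ' : M := ⟨ξ, UnitaryRep.self_mem_cyclicSubspace π ξ⟩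
  let η' : M := M.orthogonalProjectionOnto η
  let x : lp (fun σ : CyclicRep G => σ.carrier) 2 := lp.single 2 σ ξ'
  let y : lp (fun σ : CyclicRep G => σ.carrier) 2 := lp.single 2 σ η'
  refine ⟨((innerSL ℂ y).comp (ContinuousLinearMap.apply ℂ _ x)).comp
    (fullCStar G).toSubalgebra.toSubmodule.subtypeL, fun s => ?_⟩
  change ⟪y, universalRep G s x⟫_ℂ = ⟪η, π s ξ⟫_ℂ
  rw [lp.inner_single_left]
  have h : (universalRep G s x) σ = σ.rep s ξ' := by
    change σ.rep s (x σ) = _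
    simp [x]
  rw [h]
  exact Submodule.inner_orthogonalProjectionOnto_eq_of_mem_right (σ.rep s ξ') η


/-- The pairing of `B(G)` with `C*(G)`, which identifies `B(G)` with the dual of `C*(G)`. -/
def fsToDual (f : fourierStieltjes G) : StrongDual ℂ (fullCStar G) :=
  (exists_functional f).choose

theorem fsToDual_apply (f : fourierStieltjes G) (s : G) :
    fsToDual f (fullCStarOf G s) = (f : G → ℂ) s :=
  (exists_functional f).choose_spec s

/-- The operator space structure of `B(G)` as the dual of `C*(G)`. -/
instance instMatrixNormsFS : MatrixNorms (fourierStieltjes G) where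
  matNorm x := matNorm (x.map fsToDual)

/-- A subalgebra of `B(G)` carries the inherited operator space structure. -/
instance instMatrixNormsFSSub (B : NonUnitalSubalgebra ℂ (fourierStieltjes G)) :
    MatrixNorms B where
  matNorm x := matNorm (x.map fun b => (b : fourierStieltjes G))

variable (G) in
/-- The weak* topology `σ(B(G), C*(G))`. -/
@[reducible] def fsWeakStar : TopologicalSpace (fourierStieltjes G) :=
  TopologicalSpace.induced fsToDual (weakStar (fullCStar G))

/-- The weak* topology of a subalgebra `B` of `B(G)`, inherited from `B(G)`. If `B` is
weak*-closed, this is the weak* topology given by the predual `C*(G) / B_⊥`. -/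
@[reducible] def fsSubWeakStar (B : NonUnitalSubalgebra ℂ (fourierStieltjes G)) :
    TopologicalSpace B :=
  TopologicalSpace.induced (fun b => (b : fourierStieltjes G)) (fsWeakStar G)

variable (G)

variable {G} in
/-- The operator `f ↦ f ∘ e` on `ℓ²(G)`. -/
def lpComp (e : Equiv.Perm G) : lp (fun _ : G => ℂ) 2 →ₗᵢ[ℂ] lp (fun _ : G => ℂ) 2 where
  toFun f := ⟨fun x => f (e x), by
    have h := (memℓp_gen_iff (by simp)).1 (lp.memℓp f)
    exact (memℓp_gen_iff (by simp)).2 (e.summable_iff.2 h)⟩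
  map_add' f g := rfl
  map_smul' c f := rfl
  norm_map' f := by
    rw [lp.norm_eq_tsum_rpow (by simp), lp.norm_eq_tsum_rpow (by simp)]
    congr 1
    exact e.tsum_eq fun x => ‖f x‖ ^ (2 : ENNReal).toReal

/-- The left regular representation `(λ(s) f)(x) = f(s⁻¹ x)` on `ℓ²(G)`. -/
def leftRegular : UnitaryRep G (lp (fun _ : G => ℂ) 2) :=
  UnitaryRep.ofIsometric
    { toFun := fun s => (lpComp (Equiv.mulLeft s⁻¹)).toContinuousLinearMap
      map_one' := by ext f x; simp [lpComp]
      map_mul' := fun s t => by ext f x; simp [lpComp, mul_assoc] }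
    (fun s f => (lpComp (Equiv.mulLeft s⁻¹)).norm_map f)

/-- The right regular representation `(ρ(t) f)(x) = f(x t)` on `ℓ²(G)`. -/
def rightRegular : UnitaryRep G (lp (fun _ : G => ℂ) 2) :=
  UnitaryRep.ofIsometric
    { toFun := fun t => (lpComp (Equiv.mulRight t)).toContinuousLinearMap
      map_one' := by ext f x; simp [lpComp]
      map_mul' := fun s t => by ext f x; simp [lpComp, mul_assoc] }
    (fun t f => (lpComp (Equiv.mulRight t)).norm_map f)

/-- The Fourier algebra `A(G)`: the norm closure in `B(G)` of the linear span of the coefficients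
of the left regular representation. -/
def fourierAlgebra : Set (fourierStieltjes G) :=
  {f | ∀ ε > 0, ∃ g ∈ Submodule.span ℂ {g : fourierStieltjes G |
      ∃ ξ η, (g : G → ℂ) = UnitaryRep.coeff (leftRegular G) ξ η}, fsNorm (f - g) < ε}

/-! ### The factorization property -/

/-- `C*(G) ⊗_min C*(G)`. -/
abbrev minSquare := minTensor (fullCStar G) (fullCStar G)

/-- The factorization property: the representation `(s, t) ↦ λ(s) ρ(t)` of `G × G` on `ℓ²(G)`
extends to a *-representation of `C*(G) ⊗_min C*(G)`. -/
def FactorizationProperty : Prop :=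
  ∃ Φ : minSquare G →⋆ₐ[ℂ] (lp (fun _ : G => ℂ) 2 →L[ℂ] lp (fun _ : G => ℂ) 2),
    ∀ s t : G, Φ (minTmul (fullCStarOf G s) (fullCStarOf G t)) =
      UnitaryRep.op (leftRegular G) s * UnitaryRep.op (rightRegular G) t

open Classical in
/-- The indicator function `1_Δ` of the diagonal subgroup of `G × G` extends to a state on
`C*(G) ⊗_min C*(G)`. -/
def DiagonalExtendsToState : Prop :=
  ∃ φ : StrongDual ℂ (minSquare G), IsState φ ∧
    ∀ s t : G, φ (minTmul (fullCStarOf G s) (fullCStarOf G t)) = if s = t then 1 else 0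

end Group

end

/-!
Let `V = C*(G) ⊗_min C*(G)`. The algebra `B(G)` acts on `V` through either leg,
`u · (ϖ(s) ⊗ ϖ(t)) = u(s) ϖ(s) ⊗ ϖ(t)` and `(ϖ(s) ⊗ ϖ(t)) · u = u(t) ϖ(s) ⊗ ϖ(t)`. These actions are
completely contractive: multiplying coefficients by a matrix `u` over `B(G)` amounts to tensoring
with `ϖ` and slicing by `u`, and `ϖ ⊗ ϖ` is dominated by `ϖ` at every matrix level because `ϖ` is
universal. They are weak*-continuous in `u`, since for `ψ ∈ V*` and `v ∈ V` the functional
`u ↦ ψ(u · v)` is the pairing with an element of `C*(G)`.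

On the closed span `W` of the vectors `ϖ(s) ⊗ ϖ(s)` the two actions agree. The trivial
representation provides `M₀ ∈ V*` with value `1` at every `ϖ(s) ⊗ ϖ(t)`, and
`u ↦ (v ↦ M₀(u · v - v · u))` is a derivation into the normal dual bimodule `(V / W)*`. If it is
inner, implemented by `N`, then `M = M₀ - N ∘ q`, with `q : V → V / W` the quotient map, is equal to
`1` on the diagonal and satisfies `M(u · v) = M(v · u)`; the choice of point masses for `u`, which
lie in `A(G)`, gives `M(ϖ(s) ⊗ ϖ(t)) = 1_Δ(s, t)`.

A bounded functional on `V` that restricts to a positive definite function on `G × G` is positive,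
and the Gelfand–Naimark–Segal representation of `1_Δ` is `(s, t) ↦ λ(s) ρ(t)` with cyclic vector
`δ_1`. Hence `M` gives the factorization property. Conversely, the vector state at `δ_1` turns a
factorization into a state that extends `1_Δ`.
-/

open MatrixNorms (matNorm)

noncomputable section

/-! ### Matrices of operators -/

section OpMatrix

variable {H : Type*} [NormedAddCommGroup H] [InnerProductSpace ℂ H]
variable {ι κ : Type*} [Fintype ι] [Fintype κ]

theorem opNorm_le_of_norm_inner_le {K : Type*} [NormedAddCommGroup K] [InnerProductSpace ℂ K]
    (T : H →L[ℂ] K) {C : ℝ} (hC : 0 ≤ C) (h : ∀ x y, ‖⟪y, T x⟫_ℂ‖ ≤ C * ‖x‖ * ‖y‖) : ‖T‖ ≤ C :=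
  ContinuousLinearMap.opNorm_le_of_re_inner_le hC fun x y hx hy =>
    calc RCLike.re ⟪T x, y⟫_ℂ ≤ ‖⟪T x, y⟫_ℂ‖ := RCLike.re_le_norm _
      _ = ‖⟪y, T x⟫_ℂ‖ := norm_inner_symm _ _
      _ ≤ C := by simpa only [hx, hy, mul_one] using h x y

theorem opMatrix_apply (a : Matrix ι ι (H →L[ℂ] H)) (X : PiLp 2 fun _ : ι => H) (i : ι) :
    opMatrix a X i = ∑ j, a i j (X j) := by
  simp [opMatrix]

theorem inner_opMatrix (a : Matrix ι ι (H →L[ℂ] H)) (X Y : PiLp 2 fun _ : ι => H) :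
    ⟪Y, opMatrix a X⟫_ℂ = ∑ i, ∑ j, ⟪Y i, a i j (X j)⟫_ℂ := by
  simp [PiLp.inner_apply, opMatrix_apply, inner_sum]

theorem norm_opMatrix_le (a : Matrix ι ι (H →L[ℂ] H)) {C : ℝ} (hC : 0 ≤ C)
    (h : ∀ X Y : PiLp 2 fun _ : ι => H,
      ‖∑ i, ∑ j, ⟪Y i, a i j (X j)⟫_ℂ‖ ≤ C * ‖X‖ * ‖Y‖) : ‖opMatrix a‖ ≤ C :=
  opNorm_le_of_norm_inner_le _ hC fun X Y => by rw [inner_opMatrix]; exact h X Y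

theorem norm_inner_apply_le {K : Type*} [NormedAddCommGroup K] [InnerProductSpace ℂ K]
    (T : H →L[ℂ] K) (x : H) (y : K) : ‖⟪y, T x⟫_ℂ‖ ≤ ‖T‖ * ‖x‖ * ‖y‖ :=
  calc ‖⟪y, T x⟫_ℂ‖ ≤ ‖y‖ * ‖T x‖ := norm_inner_le_norm _ _
    _ ≤ ‖y‖ * (‖T‖ * ‖x‖) := by gcongr; exact T.le_opNorm x
    _ = ‖T‖ * ‖x‖ * ‖y‖ := mul_comm _ _

theorem norm_sum_inner_le (a : Matrix ι ι (H →L[ℂ] H)) (X Y : PiLp 2 fun _ : ι => H) :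
    ‖∑ i, ∑ j, ⟪Y i, a i j (X j)⟫_ℂ‖ ≤ ‖opMatrix a‖ * ‖X‖ * ‖Y‖ := by
  rw [← inner_opMatrix]
  exact norm_inner_apply_le _ X Y

theorem opMatrix_add (a b : Matrix ι ι (H →L[ℂ] H)) :
    opMatrix (a + b) = opMatrix a + opMatrix b := by
  ext X i; simp [opMatrix_apply, Finset.sum_add_distrib]

theorem opMatrix_smul (c : ℂ) (a : Matrix ι ι (H →L[ℂ] H)) :
    opMatrix (c • a) = c • opMatrix a := by
  ext X i; simp [opMatrix_apply, Finset.smul_sum]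

theorem opMatrix_mul (a b : Matrix ι ι (H →L[ℂ] H)) :
    opMatrix (a * b) = opMatrix a * opMatrix b := by
  ext X i
  simp only [opMatrix_apply, Matrix.mul_apply, map_sum, sum_apply, mul_apply_eq_comp]
  exact Finset.sum_comm

theorem opMatrix_star [CompleteSpace H] (a : Matrix ι ι (H →L[ℂ] H)) :
    opMatrix a.conjTranspose = star (opMatrix a) := by
  rw [ContinuousLinearMap.star_eq_adjoint, ContinuousLinearMap.eq_adjoint_iff]
  intro X Y
  rw [inner_opMatrix, ← inner_conj_symm, inner_opMatrix, Finset.sum_comm]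
  simp only [map_sum, inner_conj_symm, Matrix.conjTranspose_apply,
    ContinuousLinearMap.star_eq_adjoint, ContinuousLinearMap.adjoint_inner_left]

theorem opMatrix_apply_single [DecidableEq ι] (a : Matrix ι ι (H →L[ℂ] H)) (i j : ι) (x : H) :
    opMatrix a (PiLp.single 2 j x) i = a i j x := by
  rw [opMatrix_apply, Finset.sum_eq_single j] <;> simp +contextual

theorem opMatrix_injective :
    Function.Injective (opMatrix : Matrix ι ι (H →L[ℂ] H) → _) := by
  classical
  intro a b h
  ext i j x
  rw [← opMatrix_apply_single a, h, opMatrix_apply_single]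

theorem norm_entry_le_norm_opMatrix (a : Matrix ι ι (H →L[ℂ] H)) (i j : ι) :
    ‖a i j‖ ≤ ‖opMatrix a‖ := by
  classical
  refine ContinuousLinearMap.opNorm_le_bound _ (opMatrix a).opNorm_nonneg fun x => ?_
  calc ‖a i j x‖ = ‖opMatrix a (PiLp.single 2 j x) i‖ := by rw [opMatrix_apply_single]
    _ ≤ ‖opMatrix a (PiLp.single 2 j x)‖ := PiLp.norm_apply_le _ i
    _ ≤ ‖opMatrix a‖ * ‖x‖ := by simpa using (opMatrix a).le_opNorm (PiLp.single 2 j x)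

theorem norm_opMatrix_le_sum (a : Matrix ι ι (H →L[ℂ] H)) :
    ‖opMatrix a‖ ≤ ∑ i, ∑ j, ‖a i j‖ := by
  refine norm_opMatrix_le a (by positivity) fun X Y => ?_
  simp only [Finset.sum_mul]
  refine norm_sum_le_of_le _ fun i _ => norm_sum_le_of_le _ fun j _ =>
    (norm_inner_apply_le (a i j) (X j) (Y i)).trans ?_
  gcongr <;> exact PiLp.norm_apply_le _ _

theorem norm_opMatrix_fromBlocks_le (x : Matrix ι ι (H →L[ℂ] H)) (y : Matrix κ κ (H →L[ℂ] H)) :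
    ‖opMatrix (Matrix.fromBlocks x 0 0 y)‖ ≤ max ‖opMatrix x‖ ‖opMatrix y‖ := by
  have hm : 0 ≤ max ‖opMatrix x‖ ‖opMatrix y‖ := le_max_of_le_left (opMatrix x).opNorm_nonneg
  refine ContinuousLinearMap.opNorm_le_bound _ hm fun X => le_of_sq_le_sq ?_ (by positivity)
  let X₁ : PiLp 2 fun _ : ι => H := WithLp.toLp 2 fun i => X (.inl i)
  let X₂ : PiLp 2 fun _ : κ => H := WithLp.toLp 2 fun i => X (.inr i)
  have h_image : ‖opMatrix (Matrix.fromBlocks x 0 0 y) X‖ ^ 2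
      = ‖opMatrix x X₁‖ ^ 2 + ‖opMatrix y X₂‖ ^ 2 := by
    simp [PiLp.norm_sq_eq_of_L2, opMatrix_apply, X₁, X₂]
  have h_source : ‖X‖ ^ 2 = ‖X₁‖ ^ 2 + ‖X₂‖ ^ 2 := by
    simp [PiLp.norm_sq_eq_of_L2, X₁, X₂]
  rw [h_image, mul_pow, h_source, mul_add, ← mul_pow, ← mul_pow]
  gcongr
  · exact (opMatrix x).le_of_opNorm_le (le_max_left _ _) X₁
  · exact (opMatrix y).le_of_opNorm_le (le_max_right _ _) X₂

end OpMatrix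

/-! ### Scalar matrices -/

section ScalarMatrix

variable {H : Type*} [NormedAddCommGroup H] [InnerProductSpace ℂ H]
variable {ι κ : Type*} [Fintype ι] [Fintype κ]

theorem exists_orthonormal_coords {ι : Type*} [Finite ι] (X : ι → H) :
    ∃ (N : ℕ) (f : Fin N → H), Orthonormal ℂ f ∧
      ∃ c : ι → Fin N → ℂ, ∀ i, X i = ∑ n, c i n • f n := by
  let M := Submodule.span ℂ (Set.range X)
  have : FiniteDimensional ℂ M := FiniteDimensional.span_of_finite ℂ (Set.finite_range X)
  let b := stdOrthonormalBasis ℂ M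
  let X' (i : ι) : M := ⟨X i, Submodule.subset_span ⟨i, rfl⟩⟩
  refine ⟨_, fun n => (b n : H), b.orthonormal.comp_linearIsometry M.subtypeₗᵢ,
    fun i n => b.repr (X' i) n, fun i => ?_⟩
  simpa using (congrArg ((↑) : M → H) (b.sum_repr (X' i))).symm

theorem norm_sq_sum_smul_orthonormal {f : κ → H} (hf : Orthonormal ℂ f) (c : κ → ℂ) :
    ‖∑ n, c n • f n‖ ^ 2 = ∑ n, ‖c n‖ ^ 2 := by
  simpa using hf.orthogonalFamily.norm_sum c Finset.univ

theorem norm_toLp_coords {f : κ → H} (hf : Orthonormal ℂ f) {X : PiLp 2 fun _ : ι => H}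
    {c : ι → κ → ℂ} (hc : ∀ i, X i = ∑ n, c i n • f n) :
    ‖(WithLp.toLp 2 fun p : ι × κ => c p.1 p.2 : EuclideanSpace ℂ (ι × κ))‖ = ‖X‖ := by
  refine (pow_left_inj₀ (norm_nonneg _) (norm_nonneg _) two_ne_zero).1 ?_
  rw [EuclideanSpace.norm_sq_eq, PiLp.norm_sq_eq_of_L2, Fintype.sum_prod_type]
  simp_rw [hc, norm_sq_sum_smul_orthonormal hf]

theorem inner_toLp_mulVec (M : Matrix ι κ ℂ) (x : EuclideanSpace ℂ κ) (y : EuclideanSpace ℂ ι) :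
    ⟪y, WithLp.toLp 2 (M.mulVec x)⟫_ℂ = ∑ i, ∑ j, star (y i) * M i j * x j := by
  simp only [PiLp.inner_apply, Matrix.mulVec, dotProduct, RCLike.inner_apply, Finset.sum_mul]
  exact Finset.sum_congr rfl fun i _ => Finset.sum_congr rfl fun j _ => by
    rw [RCLike.star_def]; ring

variable [DecidableEq κ]

theorem norm_matrix_one_le : ‖(1 : Matrix κ κ ℂ)‖ ≤ 1 := by
  rw [← Matrix.diagonal_one, Matrix.l2_opNorm_diagonal]
  exact (pi_norm_le_iff_of_nonneg zero_le_one).2 fun _ => by simp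

theorem norm_toLp_sum_smul_le (M : Matrix ι κ ℂ) (X : PiLp 2 fun _ : κ => H) :
    ‖(WithLp.toLp 2 fun i => ∑ j, M i j • X j : PiLp 2 fun _ : ι => H)‖ ≤ ‖M‖ * ‖X‖ := by
  obtain ⟨N, f, hf, c, hc⟩ := exists_orthonormal_coords X
  have h_image (i : ι) : ∑ j, M i j • X j = ∑ n, (∑ j, M i j * c j n) • f n := by
    simp_rw [hc, Finset.smul_sum, Finset.sum_smul, smul_smul]
    exact Finset.sum_comm
  have h_column (n : Fin N) : ∑ i, ‖∑ j, M i j * c j n‖ ^ 2 ≤ ‖M‖ ^ 2 * ∑ j, ‖c j n‖ ^ 2 := by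
    have h := pow_le_pow_left₀ (norm_nonneg _)
      (M.l2_opNorm_mulVec (WithLp.toLp 2 fun j => c j n)) 2
    simpa [mul_pow, EuclideanSpace.norm_sq_eq, Matrix.mulVec, dotProduct] using h
  refine le_of_sq_le_sq ?_ (by positivity)
  simp_rw [mul_pow, PiLp.norm_sq_eq_of_L2, h_image, hc, norm_sq_sum_smul_orthonormal hf]
  rw [Finset.sum_comm, Finset.sum_comm (s := (Finset.univ : Finset κ)), Finset.mul_sum]
  exact Finset.sum_le_sum fun n _ => h_column n

theorem norm_matrix_le (M : Matrix ι κ ℂ) {C : ℝ} (hC : 0 ≤ C)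
    (h : ∀ (x : EuclideanSpace ℂ κ) (y : EuclideanSpace ℂ ι),
      ‖∑ i, ∑ j, star (y i) * M i j * x j‖ ≤ C * ‖x‖ * ‖y‖) : ‖M‖ ≤ C := by
  rw [Matrix.l2_opNorm_def]
  refine opNorm_le_of_norm_inner_le _ hC fun x y => ?_
  have h_xy := h x y
  rwa [← inner_toLp_mulVec] at h_xy

theorem norm_sum_star_mul_mul_le (M : Matrix ι κ ℂ) (x : EuclideanSpace ℂ κ)
    (y : EuclideanSpace ℂ ι) :
    ‖∑ i, ∑ j, star (y i) * M i j * x j‖ ≤ ‖M‖ * ‖x‖ * ‖y‖ := by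
  rw [← inner_toLp_mulVec]
  exact norm_inner_apply_le (Matrix.toEuclideanLin M).toContinuousLinearMap x y

theorem norm_col_le (x : EuclideanSpace ℂ ι) :
    ‖(Matrix.of fun i (_ : Unit) => x i : Matrix ι Unit ℂ)‖ ≤ ‖x‖ := by
  refine norm_matrix_le _ (norm_nonneg _) fun c y => ?_
  have h : ∑ i, ∑ j, star (y i) * (Matrix.of fun i (_ : Unit) => x i : Matrix ι Unit ℂ) i j * c j
      = ⟪y, x⟫_ℂ * c () := by
    simp [PiLp.inner_apply, Finset.mul_sum, mul_comm]
  rw [h, norm_mul]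
  calc ‖⟪y, x⟫_ℂ‖ * ‖c ()‖ ≤ (‖y‖ * ‖x‖) * ‖c‖ := by
        gcongr
        · exact norm_inner_le_norm _ _
        · exact PiLp.norm_apply_le c ()
    _ = ‖x‖ * ‖c‖ * ‖y‖ := by ring

variable [DecidableEq ι]

theorem norm_opMatrix_le_of_orthonormal (a : Matrix ι ι (H →L[ℂ] H)) {C : ℝ} (hC : 0 ≤ C)
    (h : ∀ (N : ℕ) (f : Fin N → H), Orthonormal ℂ f →
      ‖(Matrix.of fun p q : ι × Fin N => ⟪f p.2, a p.1 q.1 (f q.2)⟫_ℂ : Matrix _ _ ℂ)‖ ≤ C) :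
    ‖opMatrix a‖ ≤ C := by
  refine norm_opMatrix_le a hC fun X Y => ?_
  obtain ⟨N, f, hf, c, hc⟩ := exists_orthonormal_coords (Sum.elim X Y)
  have hX (i : ι) : X i = ∑ n, c (.inl i) n • f n := hc (.inl i)
  have hY (i : ι) : Y i = ∑ n, c (.inr i) n • f n := hc (.inr i)
  rw [← norm_toLp_coords hf hX, ← norm_toLp_coords hf hY]
  refine le_of_eq_of_le (congrArg norm ?_) ((norm_sum_star_mul_mul_le _ _ _).trans
    (by gcongr; exact h N f hf))
  simp only [Fintype.sum_prod_type, hX, hY, map_sum, map_smul, sum_inner, inner_sum,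
    inner_smul_left, inner_smul_right, Matrix.of_apply, Finset.mul_sum]
  refine Finset.sum_congr rfl fun i _ => ?_
  rw [Finset.sum_comm (s := (Finset.univ : Finset (Fin N)))]
  refine Finset.sum_congr rfl fun j _ => ?_
  rw [Finset.sum_comm]
  refine Finset.sum_congr rfl fun n _ => Finset.sum_congr rfl fun m _ => ?_
  rw [RCLike.star_def]
  ring

theorem norm_row_le (y : EuclideanSpace ℂ ι) :
    ‖(Matrix.of fun (_ : Unit) i => star (y i) : Matrix Unit ι ℂ)‖ ≤ ‖y‖ := by
  rw [← Matrix.l2_opNorm_conjTranspose]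
  simpa [Matrix.conjTranspose, Matrix.transpose, Matrix.map] using norm_col_le y

variable {f : κ → ι}

theorem norm_one_submatrix_id_le (hf : Function.Injective f) :
    ‖(1 : Matrix ι ι ℂ).submatrix id f‖ ≤ 1 := by
  have h_isometry : ((1 : Matrix ι ι ℂ).submatrix id f).conjTranspose
      * (1 : Matrix ι ι ℂ).submatrix id f = 1 := by
    ext i j
    simp [Matrix.mul_apply, Matrix.one_apply, hf.eq_iff, eq_comm]
  have h := Matrix.l2_opNorm_conjTranspose_mul_self ((1 : Matrix ι ι ℂ).submatrix id f)
  rw [h_isometry] at h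
  nlinarith [norm_matrix_one_le (κ := κ), norm_nonneg ((1 : Matrix ι ι ℂ).submatrix id f)]

omit [DecidableEq κ] in
theorem norm_one_submatrix_le (hf : Function.Injective f) :
    ‖(1 : Matrix ι ι ℂ).submatrix f id‖ ≤ 1 := by
  classical
  rw [← Matrix.l2_opNorm_conjTranspose, Matrix.conjTranspose_submatrix, Matrix.conjTranspose_one]
  exact norm_one_submatrix_id_le hf

theorem norm_submatrix_le (hf : Function.Injective f) (M : Matrix ι ι ℂ) :
    ‖M.submatrix f f‖ ≤ ‖M‖ := by
  have h : M.submatrix f f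
      = (1 : Matrix ι ι ℂ).submatrix f id * M * (1 : Matrix ι ι ℂ).submatrix id f := by
    ext i j; simp [Matrix.mul_apply, Matrix.one_apply]
  calc ‖M.submatrix f f‖
      ≤ ‖(1 : Matrix ι ι ℂ).submatrix f id * M‖ * ‖(1 : Matrix ι ι ℂ).submatrix id f‖ :=
        h ▸ Matrix.l2_opNorm_mul _ _
    _ ≤ (1 * ‖M‖) * 1 := by
        gcongr
        · exact (Matrix.l2_opNorm_mul _ _).trans (by gcongr; exact norm_one_submatrix_le hf)
        · exact norm_one_submatrix_id_le hf
    _ = ‖M‖ := by ring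

theorem norm_matrix_le_sum_blocks (M : Matrix (ι × κ) (ι × κ) ℂ) :
    ‖M‖ ≤ ∑ i, ∑ j, ‖(Matrix.of fun p q => M (i, p) (j, q) : Matrix κ κ ℂ)‖ := by
  let slice (z : EuclideanSpace ℂ (ι × κ)) (i : ι) : EuclideanSpace ℂ κ :=
    WithLp.toLp 2 fun p => z (i, p)
  have norm_slice_le (z : EuclideanSpace ℂ (ι × κ)) (i : ι) : ‖slice z i‖ ≤ ‖z‖ := by
    refine le_of_sq_le_sq ?_ (norm_nonneg _)
    rw [EuclideanSpace.norm_sq_eq, EuclideanSpace.norm_sq_eq, Fintype.sum_prod_type]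
    exact Finset.single_le_sum (f := fun i => ∑ p, ‖z (i, p)‖ ^ 2)
      (fun _ _ => by positivity) (Finset.mem_univ i)
  refine norm_matrix_le _ (by positivity) fun c y => ?_
  have h : ∑ p, ∑ q, star (y p) * M p q * c q = ∑ i, ∑ j, ∑ p, ∑ q,
      star (slice y i p) * (Matrix.of fun p q => M (i, p) (j, q) : Matrix κ κ ℂ) p q
        * slice c j q := by
    simp only [Fintype.sum_prod_type, Matrix.of_apply]
    exact Finset.sum_congr rfl fun i _ => Finset.sum_comm
  simp only [h, Finset.sum_mul]
  refine norm_sum_le_of_le _ fun i _ => norm_sum_le_of_le _ fun j _ =>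
    (norm_sum_star_mul_mul_le _ (slice c j) (slice y i)).trans ?_
  gcongr
  exacts [norm_slice_le c j, norm_slice_le y i]

end ScalarMatrix

/-! ### Abstract operator spaces -/

section ScalarAction

variable {V : Type*} [AddCommGroup V] [Module ℂ V]
variable {ι κ : Type*} [Fintype ι]

/-- The product `α · x · β` of a matrix `x` over a vector space with scalar matrices `α` and `β`,
as it occurs in Ruan's axioms. -/
def scalarConj (α : Matrix κ ι ℂ) (x : Matrix ι ι V) (β : Matrix ι κ ℂ) : Matrix κ κ V :=
  Matrix.of fun k l => ∑ i, ∑ j, (α k i * β j l) • x i j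

theorem map_scalarConj {W : Type*} [AddCommGroup W] [Module ℂ W] (f : V →ₗ[ℂ] W)
    (α : Matrix κ ι ℂ) (x : Matrix ι ι V) (β : Matrix ι κ ℂ) :
    (scalarConj α x β).map f = scalarConj α (x.map f) β := by
  ext k l
  simp [scalarConj]

theorem scalarConj_one_submatrix [DecidableEq ι] (f : κ → ι) (x : Matrix ι ι V) :
    scalarConj ((1 : Matrix ι ι ℂ).submatrix f id) x ((1 : Matrix ι ι ℂ).submatrix id f)
      = x.submatrix f f := by
  ext k l
  simp [scalarConj, Matrix.one_apply, Finset.sum_ite_eq, mul_ite, ite_smul]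

end ScalarAction

section AbstractOperatorSpace

variable {V : Type*} [NormedAddCommGroup V] [NormedSpace ℂ V] [MatrixNorms V] [IsOperatorSpace V]
variable {ι κ : Type} [Fintype ι] [DecidableEq ι] [Fintype κ] [DecidableEq κ]

open IsOperatorSpace

theorem matNorm_zero : matNorm (0 : Matrix ι ι V) = 0 := by
  simpa using matNorm_smul (0 : ℂ) (0 : Matrix ι ι V)

theorem matNorm_neg (x : Matrix ι ι V) : matNorm (-x) = matNorm x := by
  simpa using matNorm_smul (-1 : ℂ) x

theorem matNorm_nonneg (x : Matrix ι ι V) : 0 ≤ matNorm x := by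
  have h := matNorm_add_le x (-x)
  rw [add_neg_cancel, matNorm_zero, matNorm_neg] at h
  linarith

theorem matNorm_scalarConj_le (α : Matrix κ ι ℂ) (x : Matrix ι ι V) (β : Matrix ι κ ℂ) :
    matNorm (scalarConj α x β) ≤ ‖α‖ * matNorm x * ‖β‖ :=
  matNorm_mul_mul_le α x β

theorem matNorm_submatrix_le {f : κ → ι} (hf : Function.Injective f) (x : Matrix ι ι V) :
    matNorm (x.submatrix f f) ≤ matNorm x := by
  have h_nonneg := matNorm_nonneg x
  calc matNorm (x.submatrix f f)
      ≤ ‖(1 : Matrix ι ι ℂ).submatrix f id‖ * matNorm x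
          * ‖(1 : Matrix ι ι ℂ).submatrix id f‖ := by
        rw [← scalarConj_one_submatrix]
        exact matNorm_scalarConj_le _ _ _
    _ ≤ 1 * matNorm x * 1 := by
        gcongr
        exacts [norm_one_submatrix_le hf, norm_one_submatrix_id_le hf]
    _ = matNorm x := by ring

theorem norm_sum_star_mul_smul_le (x : Matrix ι ι V) (c y : EuclideanSpace ℂ ι) :
    ‖∑ i, ∑ j, (star (y i) * c j) • x i j‖ ≤ matNorm x * ‖c‖ * ‖y‖ := by
  let row : Matrix Unit ι ℂ := Matrix.of fun _ i => star (y i)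
  let col : Matrix ι Unit ℂ := Matrix.of fun i _ => c i
  have h_nonneg := matNorm_nonneg x
  calc ‖∑ i, ∑ j, (star (y i) * c j) • x i j‖ = matNorm (scalarConj row x col) :=
        (matNorm_one_by_one _).symm
    _ ≤ ‖row‖ * matNorm x * ‖col‖ := matNorm_scalarConj_le _ _ _
    _ ≤ ‖y‖ * matNorm x * ‖c‖ := by
        gcongr
        exacts [norm_row_le y, norm_col_le c]
    _ = matNorm x * ‖c‖ * ‖y‖ := by ring

theorem norm_map_functional_le (φ : StrongDual ℂ V) (x : Matrix ι ι V) :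
    ‖x.map φ‖ ≤ ‖φ‖ * matNorm x := by
  refine norm_matrix_le _ (mul_nonneg (norm_nonneg _) (matNorm_nonneg x)) fun c y => ?_
  have h : ∑ i, ∑ j, star (y i) * x.map φ i j * c j
      = φ (∑ i, ∑ j, (star (y i) * c j) • x i j) := by
    simp only [map_sum, map_smul, Matrix.map_apply, smul_eq_mul]
    exact Finset.sum_congr rfl fun i _ => Finset.sum_congr rfl fun j _ => by ring
  rw [h, mul_assoc, mul_assoc, ← mul_assoc (matNorm x)]
  exact φ.le_opNorm_of_le (norm_sum_star_mul_smul_le x c y)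

end AbstractOperatorSpace

/-! ### Matrices of functionals -/

section DualNorms

variable {V : Type*} [NormedAddCommGroup V] [NormedSpace ℂ V]

/-- The matrix pairing `⟪φ, x⟫ = [φ i j (x k l)]` of a matrix of functionals with a matrix of
vectors; the dual operator space structure is defined by its norm. -/
def matrixPairing {ι κ : Type*} (φ : Matrix ι ι (StrongDual ℂ V)) (x : Matrix κ κ V) :
    Matrix (ι × κ) (ι × κ) ℂ :=
  Matrix.of fun p q => φ p.1 q.1 (x p.2 q.2)

variable [MatrixNorms V]
variable {ι κ : Type} [Fintype ι] [DecidableEq ι] [Fintype κ] [DecidableEq κ]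

theorem dual_matNorm_le {φ : Matrix ι ι (StrongDual ℂ V)} {C : ℝ} (hC : 0 ≤ C)
    (h : ∀ (n : ℕ) (x : Matrix (Fin n) (Fin n) V), ‖matrixPairing φ x‖ ≤ C * matNorm x) :
    matNorm φ ≤ C :=
  csInf_le ⟨0, fun _ hC => hC.1⟩ ⟨hC, h⟩

theorem dual_matNorm_nonneg (φ : Matrix ι ι (StrongDual ℂ V)) : 0 ≤ matNorm φ :=
  Real.sInf_nonneg fun _ hC => hC.1

variable [IsOperatorSpace V]

theorem norm_matrixPairing_le_sum (φ : Matrix ι ι (StrongDual ℂ V)) (x : Matrix κ κ V) :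
    ‖matrixPairing φ x‖ ≤ (∑ i, ∑ j, ‖φ i j‖) * matNorm x := by
  refine (norm_matrix_le_sum_blocks _).trans ?_
  simp only [Finset.sum_mul]
  exact Finset.sum_le_sum fun i _ => Finset.sum_le_sum fun j _ => norm_map_functional_le (φ i j) x

theorem norm_matrixPairing_fin_le (φ : Matrix ι ι (StrongDual ℂ V)) {n : ℕ}
    (x : Matrix (Fin n) (Fin n) V) : ‖matrixPairing φ x‖ ≤ matNorm φ * matNorm x := by
  have h_sum := norm_matrixPairing_le_sum φ x
  rcases (matNorm_nonneg x).eq_or_lt with h_zero | h_pos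
  · rwa [← h_zero, mul_zero] at h_sum ⊢
  · rw [← div_le_iff₀ h_pos]
    exact le_csInf ⟨∑ i, ∑ j, ‖φ i j‖, by positivity, fun n x => norm_matrixPairing_le_sum φ x⟩
      fun C hC => (div_le_iff₀ h_pos).2 (hC.2 n x)

theorem norm_matrixPairing_le (φ : Matrix ι ι (StrongDual ℂ V)) (x : Matrix κ κ V) :
    ‖matrixPairing φ x‖ ≤ matNorm φ * matNorm x := by
  let e := Fintype.equivFin κ
  have h_reindex : matrixPairing φ x = (matrixPairing φ (x.submatrix e.symm e.symm)).submatrix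
      (Prod.map id e) (Prod.map id e) := by
    ext p q; simp [matrixPairing]
  calc ‖matrixPairing φ x‖ ≤ ‖matrixPairing φ (x.submatrix e.symm e.symm)‖ :=
        h_reindex ▸ norm_submatrix_le (Function.injective_id.prodMap e.injective) _
    _ ≤ matNorm φ * matNorm (x.submatrix e.symm e.symm) := norm_matrixPairing_fin_le _ _
    _ ≤ matNorm φ * matNorm x :=
        mul_le_mul_of_nonneg_left (matNorm_submatrix_le e.symm.injective x)
          (dual_matNorm_nonneg φ)

end DualNorms

/-! ### Concrete C*-algebras are operator spaces -/

section Concrete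

variable {H : Type*} [NormedAddCommGroup H] [InnerProductSpace ℂ H]
variable {ι κ : Type*} [Fintype ι] [Fintype κ]

theorem inner_scalarConj (α : Matrix κ ι ℂ) (x : Matrix ι ι (H →L[ℂ] H)) (β : Matrix ι κ ℂ)
    (X Y : κ → H) :
    ∑ k, ∑ l, ⟪Y k, scalarConj α x β k l (X l)⟫_ℂ
      = ∑ i, ∑ j, ⟪∑ k, α.conjTranspose i k • Y k, x i j (∑ l, β j l • X l)⟫_ℂ := by
  simp only [scalarConj, Matrix.of_apply, sum_apply, smul_apply, inner_sum, sum_inner,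
    inner_smul_left, inner_smul_right, map_sum, map_smul, Matrix.conjTranspose_apply,
    RCLike.star_def, RCLike.conj_conj, Finset.mul_sum]
  calc _ = ∑ k, ∑ i, ∑ l, ∑ j, α k i * β j l * ⟪Y k, x i j (X l)⟫_ℂ :=
        Finset.sum_congr rfl fun k _ => Finset.sum_comm
    _ = ∑ i, ∑ k, ∑ j, ∑ l, α k i * β j l * ⟪Y k, x i j (X l)⟫_ℂ := by
        rw [Finset.sum_comm]
        exact Finset.sum_congr rfl fun i _ => Finset.sum_congr rfl fun k _ => Finset.sum_comm
    _ = ∑ i, ∑ j, ∑ l, ∑ k, α k i * β j l * ⟪Y k, x i j (X l)⟫_ℂ := by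
        refine Finset.sum_congr rfl fun i _ => ?_
        rw [Finset.sum_comm]
        exact Finset.sum_congr rfl fun j _ => Finset.sum_comm
    _ = _ := by
        simp only [mul_assoc, mul_left_comm]

theorem norm_opMatrix_scalarConj_le [DecidableEq ι] [DecidableEq κ] (α : Matrix κ ι ℂ)
    (x : Matrix ι ι (H →L[ℂ] H)) (β : Matrix ι κ ℂ) :
    ‖opMatrix (scalarConj α x β)‖ ≤ ‖α‖ * ‖opMatrix x‖ * ‖β‖ := by
  refine norm_opMatrix_le _ (by positivity) fun X Y => ?_
  let X' : PiLp 2 fun _ : ι => H := WithLp.toLp 2 fun j => ∑ l, β j l • X l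
  let Y' : PiLp 2 fun _ : ι => H := WithLp.toLp 2 fun i => ∑ k, α.conjTranspose i k • Y k
  have hX : ‖X'‖ ≤ ‖β‖ * ‖X‖ := norm_toLp_sum_smul_le β X
  have hY : ‖Y'‖ ≤ ‖α‖ * ‖Y‖ := by
    rw [← Matrix.l2_opNorm_conjTranspose α]
    exact norm_toLp_sum_smul_le α.conjTranspose Y
  rw [inner_scalarConj]
  calc _ ≤ ‖opMatrix x‖ * ‖X'‖ * ‖Y'‖ := norm_sum_inner_le x X' Y'
    _ ≤ ‖opMatrix x‖ * (‖β‖ * ‖X‖) * (‖α‖ * ‖Y‖) := by gcongr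
    _ = ‖α‖ * ‖opMatrix x‖ * ‖β‖ * ‖X‖ * ‖Y‖ := by ring

theorem norm_opMatrix_submatrix_le {f : κ → ι} (hf : Function.Injective f)
    (x : Matrix ι ι (H →L[ℂ] H)) : ‖opMatrix (x.submatrix f f)‖ ≤ ‖opMatrix x‖ := by
  classical
  calc ‖opMatrix (x.submatrix f f)‖
      ≤ ‖(1 : Matrix ι ι ℂ).submatrix f id‖ * ‖opMatrix x‖
          * ‖(1 : Matrix ι ι ℂ).submatrix id f‖ := by
        rw [← scalarConj_one_submatrix]
        exact norm_opMatrix_scalarConj_le _ _ _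
    _ ≤ 1 * ‖opMatrix x‖ * 1 := by
        gcongr
        exacts [norm_one_submatrix_le hf, norm_one_submatrix_id_le hf]
    _ = ‖opMatrix x‖ := by ring

theorem norm_opMatrix_fromBlocks (x : Matrix ι ι (H →L[ℂ] H))
    (y : Matrix κ κ (H →L[ℂ] H)) :
    ‖opMatrix (Matrix.fromBlocks x 0 0 y)‖ = max ‖opMatrix x‖ ‖opMatrix y‖ :=
  le_antisymm (norm_opMatrix_fromBlocks_le x y) <| max_le
    (norm_opMatrix_submatrix_le Sum.inl_injective (Matrix.fromBlocks x 0 0 y))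
    (norm_opMatrix_submatrix_le Sum.inr_injective (Matrix.fromBlocks x 0 0 y))

variable [CompleteSpace H]

theorem starSubalgebra_matNorm_def {A : StarSubalgebra ℂ (H →L[ℂ] H)} {ι : Type} [Fintype ι]
    [DecidableEq ι] (x : Matrix ι ι A) :
    matNorm x = ‖opMatrix (x.map fun a => (a : H →L[ℂ] H))‖ := rfl

instance instIsOperatorSpaceStarSubalgebra (A : StarSubalgebra ℂ (H →L[ℂ] H)) :
    IsOperatorSpace A where
  matNorm_add_le x y := by
    simp only [starSubalgebra_matNorm_def]
    exact (congrArg norm (opMatrix_add _ _)).trans_le (norm_add_le _ _)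
  matNorm_smul c x := by
    simp only [starSubalgebra_matNorm_def]
    exact (congrArg norm (opMatrix_smul c _)).trans (norm_smul c _)
  matNorm_one_by_one v := by
    rw [starSubalgebra_matNorm_def]
    refine le_antisymm ((norm_opMatrix_le_sum _).trans (by simp)) ?_
    exact norm_entry_le_norm_opMatrix
      ((Matrix.of fun _ _ : Unit => v).map fun a : A => (a : H →L[ℂ] H)) () ()
  matNorm_mul_mul_le {_ κ} _ _ _ _ α x β :=
    (congrArg (fun y : Matrix κ κ (H →L[ℂ] H) => ‖opMatrix y‖)
      (map_scalarConj A.toSubalgebra.toSubmodule.subtype α x β)).trans_le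
        (norm_opMatrix_scalarConj_le α _ β)
  matNorm_fromBlocks x y := by
    simp only [starSubalgebra_matNorm_def, Matrix.fromBlocks_map]
    exact norm_opMatrix_fromBlocks _ _

end Concrete

/-! ### Quotients of operator spaces -/

section Quotient

theorem exists_map_mkQ_eq {ι V : Type*} [AddCommGroup V] [Module ℂ V]
    (W : Submodule ℂ V) (x : Matrix ι ι (V ⧸ W)) : ∃ y : Matrix ι ι V, y.map W.mkQ = x := by
  choose y hy using fun i j => W.mkQ_surjective (x i j)
  exact ⟨y, by ext i j; exact hy i j⟩

variable {V : Type*} [NormedAddCommGroup V] [NormedSpace ℂ V] [MatrixNorms V]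

/-- The quotient operator space structure on `V ⧸ W`: the norm on `M_ι(V ⧸ W)` is the quotient
norm of `M_ι(V)`. -/
instance instMatrixNormsQuotient (W : Submodule ℂ V) : MatrixNorms (V ⧸ W) where
  matNorm {ι} _ _ x := sInf {r | ∃ y : Matrix ι ι V, y.map W.mkQ = x ∧ r = matNorm y}

variable {ι κ : Type} [Fintype ι] [DecidableEq ι] [Fintype κ] [DecidableEq κ]
variable {W : Submodule ℂ V}

theorem le_quotient_matNorm {x : Matrix ι ι (V ⧸ W)} {C : ℝ}
    (h : ∀ y : Matrix ι ι V, y.map W.mkQ = x → C ≤ matNorm y) : C ≤ matNorm x := by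
  obtain ⟨y, hy⟩ := exists_map_mkQ_eq W x
  refine le_csInf ⟨_, y, hy, rfl⟩ ?_
  rintro _ ⟨y, hy, rfl⟩
  exact h y hy

theorem le_mul_quotient_matNorm {x : Matrix ι ι (V ⧸ W)} {C K : ℝ} (hK : 0 ≤ K)
    (h : ∀ y : Matrix ι ι V, y.map W.mkQ = x → C ≤ K * matNorm y) : C ≤ K * matNorm x := by
  rcases hK.eq_or_lt with rfl | hK
  · obtain ⟨y, hy⟩ := exists_map_mkQ_eq W x
    simpa using h y hy
  · rw [← div_le_iff₀' hK]
    exact le_quotient_matNorm fun y hy => (div_le_iff₀' hK).2 (h y hy)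

theorem exists_lift_matNorm_lt (x : Matrix ι ι (V ⧸ W)) {ε : ℝ} (hε : 0 < ε) :
    ∃ y : Matrix ι ι V, y.map W.mkQ = x ∧ matNorm y < matNorm x + ε := by
  by_contra! h
  linarith [le_quotient_matNorm h]

variable [IsOperatorSpace V]

open IsOperatorSpace

variable (W) in
theorem quotient_matNorm_map_le (y : Matrix ι ι V) : matNorm (y.map W.mkQ) ≤ matNorm y :=
  csInf_le ⟨0, by rintro _ ⟨y, _, rfl⟩; exact matNorm_nonneg y⟩ ⟨y, rfl, rfl⟩

theorem quotient_matNorm_add_le (x y : Matrix ι ι (V ⧸ W)) :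
    matNorm (x + y) ≤ matNorm x + matNorm y := by
  refine le_of_forall_pos_lt_add fun ε hε => ?_
  obtain ⟨x', rfl, hx⟩ := exists_lift_matNorm_lt x (half_pos hε)
  obtain ⟨y', rfl, hy⟩ := exists_lift_matNorm_lt y (half_pos hε)
  calc matNorm (x'.map W.mkQ + y'.map W.mkQ) ≤ matNorm (x' + y') :=
        quotient_matNorm_map_le W (x' + y')
    _ ≤ matNorm x' + matNorm y' := matNorm_add_le x' y'
    _ < matNorm (x'.map W.mkQ) + matNorm (y'.map W.mkQ) + ε := by linarith

theorem quotient_matNorm_smul_le (c : ℂ) (x : Matrix ι ι (V ⧸ W)) :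
    matNorm (c • x) ≤ ‖c‖ * matNorm x :=
  le_mul_quotient_matNorm (norm_nonneg c) fun y hy => by
    rw [← hy, ← matNorm_smul]
    exact quotient_matNorm_map_le W (c • y)

theorem quotient_matNorm_smul (c : ℂ) (x : Matrix ι ι (V ⧸ W)) :
    matNorm (c • x) = ‖c‖ * matNorm x := by
  refine le_antisymm (quotient_matNorm_smul_le c x) ?_
  rcases eq_or_ne c 0 with rfl | hc
  · simpa using le_quotient_matNorm fun y _ => matNorm_nonneg y
  · have h := quotient_matNorm_smul_le c⁻¹ (c • x)
    rwa [inv_smul_smul₀ hc, norm_inv, ← div_eq_inv_mul, le_div_iff₀' (norm_pos_iff.2 hc)] at h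

theorem quotient_matNorm_one_by_one (v : V ⧸ W) :
    matNorm (Matrix.of fun _ _ : Unit => v) = ‖v‖ := by
  refine le_antisymm (le_of_forall_pos_lt_add fun ε hε => ?_)
    (le_quotient_matNorm fun y hy => ?_)
  · obtain ⟨w, rfl, hw⟩ := Submodule.Quotient.norm_mk_lt v hε
    calc matNorm ((Matrix.of fun _ _ : Unit => w).map W.mkQ)
        ≤ matNorm (Matrix.of fun _ _ : Unit => w) := quotient_matNorm_map_le W _
      _ = ‖w‖ := matNorm_one_by_one w
      _ < ‖Submodule.Quotient.mk w‖ + ε := hw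
  · calc ‖v‖ = ‖W.mkQ (y () ())‖ := congrArg norm (congrFun₂ hy () ()).symm
      _ ≤ ‖y () ()‖ := Submodule.Quotient.norm_mk_le W _
      _ = matNorm y := (matNorm_one_by_one _).symm

theorem quotient_matNorm_scalarConj_le (α : Matrix κ ι ℂ) (x : Matrix ι ι (V ⧸ W))
    (β : Matrix ι κ ℂ) : matNorm (scalarConj α x β) ≤ ‖α‖ * matNorm x * ‖β‖ := by
  rw [mul_right_comm]
  refine le_mul_quotient_matNorm (by positivity) fun y hy => ?_
  rw [← hy, ← map_scalarConj, mul_right_comm]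
  exact (quotient_matNorm_map_le W _).trans (matNorm_scalarConj_le α y β)

theorem quotient_matNorm_submatrix_le {f : κ → ι} (hf : Function.Injective f)
    (x : Matrix ι ι (V ⧸ W)) : matNorm (x.submatrix f f) ≤ matNorm x :=
  le_quotient_matNorm fun y hy => by
    rw [← hy]
    exact (quotient_matNorm_map_le W (y.submatrix f f)).trans (matNorm_submatrix_le hf y)

theorem quotient_matNorm_fromBlocks (x : Matrix ι ι (V ⧸ W)) (y : Matrix κ κ (V ⧸ W)) :
    matNorm (Matrix.fromBlocks x 0 0 y) = max (matNorm x) (matNorm y) := by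
  refine le_antisymm (le_of_forall_pos_lt_add fun ε hε => ?_) (max_le ?_ ?_)
  · obtain ⟨x', rfl, hx⟩ := exists_lift_matNorm_lt x hε
    obtain ⟨y', rfl, hy⟩ := exists_lift_matNorm_lt y hε
    have h_lift : (Matrix.fromBlocks x' 0 0 y').map W.mkQ
        = Matrix.fromBlocks (x'.map W.mkQ) 0 0 (y'.map W.mkQ) := by
      rw [Matrix.fromBlocks_map, Matrix.map_zero _ (map_zero _), Matrix.map_zero _ (map_zero _)]
    rw [← h_lift, ← max_add_add_right]
    refine (quotient_matNorm_map_le W _).trans_lt ?_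
    rw [matNorm_fromBlocks]
    exact max_lt_max hx hy
  · exact quotient_matNorm_submatrix_le Sum.inl_injective (Matrix.fromBlocks x 0 0 y)
  · exact quotient_matNorm_submatrix_le Sum.inr_injective (Matrix.fromBlocks x 0 0 y)

instance instIsOperatorSpaceQuotient [IsClosed (W : Set V)] : IsOperatorSpace (V ⧸ W) where
  matNorm_add_le := quotient_matNorm_add_le
  matNorm_smul := quotient_matNorm_smul
  matNorm_one_by_one := quotient_matNorm_one_by_one
  matNorm_mul_mul_le := quotient_matNorm_scalarConj_le
  matNorm_fromBlocks := quotient_matNorm_fromBlocks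

end Quotient

/-! ### Operators on Hilbert space tensor products -/

section Tensor

variable {H : Type*} [NormedAddCommGroup H] [InnerProductSpace ℂ H]
variable {K : Type*} [NormedAddCommGroup K] [InnerProductSpace ℂ K]

theorem opTensor_tmul (a : H →L[ℂ] H) (b : K →L[ℂ] K) (x : H) (y : K) :
    opTensor a b (HilbertTensor.incl H K (x ⊗ₜ y)) = HilbertTensor.incl H K (a x ⊗ₜ b y) := by
  rw [opTensor_incl, TensorProduct.mapL_tmul]

theorem HilbertTensor.clm_ext {L : Type*} [NormedAddCommGroup L] [NormedSpace ℂ L]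
    {S T : HilbertTensor H K →L[ℂ] L}
    (h : ∀ x y, S (HilbertTensor.incl H K (x ⊗ₜ y)) = T (HilbertTensor.incl H K (x ⊗ₜ y))) :
    S = T := by
  refine ContinuousLinearMap.coeFn_injective ?_
  refine HilbertTensor.denseRange_incl.equalizer (by fun_prop) (by fun_prop) ?_
  have : S.toLinearMap ∘ₗ (HilbertTensor.incl H K).toLinearMap
      = T.toLinearMap ∘ₗ (HilbertTensor.incl H K).toLinearMap := by
    ext x y
    exact h x y
  exact congrArg DFunLike.coe this

theorem opTensor_add_left (a a' : H →L[ℂ] H) (b : K →L[ℂ] K) :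
    opTensor (a + a') b = opTensor a b + opTensor a' b :=
  HilbertTensor.clm_ext fun x y => by simp [opTensor_tmul, TensorProduct.add_tmul]

theorem opTensor_add_right (a : H →L[ℂ] H) (b b' : K →L[ℂ] K) :
    opTensor a (b + b') = opTensor a b + opTensor a b' :=
  HilbertTensor.clm_ext fun x y => by simp [opTensor_tmul, TensorProduct.tmul_add]

theorem opTensor_smul_left (c : ℂ) (a : H →L[ℂ] H) (b : K →L[ℂ] K) :
    opTensor (c • a) b = c • opTensor a b :=
  HilbertTensor.clm_ext fun x y => by
    rw [smul_apply, opTensor_tmul, opTensor_tmul, smul_apply, ← TensorProduct.smul_tmul', map_smul]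

theorem opTensor_smul_right (c : ℂ) (a : H →L[ℂ] H) (b : K →L[ℂ] K) :
    opTensor a (c • b) = c • opTensor a b :=
  HilbertTensor.clm_ext fun x y => by simp [opTensor_tmul]

theorem opTensor_mul (a a' : H →L[ℂ] H) (b b' : K →L[ℂ] K) :
    opTensor (a * a') (b * b') = opTensor a b * opTensor a' b' :=
  HilbertTensor.clm_ext fun x y => by simp [opTensor_tmul]

theorem opTensor_one : opTensor (1 : H →L[ℂ] H) (1 : K →L[ℂ] K) = 1 :=
  HilbertTensor.clm_ext fun x y => by simp [opTensor_tmul]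

theorem norm_opTensor_le (a : H →L[ℂ] H) (b : K →L[ℂ] K) : ‖opTensor a b‖ ≤ ‖a‖ * ‖b‖ := by
  refine ContinuousLinearMap.opNorm_le_bound _ (by positivity) fun x => ?_
  refine HilbertTensor.denseRange_incl.induction_on x
    (isClosed_le (by fun_prop) (by fun_prop)) fun x => ?_
  rw [opTensor_incl, LinearIsometry.norm_map, LinearIsometry.norm_map]
  exact ((TensorProduct.mapL a b).le_opNorm x).trans
    (by gcongr; exact TensorProduct.norm_mapL_le a b)

variable (H K) in
/-- The bilinear map `(a, b) ↦ a ⊗ b` on bounded operators. -/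
def opTensorₗ : (H →L[ℂ] H) →ₗ[ℂ] (K →L[ℂ] K) →ₗ[ℂ]
    (HilbertTensor H K →L[ℂ] HilbertTensor H K) :=
  LinearMap.mk₂ ℂ opTensor opTensor_add_left opTensor_smul_left opTensor_add_right
    opTensor_smul_right

theorem continuous_opTensor :
    Continuous fun p : (H →L[ℂ] H) × (K →L[ℂ] K) => opTensor p.1 p.2 :=
  ((opTensorₗ H K).mkContinuous₂ 1 fun a b => by
    rw [one_mul]; exact norm_opTensor_le a b).continuous₂

theorem opTensor_star [CompleteSpace H] [CompleteSpace K] (a : H →L[ℂ] H) (b : K →L[ℂ] K) :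
    opTensor (star a) (star b) = star (opTensor a b) := by
  refine HilbertTensor.clm_ext fun x y => ?_
  refine ext_inner_right ℂ fun z => ?_
  rw [ContinuousLinearMap.star_eq_adjoint (opTensor a b), ContinuousLinearMap.adjoint_inner_left]
  have : (innerSL ℂ (opTensor (star a) (star b) (HilbertTensor.incl H K (x ⊗ₜ y))))
      = (innerSL ℂ (HilbertTensor.incl H K (x ⊗ₜ y))) ∘L opTensor a b := by
    refine HilbertTensor.clm_ext fun x' y' => ?_
    simp [opTensor_tmul, ContinuousLinearMap.star_eq_adjoint,
      ContinuousLinearMap.adjoint_inner_left]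
  exact congrArg (fun f => f z) this

theorem exists_tmul_orthonormal {α : Type*} [Finite α] (X : α → H ⊗[ℂ] K) :
    ∃ (N : ℕ) (g : Fin N → K), Orthonormal ℂ g ∧
      ∃ X' : α → Fin N → H, ∀ a, X a = ∑ n, X' a n ⊗ₜ[ℂ] g n := by
  choose k m z h using fun a => TensorProduct.exists_sum_tmul_eq (X a)
  obtain ⟨N, g, hg, c, hc⟩ := exists_orthonormal_coords fun p : Σ a, Fin (k a) => z p.1 p.2
  refine ⟨N, g, hg, fun a n => ∑ j, c ⟨a, j⟩ n • m a j, fun a => ?_⟩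
  rw [h a]
  simp_rw [TensorProduct.sum_tmul]
  rw [Finset.sum_comm]
  refine Finset.sum_congr rfl fun j _ => ?_
  rw [hc ⟨a, j⟩, TensorProduct.tmul_sum]
  exact Finset.sum_congr rfl fun n _ => by
    rw [TensorProduct.tmul_smul, TensorProduct.smul_tmul']

theorem denseRange_incl_pi (α : Type*) :
    DenseRange fun X : α → H ⊗[ℂ] K =>
      (WithLp.toLp 2 fun a => HilbertTensor.incl H K (X a) :
        PiLp 2 fun _ : α => HilbertTensor H K) := by
  have h_dense : DenseRange (Pi.map fun _ : α => (HilbertTensor.incl H K : H ⊗[ℂ] K → _)) :=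
    DenseRange.piMap fun _ => HilbertTensor.denseRange_incl
  exact (WithLp.toLp_surjective 2).denseRange.comp h_dense (PiLp.continuous_toLp 2 _)

section Slice

variable {ι κ ν S : Type*} [Fintype ι] [Fintype κ] [Fintype ν]

/-- The embedding `H^(ι × ν) → (H ⊗ K)^(ι × κ)` given by a family `g` of vectors in `K^κ`. -/
def sliceEmb (g : ν → PiLp 2 fun _ : κ => K) (X : PiLp 2 fun _ : ι × ν => H) :
    PiLp 2 fun _ : ι × κ => HilbertTensor H K :=
  WithLp.toLp 2 fun p => ∑ n, HilbertTensor.incl H K (X (p.1, n) ⊗ₜ g n p.2)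

theorem sum_inner_sum_tmul (g : ν → PiLp 2 fun _ : κ => K) (a : H →L[ℂ] H)
    (T : Matrix κ κ (K →L[ℂ] K)) (X Y : ν → H) :
    ∑ k, ∑ l, ⟪∑ n, HilbertTensor.incl H K (Y n ⊗ₜ g n k),
        opTensor a (T k l) (∑ n, HilbertTensor.incl H K (X n ⊗ₜ g n l))⟫_ℂ
      = ∑ n, ∑ m, ⟪g n, opMatrix T (g m)⟫_ℂ * ⟪Y n, a (X m)⟫_ℂ := by
  simp only [map_sum, opTensor_tmul, sum_inner, inner_sum,
    LinearIsometry.inner_map_map, TensorProduct.inner_tmul, inner_opMatrix, Finset.sum_mul]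
  calc _ = ∑ k, ∑ l, ∑ n, ∑ m, ⟪Y n, a (X m)⟫_ℂ * ⟪g n k, T k l (g m l)⟫_ℂ :=
        Finset.sum_congr rfl fun k _ => Finset.sum_congr rfl fun l _ => Finset.sum_comm
    _ = ∑ k, ∑ n, ∑ l, ∑ m, ⟪Y n, a (X m)⟫_ℂ * ⟪g n k, T k l (g m l)⟫_ℂ :=
        Finset.sum_congr rfl fun k _ => Finset.sum_comm
    _ = ∑ n, ∑ k, ∑ l, ∑ m, ⟪Y n, a (X m)⟫_ℂ * ⟪g n k, T k l (g m l)⟫_ℂ := Finset.sum_comm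
    _ = ∑ n, ∑ k, ∑ m, ∑ l, ⟪Y n, a (X m)⟫_ℂ * ⟪g n k, T k l (g m l)⟫_ℂ :=
        Finset.sum_congr rfl fun n _ => Finset.sum_congr rfl fun k _ => Finset.sum_comm
    _ = ∑ n, ∑ m, ∑ k, ∑ l, ⟪Y n, a (X m)⟫_ℂ * ⟪g n k, T k l (g m l)⟫_ℂ :=
        Finset.sum_congr rfl fun n _ => Finset.sum_comm
    _ = _ := by simp only [mul_comm]

theorem sum_prod_prod_comm {ι α S M : Type*} [Fintype ι] [Fintype α] [AddCommMonoid M]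
    (s : Finset S) (F : ι × α → ι × α → S → M) :
    ∑ p, ∑ q, ∑ t ∈ s, F p q t = ∑ t ∈ s, ∑ i, ∑ j, ∑ k, ∑ l, F (i, k) (j, l) t := by
  simp_rw [Finset.sum_comm (t := s)]
  refine Finset.sum_congr rfl fun t _ => ?_
  simp_rw [Fintype.sum_prod_type]
  exact Finset.sum_congr rfl fun i _ => Finset.sum_comm

theorem sum_inner_sliceEmb (g : ν → PiLp 2 fun _ : κ => K) (s : Finset S)
    (a : S → Matrix ι ι (H →L[ℂ] H)) (T : S → Matrix κ κ (K →L[ℂ] K))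
    (X Y : PiLp 2 fun _ : ι × ν => H) :
    ∑ p, ∑ q, ⟪sliceEmb g Y p,
        (∑ t ∈ s, opTensor (a t p.1 q.1) (T t p.2 q.2)) (sliceEmb g X q)⟫_ℂ
      = ∑ p, ∑ q, ⟪Y p,
        (∑ t ∈ s, ⟪g p.2, opMatrix (T t) (g q.2)⟫_ℂ • a t p.1 q.1) (X q)⟫_ℂ := by
  simp only [sum_apply, inner_sum, smul_apply, inner_smul_right]
  rw [sum_prod_prod_comm, sum_prod_prod_comm]
  refine Finset.sum_congr rfl fun t _ => Finset.sum_congr rfl fun i _ =>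
    Finset.sum_congr rfl fun j _ => ?_
  exact sum_inner_sum_tmul g (a t i j) (T t) (fun n => X (j, n)) (fun n => Y (i, n))

theorem norm_sliceEmb {g : ν → PiLp 2 fun _ : κ => K} (hg : Orthonormal ℂ g)
    (X : PiLp 2 fun _ : ι × ν => H) : ‖sliceEmb g X‖ = ‖X‖ := by
  classical
  have h : ⟪sliceEmb g X, sliceEmb g X⟫_ℂ = ⟪X, X⟫_ℂ := by
    rw [PiLp.inner_apply, PiLp.inner_apply, Fintype.sum_prod_type, Fintype.sum_prod_type]
    refine Finset.sum_congr rfl fun i _ => ?_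
    simp only [sliceEmb, sum_inner, inner_sum, LinearIsometry.inner_map_map,
      TensorProduct.inner_tmul]
    rw [Finset.sum_comm]
    refine Finset.sum_congr rfl fun n _ => ?_
    rw [Finset.sum_comm]
    simp_rw [← Finset.mul_sum, ← PiLp.inner_apply, orthonormal_iff_ite.1 hg]
    simp
  rw [@norm_eq_sqrt_re_inner ℂ, h, ← @norm_eq_sqrt_re_inner ℂ]

theorem norm_opMatrix_slice_le {g : ν → PiLp 2 fun _ : κ => K} (hg : Orthonormal ℂ g)
    (s : Finset S) (a : S → Matrix ι ι (H →L[ℂ] H)) (T : S → Matrix κ κ (K →L[ℂ] K)) :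
    ‖opMatrix (Matrix.of fun p q : ι × ν =>
        ∑ t ∈ s, ⟪g p.2, opMatrix (T t) (g q.2)⟫_ℂ • a t p.1 q.1)‖
      ≤ ‖opMatrix (Matrix.of fun p q : ι × κ =>
        ∑ t ∈ s, opTensor (a t p.1 q.1) (T t p.2 q.2))‖ := by
  refine norm_opMatrix_le _ (ContinuousLinearMap.opNorm_nonneg _) fun X Y => ?_
  simp only [Matrix.of_apply]
  rw [← sum_inner_sliceEmb, ← norm_sliceEmb hg X, ← norm_sliceEmb hg Y]
  exact norm_sum_inner_le (Matrix.of fun p q : ι × κ =>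
        ∑ t ∈ s, opTensor (a t p.1 q.1) (T t p.2 q.2)) _ _

omit [Fintype κ] in
theorem exists_lTensor_proj_eq [Finite κ] (X : κ → H ⊗[ℂ] K) :
    ∃ Z : H ⊗[ℂ] (PiLp 2 fun _ : κ => K),
      ∀ k, (PiLp.projₗ 2 (𝕜 := ℂ) (fun _ : κ => K) k).lTensor H Z = X k := by
  classical
  cases nonempty_fintype κ
  let single (k : κ) : K →ₗ[ℂ] PiLp 2 fun _ : κ => K :=
    (WithLp.linearEquiv 2 ℂ (κ → K)).symm.toLinearMap ∘ₗ LinearMap.single ℂ (fun _ => K) k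
  refine ⟨∑ l, (single l).lTensor H (X l), fun k => ?_⟩
  rw [map_sum, Finset.sum_eq_single k]
  · have h : PiLp.projₗ 2 (𝕜 := ℂ) (fun _ : κ => K) k ∘ₗ single k = LinearMap.id := by
      ext x; simp [single]
    rw [← LinearMap.comp_apply, ← LinearMap.lTensor_comp, h, LinearMap.lTensor_id,
      LinearMap.id_apply]
  · intro l _ hl
    have h : PiLp.projₗ 2 (𝕜 := ℂ) (fun _ : κ => K) k ∘ₗ single l = 0 := by
      ext x; simp [single, hl.symm]
    rw [← LinearMap.comp_apply, ← LinearMap.lTensor_comp, h, LinearMap.lTensor_zero,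
      LinearMap.zero_apply]
  · simp

omit [Fintype ι] in
theorem exists_sliceEmb_eq [Finite ι] (X Y : ι × κ → H ⊗[ℂ] K) :
    ∃ (N : ℕ) (g : Fin N → PiLp 2 fun _ : κ => K), Orthonormal ℂ g ∧
      ∃ X' Y' : PiLp 2 fun _ : ι × Fin N => H,
        (WithLp.toLp 2 fun p => HilbertTensor.incl H K (X p)) = sliceEmb g X' ∧
        (WithLp.toLp 2 fun p => HilbertTensor.incl H K (Y p)) = sliceEmb g Y' := by
  cases nonempty_fintype ι
  choose up h_up using fun (W : ι × κ → H ⊗[ℂ] K) i => exists_lTensor_proj_eq fun k => W (i, k)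
  obtain ⟨N, g, hg, Z, hZ⟩ := exists_tmul_orthonormal (Sum.elim (up X) (up Y))
  have h_emb (W : ι × κ → H ⊗[ℂ] K) (W' : ι → Fin N → H)
      (hW : ∀ i, up W i = ∑ n, W' i n ⊗ₜ[ℂ] g n) :
      (WithLp.toLp 2 fun p => HilbertTensor.incl H K (W p))
        = sliceEmb g (WithLp.toLp 2 fun p : ι × Fin N => W' p.1 p.2) := by
    ext p
    have h := h_up W p.1 p.2
    rw [hW, map_sum] at h
    simp only [sliceEmb, ← map_sum]
    rw [← h]
    simp
  exact ⟨N, g, hg, _, _, h_emb X _ fun i => hZ (.inl i), h_emb Y _ fun i => hZ (.inr i)⟩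

theorem norm_opMatrix_opTensor_le (s : Finset S) (a : S → Matrix ι ι (H →L[ℂ] H))
    (T : S → Matrix κ κ (K →L[ℂ] K)) {C : ℝ} (hC : 0 ≤ C)
    (h : ∀ (N : ℕ) (g : Fin N → PiLp 2 fun _ : κ => K), Orthonormal ℂ g →
      ‖opMatrix (Matrix.of fun p q : ι × Fin N =>
        ∑ t ∈ s, ⟪g p.2, opMatrix (T t) (g q.2)⟫_ℂ • a t p.1 q.1)‖ ≤ C) :
    ‖opMatrix (Matrix.of fun p q : ι × κ =>
        ∑ t ∈ s, opTensor (a t p.1 q.1) (T t p.2 q.2))‖ ≤ C := by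
  refine opNorm_le_of_norm_inner_le _ hC fun X Y => ?_
  refine (denseRange_incl_pi (H := H) (K := K) (ι × κ)).induction_on₂
    (isClosed_le (by fun_prop) (by fun_prop)) (fun X Y => ?_) X Y
  -- Both vectors lie in the range of one isometry `sliceEmb g`.
  obtain ⟨N, g, hg, X', Y', hX, hY⟩ := exists_sliceEmb_eq X Y
  rw [hX, hY, inner_opMatrix]
  simp only [Matrix.of_apply]
  rw [sum_inner_sliceEmb, norm_sliceEmb hg, norm_sliceEmb hg]
  refine (norm_sum_inner_le (Matrix.of fun p q : ι × Fin N =>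
    ∑ t ∈ s, ⟪g p.2, opMatrix (T t) (g q.2)⟫_ℂ • a t p.1 q.1) X' Y').trans ?_
  gcongr
  exact h N g hg

end Slice

end Tensor

/-! ### Star homomorphisms and matrices -/

section CompleteContractivity

variable {H : Type*} [NormedAddCommGroup H] [InnerProductSpace ℂ H] [CompleteSpace H]
variable {A : Type*} [CStarAlgebra A] {ι : Type*} [Fintype ι]

/-- The *-representation of `M_ι(A)` on `H^ι` induced by a *-representation of `A` on `H`. -/
def opMatrixHom (Φ : A →⋆ₐ[ℂ] (H →L[ℂ] H)) :
    CStarMatrix ι ι A →⋆ₙₐ[ℂ]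
      ((PiLp 2 fun _ : ι => H) →L[ℂ] (PiLp 2 fun _ : ι => H)) where
  toFun M := opMatrix (Matrix.of fun i j => Φ (M i j))
  map_smul' c M := by
    rw [← opMatrix_smul]; congr 1; ext i j : 2; simp
  map_zero' := by ext; simp [opMatrix_apply]
  map_add' M N := by
    rw [← opMatrix_add]; congr 1; ext i j : 2; simp
  map_mul' M N := by
    rw [← opMatrix_mul]; congr 1; ext i j : 2; simp [Matrix.mul_apply, CStarMatrix.mul_apply]
  map_star' M := by
    rw [← opMatrix_star]; congr 1; ext i j : 2
    simp [CStarMatrix.star_apply, map_star]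

theorem norm_opMatrix_map_le {K : Type*} [NormedAddCommGroup K] [InnerProductSpace ℂ K]
    [CompleteSpace K] (Φ : A →⋆ₐ[ℂ] (H →L[ℂ] H)) (Ψ : A →⋆ₐ[ℂ] (K →L[ℂ] K))
    (hΨ : Function.Injective Ψ) (x : Matrix ι ι A) :
    ‖opMatrix (x.map Φ)‖ ≤ ‖opMatrix (x.map Ψ)‖ := by
  let _ := CStarAlgebra.spectralOrder A
  have := CStarAlgebra.spectralOrderedRing A
  have h_contractive := NonUnitalStarAlgHom.norm_apply_le (opMatrixHom (ι := ι) Φ)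
    (CStarMatrix.ofMatrix x)
  have h_isometric := NonUnitalStarAlgHom.norm_map (opMatrixHom (ι := ι) Ψ) (fun M N h => by
    ext i j
    exact hΨ (congrFun (congrFun (opMatrix_injective h) i) j)) (CStarMatrix.ofMatrix x)
  exact h_contractive.trans h_isometric.symm.le

end CompleteContractivity

/-! ### Algebras generated by a group -/

section GroupGenerated

variable {Γ : Type*} [Group Γ]

theorem adjoin_range_eq_span {A : Type*} [Ring A] [StarRing A] [Algebra ℂ A] [StarModule ℂ A]
    (f : Γ →* A) (hf : ∀ s, star (f s) = f s⁻¹) :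
    Subalgebra.toSubmodule (StarAlgebra.adjoin ℂ (Set.range f)).toSubalgebra
      = Submodule.span ℂ (Set.range f) := by
  rw [StarAlgebra.adjoin_eq_span]
  have h_union : Set.range f ∪ star (Set.range f) = (MonoidHom.mrange f : Set A) := by
    rw [MonoidHom.coe_mrange, Set.union_eq_left]
    rintro x ⟨s, hs⟩
    exact ⟨s⁻¹, by rw [← hf, hs, star_star]⟩
  rw [h_union, Submonoid.closure_eq, MonoidHom.coe_mrange]

theorem denseRange_linearCombination {A : Type*} [NormedRing A] [StarRing A] [NormedAlgebra ℂ A]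
    [StarModule ℂ A] [ContinuousStar A] (f : Γ →* A) (hf : ∀ s, star (f s) = f s⁻¹)
    {B : StarSubalgebra ℂ A} (hB : B = (StarAlgebra.adjoin ℂ (Set.range f)).topologicalClosure)
    (g : Γ → B) (hg : ∀ s, (g s : A) = f s) :
    DenseRange (Finsupp.linearCombination ℂ g) := by
  intro x
  have hx : (x : A) ∈ closure (Submodule.span ℂ (Set.range f) : Set A) := by
    rw [← adjoin_range_eq_span f hf]
    exact hB.le x.2
  refine closure_subtype.2 (closure_mono (fun y hy => ?_) hx)
  obtain ⟨c, rfl⟩ := (Finsupp.mem_span_range_iff_exists_finsupp).1 hy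
  refine ⟨_, ⟨c, rfl⟩, ?_⟩
  simp [Finsupp.linearCombination_apply, Finsupp.sum, hg]

theorem linearCombination_coeff_mul {R : Type*} [Ring R] [Algebra ℂ R] (f : Γ →* R)
    (c d : Γ →₀ ℂ) :
    Finsupp.linearCombination ℂ f (MonoidAlgebra.ofCoeff c * MonoidAlgebra.ofCoeff d).coeff
      = Finsupp.linearCombination ℂ f c * Finsupp.linearCombination ℂ f d := by
  simpa only [MonoidAlgebra.lift_apply, Finsupp.linearCombination_apply] using
    map_mul (MonoidAlgebra.lift ℂ R Γ f) (MonoidAlgebra.ofCoeff c) (MonoidAlgebra.ofCoeff d)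

theorem exists_starAlgHom_of_norm_le {A B : Type*} [NormedRing A] [NormedAlgebra ℂ A] [StarRing A]
    [ContinuousStar A] [StarModule ℂ A] [NormedRing B] [NormedAlgebra ℂ B] [StarRing B]
    [ContinuousStar B] [StarModule ℂ B] [CompleteSpace B] (f : Γ →* A) (g : Γ →* B)
    (hf : ∀ s, star (f s) = f s⁻¹) (hg : ∀ s, star (g s) = g s⁻¹)
    (hd : DenseRange (Finsupp.linearCombination ℂ f))
    (hn : ∀ c, ‖Finsupp.linearCombination ℂ g c‖ ≤ ‖Finsupp.linearCombination ℂ f c‖) :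
    ∃ Φ : A →⋆ₐ[ℂ] B, ∀ s, Φ (f s) = g s := by
  let F : A →L[ℂ] B := (Finsupp.linearCombination ℂ g).extendOfNorm (Finsupp.linearCombination ℂ f)
  have hF : ∀ c, F (Finsupp.linearCombination ℂ f c) = Finsupp.linearCombination ℂ g c :=
    LinearMap.extendOfNorm_eq hd ⟨1, by simpa using hn⟩
  have hFs : ∀ s, F (f s) = g s := fun s => by simpa using hF (Finsupp.single s 1)
  have hF1 : F 1 = 1 := by rw [← map_one f, hFs, map_one]
  have hmul : ∀ x y, F (x * y) = F x * F y := fun x y => by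
    refine hd.induction_on₂ (isClosed_eq (by fun_prop) (by fun_prop)) (fun c d => ?_) x y
    rw [← linearCombination_coeff_mul, hF, hF, hF, linearCombination_coeff_mul]
  have hstar : ∀ x, F (star x) = star (F x) := fun x => by
    refine hd.induction_on x (isClosed_eq (by fun_prop) (by fun_prop)) fun c => ?_
    induction c using Finsupp.induction_linear with
    | zero => simp
    | add c c' hc hc' => simp [hc, hc']
    | single s z => simp [hf, hg, hFs]
  exact ⟨{ toFun := F
           map_one' := hF1
           map_mul' := hmul
           map_zero' := map_zero F
           map_add' := map_add F
           commutes' := fun r => by rw [Algebra.algebraMap_eq_smul_one, map_smul, hF1,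
             Algebra.algebraMap_eq_smul_one]
           map_star' := hstar }, hFs⟩

end GroupGenerated

/-! ### The universal representation -/

section UnitaryReps

variable {G : Type*} [Group G] {H : Type*} [NormedAddCommGroup H] [InnerProductSpace ℂ H]

/-- A unitary representation as a homomorphism into the bounded operators. -/
def UnitaryRep.opHom (π : UnitaryRep G H) : G →* (H →L[ℂ] H) where
  toFun := UnitaryRep.op π
  map_one' := by ext x; simp
  map_mul' s t := by ext x; simp

variable [CompleteSpace H]

theorem UnitaryRep.star_op (π : UnitaryRep G H) (s : G) :
    star (UnitaryRep.op π s) = UnitaryRep.op π s⁻¹ := by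
  rw [ContinuousLinearMap.star_eq_adjoint]
  refine ((ContinuousLinearMap.eq_adjoint_iff _ _).2 fun x y => ?_).symm
  rw [UnitaryRep.op_apply, UnitaryRep.op_apply, ← LinearIsometryEquiv.inner_map_map (π s)]
  congr 1
  simp

/-- The canonical homomorphism of `G` into the C*-algebra generated by a representation. -/
def UnitaryRep.cstarHom (π : UnitaryRep G H) : G →* UnitaryRep.cstar π where
  toFun := UnitaryRep.cstarOf π
  map_one' := Subtype.ext (map_one (UnitaryRep.opHom π))
  map_mul' s t := Subtype.ext (map_mul (UnitaryRep.opHom π) s t)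

theorem UnitaryRep.cstarHom_apply (π : UnitaryRep G H) (s : G) :
    UnitaryRep.cstarHom π s = UnitaryRep.cstarOf π s := rfl

theorem UnitaryRep.star_cstarHom (π : UnitaryRep G H) (s : G) :
    star (UnitaryRep.cstarHom π s) = UnitaryRep.cstarHom π s⁻¹ :=
  Subtype.ext (UnitaryRep.star_op π s)

theorem UnitaryRep.denseRange_cstarHom (π : UnitaryRep G H) :
    DenseRange (Finsupp.linearCombination ℂ (UnitaryRep.cstarHom π)) :=
  denseRange_linearCombination (UnitaryRep.opHom π) (UnitaryRep.star_op π) rfl _ fun _ => rfl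

theorem UnitaryRep.coe_linearCombination_cstarHom (π : UnitaryRep G H) (c : G →₀ ℂ) :
    (Finsupp.linearCombination ℂ (UnitaryRep.cstarHom π) c : H →L[ℂ] H)
      = Finsupp.linearCombination ℂ (UnitaryRep.op π) c := by
  simp [Finsupp.linearCombination_apply, Finsupp.sum, UnitaryRep.cstarHom_apply,
    UnitaryRep.cstarOf]

end UnitaryReps

section Universal

variable {G : Type u} [Group G]

/-- The matrix of operators `∑ s ∈ S, c(s) ⊗ π(s)` with scalar coefficient matrices `c(s)`. -/
def repMatrix {H : Type*} [NormedAddCommGroup H] [InnerProductSpace ℂ H] {ι : Type*}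
    (π : UnitaryRep G H) (S : Finset G) (c : G → Matrix ι ι ℂ) : Matrix ι ι (H →L[ℂ] H) :=
  Matrix.of fun i j => ∑ s ∈ S, c s i j • UnitaryRep.op π s

theorem repMatrix_apply {H : Type*} [NormedAddCommGroup H] [InnerProductSpace ℂ H] {ι : Type*}
    (π : UnitaryRep G H) (S : Finset G) (c : G → Matrix ι ι ℂ) (i j : ι) :
    repMatrix π S c i j = ∑ s ∈ S, c s i j • UnitaryRep.op π s := rfl

theorem universalRep_apply (s : G) (x : lp (fun σ : CyclicRep G => σ.carrier) 2)
    (σ : CyclicRep G) : (universalRep G s x : ∀ σ : CyclicRep G, σ.carrier) σ = σ.rep s (x σ) := rfl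

theorem repMatrix_universalRep_apply {ι : Type*} (S : Finset G) (c : G → Matrix ι ι ℂ) (i j : ι)
    (x : lp (fun σ : CyclicRep G => σ.carrier) 2) (σ : CyclicRep G) :
    (repMatrix (universalRep G) S c i j x : ∀ σ : CyclicRep G, σ.carrier) σ
      = repMatrix σ.rep S c i j (x σ) := by
  simp only [repMatrix_apply, sum_apply, smul_apply, UnitaryRep.op_apply, lp.coeFn_sum,
    Finset.sum_apply, lp.coeFn_smul, Pi.smul_apply, universalRep_apply]

theorem hasSum_norm_sq_toLp_apply {I ι : Type*} [Fintype ι] {E : I → Type*}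
    [∀ i, NormedAddCommGroup (E i)] (X : PiLp 2 fun _ : ι => lp E 2) :
    HasSum (fun k => ‖(WithLp.toLp 2 fun i => X i k : PiLp 2 fun _ : ι => E k)‖ ^ 2)
      (‖X‖ ^ 2) := by
  simp_rw [PiLp.norm_sq_eq_of_L2]
  exact hasSum_sum fun i _ => by simpa using lp.hasSum_norm (p := 2) (by simp) (X i)

theorem norm_repMatrix_universalRep_le {ι : Type*} [Fintype ι] (S : Finset G)
    (c : G → Matrix ι ι ℂ) {C : ℝ} (hC : 0 ≤ C)
    (h : ∀ σ : CyclicRep G, ‖opMatrix (repMatrix σ.rep S c)‖ ≤ C) :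
    ‖opMatrix (repMatrix (universalRep G) S c)‖ ≤ C := by
  refine ContinuousLinearMap.opNorm_le_bound _ hC fun X => le_of_sq_le_sq ?_ (by positivity)
  rw [mul_pow]
  refine hasSum_le (fun σ => ?_) (hasSum_norm_sq_toLp_apply _)
    ((hasSum_norm_sq_toLp_apply X).mul_left (C ^ 2))
  have h_coord : (WithLp.toLp 2 fun i => opMatrix (repMatrix (universalRep G) S c) X i σ :
      PiLp 2 fun _ : ι => σ.carrier)
      = opMatrix (repMatrix σ.rep S c) (WithLp.toLp 2 fun i => X i σ) := by
    ext i
    simp only [opMatrix_apply, lp.coeFn_sum, Finset.sum_apply, repMatrix_universalRep_apply]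
  rw [h_coord, ← mul_pow]
  gcongr
  exact ContinuousLinearMap.le_of_opNorm_le _ (h σ) _

theorem norm_linearCombination_cyclicRep_le (σ : CyclicRep G) (c : G →₀ ℂ) (x : σ.carrier) :
    ‖Finsupp.linearCombination ℂ (UnitaryRep.op σ.rep) c x‖
      ≤ ‖Finsupp.linearCombination ℂ (UnitaryRep.op (universalRep G)) c‖ * ‖x‖ := by
  classical
  let X : lp (fun σ : CyclicRep G => σ.carrier) 2 := lp.single 2 σ x
  have h : (Finsupp.linearCombination ℂ (UnitaryRep.op (universalRep G)) c X :
      ∀ σ : CyclicRep G, σ.carrier) σ = Finsupp.linearCombination ℂ (UnitaryRep.op σ.rep) c x := by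
    simp only [Finsupp.linearCombination_apply, Finsupp.sum, sum_apply, smul_apply,
      UnitaryRep.op_apply, lp.coeFn_sum, Finset.sum_apply, lp.coeFn_smul, Pi.smul_apply,
      universalRep_apply, X, lp.single_apply_self]
  rw [← h]
  refine (lp.norm_apply_le_norm (by simp) _ σ).trans
    ((ContinuousLinearMap.le_opNorm _ _).trans_eq ?_)
  rw [lp.norm_single (by simp)]

theorem norm_linearCombination_op_le {H : Type u} [NormedAddCommGroup H] [InnerProductSpace ℂ H]
    [CompleteSpace H] (π : UnitaryRep G H) (c : G →₀ ℂ) :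
    ‖Finsupp.linearCombination ℂ (UnitaryRep.op π) c‖
      ≤ ‖Finsupp.linearCombination ℂ (UnitaryRep.op (universalRep G)) c‖ := by
  refine ContinuousLinearMap.opNorm_le_bound _ (norm_nonneg _) fun ξ => ?_
  let M := UnitaryRep.cyclicSubspace π ξ
  have : CompleteSpace M := (Submodule.isClosed_topologicalClosure _).completeSpace_coe
  let σ : CyclicRep G := ⟨M, UnitaryRep.sub π M (UnitaryRep.cyclicSubspace_invariant π ξ), _,
    UnitaryRep.isCyclicVector_sub π ξ⟩
  let ξ' : M := ⟨ξ, UnitaryRep.self_mem_cyclicSubspace π ξ⟩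
  have h_coe : ((Finsupp.linearCombination ℂ (UnitaryRep.op σ.rep) c ξ' : M) : H)
      = Finsupp.linearCombination ℂ (UnitaryRep.op π) c ξ := by
    simp only [Finsupp.linearCombination_apply, Finsupp.sum, sum_apply, smul_apply,
      UnitaryRep.op_apply]
    simp [σ, ξ']
  rw [← h_coe]
  exact norm_linearCombination_cyclicRep_le σ c ξ'

instance instIsClosedCstar {H : Type*} [NormedAddCommGroup H] [InnerProductSpace ℂ H]
    [CompleteSpace H] (π : UnitaryRep G H) : IsClosed (UnitaryRep.cstar π : Set (H →L[ℂ] H)) :=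
  StarSubalgebra.isClosed_topologicalClosure _

theorem exists_starAlgHom_fullCStar {H : Type u} [NormedAddCommGroup H] [InnerProductSpace ℂ H]
    [CompleteSpace H] (π : UnitaryRep G H) :
    ∃ Φ : fullCStar G →⋆ₐ[ℂ] (H →L[ℂ] H), ∀ s, Φ (fullCStarOf G s) = UnitaryRep.op π s := by
  refine exists_starAlgHom_of_norm_le (UnitaryRep.cstarHom (universalRep G)) (UnitaryRep.opHom π)
    (UnitaryRep.star_cstarHom _) (UnitaryRep.star_op π) (UnitaryRep.denseRange_cstarHom _)
    fun c => ?_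
  refine (norm_linearCombination_op_le π c).trans_eq ?_
  rw [← UnitaryRep.coe_linearCombination_cstarHom]
  rfl

/-- Matrices over `C*(G)` of the form `∑ s ∈ S, c(s) ⊗ ϖ(s)`. -/
def fullMatrix {ι : Type*} (S : Finset G) (c : G → Matrix ι ι ℂ) :
    Matrix ι ι (fullCStar G) :=
  Matrix.of fun i j => ∑ s ∈ S, c s i j • fullCStarOf G s

theorem fullMatrix_map_coe {ι : Type*} (S : Finset G) (c : G → Matrix ι ι ℂ) :
    ((fullMatrix S c).map fun a => (a : lp (fun σ : CyclicRep G => σ.carrier) 2 →L[ℂ] _))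
      = repMatrix (universalRep G) S c := by
  ext i j : 2
  simp [fullMatrix, repMatrix_apply, UnitaryRep.cstarOf]

theorem matNorm_fullMatrix {ι : Type} [Fintype ι] [DecidableEq ι] (S : Finset G)
    (c : G → Matrix ι ι ℂ) :
    matNorm (fullMatrix S c) = ‖opMatrix (repMatrix (universalRep G) S c)‖ := by
  rw [starSubalgebra_matNorm_def, fullMatrix_map_coe]

theorem norm_repMatrix_le_universalRep {H : Type u} [NormedAddCommGroup H] [InnerProductSpace ℂ H]
    [CompleteSpace H] (π : UnitaryRep G H) {ι : Type*} [Fintype ι] (S : Finset G)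
    (c : G → Matrix ι ι ℂ) :
    ‖opMatrix (repMatrix π S c)‖ ≤ ‖opMatrix (repMatrix (universalRep G) S c)‖ := by
  obtain ⟨Φ, hΦ⟩ := exists_starAlgHom_fullCStar π
  have h_map : (fullMatrix S c).map Φ = repMatrix π S c := by
    ext i j : 2
    simp [fullMatrix, repMatrix_apply, hΦ]
  rw [← h_map, ← fullMatrix_map_coe]
  exact norm_opMatrix_map_le Φ (fullCStar G).subtype Subtype.val_injective (fullMatrix S c)

end Universal

/-! ### Multiplication by coefficient functions is completely bounded -/

section Multipliers

variable {G : Type u} [Group G]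

theorem fs_matNorm_def {ι : Type} [Fintype ι] [DecidableEq ι]
    (u : Matrix ι ι (fourierStieltjes G)) : matNorm u = matNorm (u.map fsToDual) := rfl

theorem norm_repMatrix_coeff_le {K : Type u} [NormedAddCommGroup K] [InnerProductSpace ℂ K]
    [CompleteSpace K] (τ : UnitaryRep G K) {N : ℕ} {f : Fin N → K} (hf : Orthonormal ℂ f)
    {ν : Type*} [Fintype ν] (S : Finset G) (d : G → Matrix ν ν ℂ) :
    ‖opMatrix (repMatrix (universalRep G) S fun s => Matrix.of fun p q : ν × Fin N =>
        ⟪f p.2, τ s (f q.2)⟫_ℂ * d s p.1 q.1)‖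
      ≤ ‖opMatrix (repMatrix (universalRep G) S d)‖ := by
  classical
  refine norm_repMatrix_universalRep_le S _ (norm_nonneg _) fun κ => ?_
  refine le_trans ?_ (norm_repMatrix_le_universalRep (UnitaryRep.tensor κ.rep τ) S d)
  let g (n : Fin N) : PiLp 2 fun _ : Unit => K := WithLp.toLp 2 fun _ => f n
  have hg : Orthonormal ℂ g := by
    rw [orthonormal_iff_ite] at hf ⊢
    intro i j
    rw [← hf i j]
    simp [g, PiLp.inner_apply]
  have h_slice : (Matrix.of fun p q : ν × Fin N => ∑ t ∈ S,
      ⟪g p.2, opMatrix (Matrix.of fun _ _ : Unit => UnitaryRep.op τ t) (g q.2)⟫_ℂ •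
        (Matrix.of fun i j : ν => d t i j • UnitaryRep.op κ.rep t) p.1 q.1)
      = repMatrix κ.rep S fun s => Matrix.of fun p q : ν × Fin N =>
        ⟪f p.2, τ s (f q.2)⟫_ℂ * d s p.1 q.1 := by
    ext p q : 2
    simp [repMatrix_apply, inner_opMatrix, g, smul_smul]
  have h_tensor : (Matrix.of fun p q : ν × Unit => ∑ t ∈ S,
      opTensor (d t p.1 q.1 • UnitaryRep.op κ.rep t) (UnitaryRep.op τ t))
      = (repMatrix (UnitaryRep.tensor κ.rep τ) S d).submatrix Prod.fst Prod.fst := by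
    ext p q : 2
    simp only [Matrix.of_apply, opTensor_smul_left, Matrix.submatrix_apply, repMatrix_apply]
    rfl
  rw [← h_slice]
  refine (norm_opMatrix_slice_le hg S _ _).trans ?_
  simp only [Matrix.of_apply]
  rw [h_tensor]
  exact norm_opMatrix_submatrix_le (fun p q h => Prod.ext h rfl) _

theorem norm_repMatrix_mul_le {ι ν : Type} [Fintype ι] [DecidableEq ι] [Fintype ν]
    (u : Matrix ι ι (fourierStieltjes G)) (S : Finset G) (d : G → Matrix ν ν ℂ) :
    ‖opMatrix (repMatrix (universalRep G) S fun s => Matrix.of fun p q : ι × ν =>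
        (u p.1 q.1 : G → ℂ) s * d s p.2 q.2)‖
      ≤ matNorm u * ‖opMatrix (repMatrix (universalRep G) S d)‖ := by
  classical
  have hu : 0 ≤ matNorm u := dual_matNorm_nonneg _
  refine norm_repMatrix_universalRep_le S _ (by positivity) fun τ =>
    norm_opMatrix_le_of_orthonormal _ (by positivity) fun N f hf => ?_
  let e (s : G) : Matrix (ν × Fin N) (ν × Fin N) ℂ := Matrix.of fun p q =>
    ⟪f p.2, τ.rep s (f q.2)⟫_ℂ * d s p.1 q.1
  have h_pairing : (Matrix.of fun p q : (ι × ν) × Fin N =>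
      ⟪f p.2, repMatrix τ.rep S (fun s => Matrix.of fun p q : ι × ν =>
        (u p.1 q.1 : G → ℂ) s * d s p.2 q.2) p.1 q.1 (f q.2)⟫_ℂ)
      = (matrixPairing (u.map fsToDual) (fullMatrix S e)).submatrix
        (Equiv.prodAssoc ι ν (Fin N)) (Equiv.prodAssoc ι ν (Fin N)) := by
    ext p q
    simp only [matrixPairing, fullMatrix, e, Matrix.of_apply, Matrix.submatrix_apply,
      Matrix.map_apply, Equiv.prodAssoc_apply, map_sum, map_smul, fsToDual_apply, smul_eq_mul,
      repMatrix_apply, sum_apply, smul_apply, UnitaryRep.op_apply, inner_sum, inner_smul_right]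
    exact Finset.sum_congr rfl fun s _ => by ring
  rw [h_pairing]
  calc _ ≤ ‖matrixPairing (u.map fsToDual) (fullMatrix S e)‖ :=
        norm_submatrix_le (Equiv.injective _) _
    _ ≤ matNorm u * matNorm (fullMatrix S e) := norm_matrixPairing_le _ _
    _ ≤ matNorm u * ‖opMatrix (repMatrix (universalRep G) S d)‖ := by
        rw [matNorm_fullMatrix]
        gcongr
        exact norm_repMatrix_coeff_le τ.rep hf S d

theorem norm_repMatrix_slice_le {K : Type*} [NormedAddCommGroup K] [InnerProductSpace ℂ K]
    {κ : Type*} [Fintype κ] {N : ℕ} {g : Fin N → PiLp 2 fun _ : κ => K} (hg : Orthonormal ℂ g)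
    (S : Finset G) (T : G → Matrix κ κ (K →L[ℂ] K)) :
    ‖opMatrix (repMatrix (universalRep G) S fun s => Matrix.of fun n m =>
        ⟪g n, opMatrix (T s) (g m)⟫_ℂ)‖
      ≤ ‖opMatrix (Matrix.of fun p q : κ => ∑ s ∈ S,
        opTensor (UnitaryRep.op (universalRep G) s) (T s p q))‖ := by
  classical
  calc _ ≤ ‖opMatrix (Matrix.of fun p q : Unit × Fin N => ∑ t ∈ S,
          ⟪g p.2, opMatrix (T t) (g q.2)⟫_ℂ • UnitaryRep.op (universalRep G) t)‖ :=
        norm_opMatrix_submatrix_le (f := fun n : Fin N => ((), n)) (Prod.mk_right_injective _) _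
    _ ≤ ‖opMatrix (Matrix.of fun p q : Unit × κ => ∑ s ∈ S,
          opTensor (UnitaryRep.op (universalRep G) s) (T s p.2 q.2))‖ :=
        norm_opMatrix_slice_le hg S
          (fun s => Matrix.of fun _ _ : Unit => UnitaryRep.op (universalRep G) s) T
    _ ≤ _ := norm_opMatrix_submatrix_le (f := fun p : Unit × κ => p.2)
        (fun p q h => Prod.ext rfl h) (Matrix.of fun p q : κ => ∑ s ∈ S,
          opTensor (UnitaryRep.op (universalRep G) s) (T s p q))

theorem norm_opTensor_mul_le {K : Type*} [NormedAddCommGroup K] [InnerProductSpace ℂ K]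
    {ι κ : Type} [Fintype ι] [DecidableEq ι] [Fintype κ]
    (u : Matrix ι ι (fourierStieltjes G)) (S : Finset G) (T : G → Matrix κ κ (K →L[ℂ] K)) :
    ‖opMatrix (Matrix.of fun p q : ι × κ => ∑ s ∈ S,
        (u p.1 q.1 : G → ℂ) s • opTensor (UnitaryRep.op (universalRep G) s) (T s p.2 q.2))‖
      ≤ matNorm u * ‖opMatrix (Matrix.of fun p q : κ => ∑ s ∈ S,
        opTensor (UnitaryRep.op (universalRep G) s) (T s p q))‖ := by
  have hu : 0 ≤ matNorm u := dual_matNorm_nonneg _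
  have h_contraction := norm_opMatrix_opTensor_le S
    (fun s => Matrix.of fun i j : ι => (u i j : G → ℂ) s • UnitaryRep.op (universalRep G) s) T
    (C := matNorm u * ‖opMatrix (Matrix.of fun p q : κ => ∑ s ∈ S,
        opTensor (UnitaryRep.op (universalRep G) s) (T s p q))‖)
    (mul_nonneg hu (norm_nonneg _)) fun N g hg => ?_
  · simpa only [Matrix.of_apply, opTensor_smul_left] using h_contraction
  let d (s : G) : Matrix (Fin N) (Fin N) ℂ := Matrix.of fun n m =>
    ⟪g n, opMatrix (T s) (g m)⟫_ℂ
  have h_mul : (Matrix.of fun p q : ι × Fin N => ∑ t ∈ S, ⟪g p.2, opMatrix (T t) (g q.2)⟫_ℂ •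
      (Matrix.of fun i j : ι => (u i j : G → ℂ) t • UnitaryRep.op (universalRep G) t) p.1 q.1)
      = repMatrix (universalRep G) S fun s => Matrix.of fun p q : ι × Fin N =>
        (u p.1 q.1 : G → ℂ) s * d s p.2 q.2 := by
    ext p q : 2
    simp [repMatrix_apply, d, smul_smul, mul_comm]
  rw [h_mul]
  exact (norm_repMatrix_mul_le u S d).trans
    (mul_le_mul_of_nonneg_left (norm_repMatrix_slice_le hg S T) hu)

end Multipliers

section Flip

variable {H : Type*} [NormedAddCommGroup H] [InnerProductSpace ℂ H]
variable {K : Type*} [NormedAddCommGroup K] [InnerProductSpace ℂ K]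

theorem exists_flip : ∃ W : HilbertTensor H K →ₗᵢ[ℂ] HilbertTensor K H,
    ∀ x y, W (HilbertTensor.incl H K (x ⊗ₜ y)) = HilbertTensor.incl K H (y ⊗ₜ x) := by
  let F : HilbertTensor H K →L[ℂ] HilbertTensor K H :=
    ((TensorProduct.commIsometry ℂ H K).toContinuousLinearEquiv.toContinuousLinearMap).completion
  have hF : ∀ z, F (HilbertTensor.incl H K z)
      = HilbertTensor.incl K H (TensorProduct.comm ℂ H K z) := fun z =>
    ContinuousLinearMap.completion_apply_coe _ z
  refine ⟨⟨F.toLinearMap, fun z => ?_⟩, fun x y => hF _⟩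
  refine HilbertTensor.denseRange_incl.induction_on z
    (isClosed_eq (by fun_prop) (by fun_prop)) fun z => ?_
  rw [ContinuousLinearMap.coe_coe, hF]
  simp

theorem norm_sum_opTensor_flip_le {S : Type*} (s : Finset S) (c : S → ℂ) (a : S → H →L[ℂ] H)
    (b : S → K →L[ℂ] K) :
    ‖∑ t ∈ s, c t • opTensor (a t) (b t)‖ ≤ ‖∑ t ∈ s, c t • opTensor (b t) (a t)‖ := by
  obtain ⟨W, hW⟩ := exists_flip (H := H) (K := K)
  have h_intertwines (t : S) (z : HilbertTensor H K) :
      W (opTensor (a t) (b t) z) = opTensor (b t) (a t) (W z) := by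
    have h_comp : W.toContinuousLinearMap ∘L opTensor (a t) (b t)
        = opTensor (b t) (a t) ∘L W.toContinuousLinearMap :=
      HilbertTensor.clm_ext fun x y => by simp [opTensor_tmul, hW]
    exact congrArg (fun f => f z) h_comp
  refine ContinuousLinearMap.opNorm_le_bound _ (norm_nonneg _) fun z => ?_
  have h_image : W ((∑ t ∈ s, c t • opTensor (a t) (b t)) z)
      = (∑ t ∈ s, c t • opTensor (b t) (a t)) (W z) := by
    simp [sum_apply, smul_apply, h_intertwines]
  rw [← W.norm_map, h_image, ← W.norm_map z]
  exact ContinuousLinearMap.le_opNorm _ _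

end Flip

/-! ### The minimal tensor square of `C*(G)` -/

section ConcreteAlgebras

variable {H : Type*} [NormedAddCommGroup H] [InnerProductSpace ℂ H]

theorem continuous_opMatrix {ι : Type*} [Fintype ι] :
    Continuous fun a : Matrix ι ι (H →L[ℂ] H) => opMatrix a := by
  refine continuous_iff_continuousAt.2 fun b => ?_
  refine (tendsto_iff_norm_sub_tendsto_zero
    (E := (PiLp 2 fun _ : ι => H) →L[ℂ] PiLp 2 fun _ : ι => H)).2 ?_
  have h_sub (a : Matrix ι ι (H →L[ℂ] H)) : opMatrix a - opMatrix b = opMatrix (a - b) := by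
    rw [eq_comm, eq_sub_iff_add_eq, ← opMatrix_add, sub_add_cancel]
  simp_rw [h_sub]
  refine squeeze_zero (fun a => ContinuousLinearMap.opNorm_nonneg _)
    (fun a => norm_opMatrix_le_sum (a - b)) ?_
  have h_cont : Continuous fun a : Matrix ι ι (H →L[ℂ] H) => ∑ i, ∑ j, ‖(a - b) i j‖ := by
    simp only [Matrix.sub_apply]
    fun_prop
  simpa using h_cont.tendsto b

variable [CompleteSpace H] (A : StarSubalgebra ℂ (H →L[ℂ] H))

theorem continuous_matNorm {ι : Type} [Fintype ι] [DecidableEq ι] :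
    Continuous fun x : Matrix ι ι A => matNorm x := by
  simp only [starSubalgebra_matNorm_def]
  exact (continuous_opMatrix.comp (continuous_id.matrix_map continuous_subtype_val)).norm

variable {A} in
theorem norm_entry_le_matNorm {ι : Type} [Fintype ι] [DecidableEq ι] (x : Matrix ι ι A) (i j : ι) :
    ‖x i j‖ ≤ matNorm x :=
  norm_entry_le_norm_opMatrix (x.map fun a => (a : H →L[ℂ] H)) i j

instance instIsClosedMinTensor {K : Type*} [NormedAddCommGroup K] [InnerProductSpace ℂ K]
    [CompleteSpace K] (B : StarSubalgebra ℂ (K →L[ℂ] K)) :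
    IsClosed (minTensor A B : Set (HilbertTensor H K →L[ℂ] HilbertTensor H K)) :=
  StarSubalgebra.isClosed_topologicalClosure _

variable {A} in
theorem continuous_starAlgHom {K : Type*} [NormedAddCommGroup K] [InnerProductSpace ℂ K]
    [CompleteSpace K] {B : StarSubalgebra ℂ (K →L[ℂ] K)} [IsClosed (A : Set (H →L[ℂ] H))]
    [IsClosed (B : Set (K →L[ℂ] K))] (Φ : A →⋆ₐ[ℂ] B) : Continuous Φ :=
  AddMonoidHomClass.continuous_of_bound Φ 1 fun a => by
    simpa only [one_mul] using NonUnitalStarAlgHom.norm_apply_le Φ a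

variable {A} in
theorem coe_linearCombination {α : Type*} (f : α → A) (c : α →₀ ℂ) {s : Finset α}
    (hs : c.support ⊆ s) :
    (Finsupp.linearCombination ℂ f c : H →L[ℂ] H) = ∑ g ∈ s, c g • (f g : H →L[ℂ] H) := by
  rw [Finsupp.linearCombination_apply, Finsupp.sum_of_support_subset _ hs _ (by simp)]
  simp

variable {A} in
theorem norm_linearCombination {α : Type*} (f : α → A) (c : α →₀ ℂ) :
    ‖Finsupp.linearCombination ℂ f c‖ = ‖∑ g ∈ c.support, c g • (f g : H →L[ℂ] H)‖ :=
  congrArg norm (coe_linearCombination f c subset_rfl)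

end ConcreteAlgebras

section TensorHom

variable {G : Type*} [Group G] {H : Type*} [NormedAddCommGroup H] [InnerProductSpace ℂ H]
variable {G' : Type*} [Group G'] {K : Type*} [NormedAddCommGroup K] [InnerProductSpace ℂ K]
variable (π : UnitaryRep G H) (σ : UnitaryRep G' K)

/-- The operators `π(s) ⊗ σ(t)` of the outer tensor product of two representations. -/
def tensorHom : G × G' →* (HilbertTensor H K →L[ℂ] HilbertTensor H K) where
  toFun g := opTensor (UnitaryRep.opHom π g.1) (UnitaryRep.opHom σ g.2)
  map_one' := by simp only [Prod.fst_one, Prod.snd_one, map_one, opTensor_one]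
  map_mul' g h := by simp only [Prod.fst_mul, Prod.snd_mul, map_mul, opTensor_mul]

theorem tensorHom_apply (g : G × G') :
    tensorHom π σ g = opTensor (UnitaryRep.op π g.1) (UnitaryRep.op σ g.2) := rfl

variable [CompleteSpace H] [CompleteSpace K]

theorem star_tensorHom (g : G × G') : star (tensorHom π σ g) = tensorHom π σ g⁻¹ := by
  rw [tensorHom_apply, ← opTensor_star, UnitaryRep.star_op, UnitaryRep.star_op]
  rfl

theorem UnitaryRep.mem_closure_span_of_mem_cstar {a : H →L[ℂ] H} (ha : a ∈ UnitaryRep.cstar π) :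
    a ∈ closure (Submodule.span ℂ (Set.range (UnitaryRep.opHom π)) : Set (H →L[ℂ] H)) := by
  rw [← adjoin_range_eq_span (UnitaryRep.opHom π) (UnitaryRep.star_op π)]
  exact ha

theorem minTensor_cstar_eq_closure : minTensor (UnitaryRep.cstar π) (UnitaryRep.cstar σ)
    = (StarAlgebra.adjoin ℂ (Set.range (tensorHom π σ))).topologicalClosure := by
  have h_closed := StarSubalgebra.isClosed_topologicalClosure
    (StarAlgebra.adjoin ℂ (Set.range (tensorHom π σ)))
  refine le_antisymm (StarSubalgebra.topologicalClosure_minimal (StarAlgebra.adjoin_le ?_) h_closed)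
    (StarSubalgebra.topologicalClosure_minimal (StarAlgebra.adjoin_le ?_)
      (StarSubalgebra.isClosed_topologicalClosure _))
  · rintro _ ⟨a, ha, b, hb, rfl⟩
    refine map_mem_closure₂ continuous_opTensor (UnitaryRep.mem_closure_span_of_mem_cstar π ha)
      (UnitaryRep.mem_closure_span_of_mem_cstar σ hb) fun x hx y hy => ?_
    have h_map₂ := Submodule.apply_mem_map₂ (opTensorₗ H K) hx hy
    rw [Submodule.map₂_span_span] at h_map₂
    refine Submodule.span_le (p := Subalgebra.toSubmodule (StarAlgebra.adjoin ℂ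
      (Set.range (tensorHom π σ))).toSubalgebra) |>.2 ?_ h_map₂
    rintro _ ⟨_, ⟨s, rfl⟩, _, ⟨t, rfl⟩, rfl⟩
    exact StarAlgebra.subset_adjoin ℂ _ ⟨(s, t), rfl⟩
  · rintro _ ⟨⟨s, t⟩, rfl⟩
    exact (minTmul (UnitaryRep.cstarOf π s) (UnitaryRep.cstarOf σ t)).2

/-- The canonical homomorphism `(s, t) ↦ π(s) ⊗ σ(t)` into the minimal tensor product of the
C*-algebras generated by `π` and `σ`. -/
def minTensorHom : G × G' →* minTensor (UnitaryRep.cstar π) (UnitaryRep.cstar σ) where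
  toFun g := minTmul (UnitaryRep.cstarOf π g.1) (UnitaryRep.cstarOf σ g.2)
  map_one' := Subtype.ext (map_one (tensorHom π σ))
  map_mul' g h := Subtype.ext (map_mul (tensorHom π σ) g h)

theorem coe_minTensorHom (g : G × G') :
    (minTensorHom π σ g : HilbertTensor H K →L[ℂ] HilbertTensor H K)
      = opTensor (UnitaryRep.op π g.1) (UnitaryRep.op σ g.2) := rfl

theorem star_minTensorHom (g : G × G') : star (minTensorHom π σ g) = minTensorHom π σ g⁻¹ :=
  Subtype.ext (star_tensorHom π σ g)

theorem denseRange_minTensorHom : DenseRange (Finsupp.linearCombination ℂ (minTensorHom π σ)) :=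
  denseRange_linearCombination (tensorHom π σ) (star_tensorHom π σ)
    (minTensor_cstar_eq_closure π σ) _ fun _ => rfl

theorem norm_linearCombination_minTensorHom_swap_le (c : G × G' →₀ ℂ) :
    ‖Finsupp.linearCombination ℂ (fun g => minTensorHom σ π g.swap) c‖
      ≤ ‖Finsupp.linearCombination ℂ (minTensorHom π σ) c‖ := by
  simp only [norm_linearCombination, coe_minTensorHom]
  exact norm_sum_opTensor_flip_le _ _ _ _

theorem exists_minTensorFlip :
    ∃ Φ : minTensor (UnitaryRep.cstar π) (UnitaryRep.cstar σ) →⋆ₐ[ℂ]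
      minTensor (UnitaryRep.cstar σ) (UnitaryRep.cstar π),
      ∀ g, Φ (minTensorHom π σ g) = minTensorHom σ π g.swap := by
  let swapHom := (minTensorHom σ π).comp (MulEquiv.prodComm (M := G) (N := G')).toMonoidHom
  have h_star (g : G × G') : star (swapHom g) = swapHom g⁻¹ := star_minTensorHom σ π g.swap
  exact exists_starAlgHom_of_norm_le (minTensorHom π σ) swapHom (star_minTensorHom π σ) h_star
    (denseRange_minTensorHom π σ) (norm_linearCombination_minTensorHom_swap_le π σ)

end TensorHom

section MinSquare

variable {G : Type u} [Group G]

variable (G) in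
/-- The canonical homomorphism `(s, t) ↦ ϖ(s) ⊗ ϖ(t)` of `G × G` into
`C*(G) ⊗_min C*(G)`. -/
abbrev minHom : G × G →* minSquare G := minTensorHom (universalRep G) (universalRep G)

theorem denseRange_minHom : DenseRange (Finsupp.linearCombination ℂ (minHom G)) :=
  denseRange_minTensorHom _ _

theorem minSquare_clm_ext {E : Type*} [NormedAddCommGroup E] [NormedSpace ℂ E]
    {f g : minSquare G →L[ℂ] E} (h : ∀ x, f (minHom G x) = g (minHom G x)) : f = g := by
  refine ContinuousLinearMap.coeFn_injective ?_
  refine denseRange_minHom.equalizer f.continuous g.continuous ?_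
  have h_comp : f.toLinearMap ∘ₗ Finsupp.linearCombination ℂ (minHom G)
      = g.toLinearMap ∘ₗ Finsupp.linearCombination ℂ (minHom G) := by
    ext x
    simpa using h x
  exact congrArg DFunLike.coe h_comp

variable (G) in
/-- The flip automorphism `a ⊗ b ↦ b ⊗ a` of `C*(G) ⊗_min C*(G)`. -/
def minFlip : minSquare G →⋆ₐ[ℂ] minSquare G :=
  (exists_minTensorFlip (universalRep G) (universalRep G)).choose

theorem minFlip_minHom (g : G × G) : minFlip G (minHom G g) = minHom G g.swap :=
  (exists_minTensorFlip (universalRep G) (universalRep G)).choose_spec g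

theorem matNorm_minFlip_le {ι : Type} [Fintype ι] [DecidableEq ι]
    (x : Matrix ι ι (minSquare G)) : matNorm (x.map (minFlip G)) ≤ matNorm x :=
  norm_opMatrix_map_le ((minSquare G).subtype.comp (minFlip G)) (minSquare G).subtype
    Subtype.val_injective x

end MinSquare

/-! ### The `B(G)`-bimodule structure of the minimal tensor square -/

section TensorMatrices

variable {G : Type*} [Group G] {G' : Type*} [Group G']
variable {H : Type*} [NormedAddCommGroup H] [InnerProductSpace ℂ H] [CompleteSpace H]
variable {K : Type*} [NormedAddCommGroup K] [InnerProductSpace ℂ K] [CompleteSpace K]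
variable (π : UnitaryRep G H) (σ : UnitaryRep G' K) {S : Finset G} {T : Finset G'}

theorem coe_linearCombination_smul_minTensorHom (w : G → ℂ) {c : G × G' →₀ ℂ}
    (hc : c.support ⊆ S ×ˢ T) :
    (Finsupp.linearCombination ℂ (fun g => w g.1 • minTensorHom π σ g) c :
        HilbertTensor H K →L[ℂ] HilbertTensor H K)
      = ∑ s ∈ S, w s • opTensor (UnitaryRep.op π s) (∑ t ∈ T, c (s, t) • UnitaryRep.op σ t) := by
  rw [coe_linearCombination _ c hc, Finset.sum_product]
  refine Finset.sum_congr rfl fun s _ => ?_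
  have h_sum := map_sum (opTensorₗ H K (UnitaryRep.op π s))
    (fun t => c (s, t) • UnitaryRep.op σ t) T
  simp only [map_smul] at h_sum
  refine Eq.trans ?_ (congrArg (w s • ·) h_sum.symm)
  rw [Finset.smul_sum]
  exact Finset.sum_congr rfl fun t _ => smul_comm _ _ _

variable {ι : Type} [Fintype ι] [DecidableEq ι]

theorem matNorm_linearCombination_smul_minTensorHom (w : ι → ι → G → ℂ)
    {c : Matrix ι ι (G × G' →₀ ℂ)} (hc : ∀ i j, (c i j).support ⊆ S ×ˢ T) :
    matNorm (Matrix.of fun i j =>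
        Finsupp.linearCombination ℂ (fun g => w i j g.1 • minTensorHom π σ g) (c i j))
      = ‖opMatrix (Matrix.of fun i j => ∑ s ∈ S, w i j s •
          opTensor (UnitaryRep.op π s) (∑ t ∈ T, c i j (s, t) • UnitaryRep.op σ t))‖ :=
  congrArg (fun x : Matrix ι ι (HilbertTensor H K →L[ℂ] HilbertTensor H K) => ‖opMatrix x‖) <|
    Matrix.ext fun i j => coe_linearCombination_smul_minTensorHom π σ (w i j) (hc i j)

theorem matNorm_map_linearCombination_minTensorHom {c : Matrix ι ι (G × G' →₀ ℂ)}
    (hc : ∀ i j, (c i j).support ⊆ S ×ˢ T) :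
    matNorm (c.map (Finsupp.linearCombination ℂ (minTensorHom π σ)))
      = ‖opMatrix (Matrix.of fun i j => ∑ s ∈ S,
          opTensor (UnitaryRep.op π s) (∑ t ∈ T, c i j (s, t) • UnitaryRep.op σ t))‖ := by
  have h_one := matNorm_linearCombination_smul_minTensorHom π σ (fun _ _ _ => 1) hc
  simp only [one_smul] at h_one
  exact h_one

end TensorMatrices

section ModuleAction

variable {G : Type u} [Group G]
variable {ι κ : Type} [Fintype ι] [DecidableEq ι] [Fintype κ] [DecidableEq κ]

theorem matNorm_linearCombination_smul_le {G' : Type*} [Group G'] {K : Type*}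
    [NormedAddCommGroup K] [InnerProductSpace ℂ K] [CompleteSpace K] (σ : UnitaryRep G' K)
    (u : Matrix ι ι (fourierStieltjes G)) (c : Matrix κ κ (G × G' →₀ ℂ)) :
    matNorm (Matrix.of fun p q : ι × κ => Finsupp.linearCombination ℂ
        (fun g => (u p.1 q.1 : G → ℂ) g.1 • minTensorHom (universalRep G) σ g) (c p.2 q.2))
      ≤ matNorm u
        * matNorm (c.map (Finsupp.linearCombination ℂ (minTensorHom (universalRep G) σ))) := by
  classical
  let supp : Finset (G × G') := Finset.univ.biUnion fun p : κ × κ => (c p.1 p.2).support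
  let S : Finset G := supp.image Prod.fst
  let T : Finset G' := supp.image Prod.snd
  have h_supp (k l : κ) : (c k l).support ⊆ S ×ˢ T := fun g hg => by
    have h_mem : g ∈ supp := Finset.mem_biUnion.2 ⟨(k, l), Finset.mem_univ _, hg⟩
    exact Finset.mem_product.2
      ⟨Finset.mem_image_of_mem _ h_mem, Finset.mem_image_of_mem _ h_mem⟩
  have h_left := matNorm_linearCombination_smul_minTensorHom (universalRep G) σ
    (c := Matrix.of fun p q : ι × κ => c p.2 q.2) (fun p q => (u p.1 q.1 : G → ℂ))
    fun p q => h_supp p.2 q.2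
  have h_right := matNorm_map_linearCombination_minTensorHom (universalRep G) σ h_supp
  rw [h_right]
  exact h_left.trans_le (norm_opTensor_mul_le u S fun s => Matrix.of fun k l : κ =>
    ∑ t ∈ T, c k l (s, t) • UnitaryRep.op σ t)

theorem norm_linearCombination_smul_le (u : fourierStieltjes G) (c : G × G →₀ ℂ) :
    ‖Finsupp.linearCombination ℂ (fun g => (u : G → ℂ) g.1 • minHom G g) c‖
      ≤ matNorm (Matrix.of fun _ _ : Unit => u) * ‖Finsupp.linearCombination ℂ (minHom G) c‖ := by
  have h_matrix := matNorm_linearCombination_smul_le (universalRep G)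
    (Matrix.of fun _ _ : Unit => u) (Matrix.of fun _ _ : Unit => c)
  rw [← IsOperatorSpace.matNorm_one_by_one (Finsupp.linearCombination ℂ (minHom G) c)]
  exact (norm_entry_le_matNorm (Matrix.of fun _ _ : Unit × Unit =>
    Finsupp.linearCombination ℂ (fun g => (u : G → ℂ) g.1 • minHom G g) c)
      ((), ()) ((), ())).trans h_matrix

/-- The action of `B(G)` on `C*(G) ⊗_min C*(G)` through the first leg,
`u · (ϖ(s) ⊗ ϖ(t)) = u(s) ϖ(s) ⊗ ϖ(t)`. -/
def leftAct (u : fourierStieltjes G) : minSquare G →L[ℂ] minSquare G :=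
  (Finsupp.linearCombination ℂ fun g => (u : G → ℂ) g.1 • minHom G g).extendOfNorm
    (Finsupp.linearCombination ℂ (minHom G))

theorem leftAct_linearCombination (u : fourierStieltjes G) (c : G × G →₀ ℂ) :
    leftAct u (Finsupp.linearCombination ℂ (minHom G) c)
      = Finsupp.linearCombination ℂ (fun g => (u : G → ℂ) g.1 • minHom G g) c :=
  LinearMap.extendOfNorm_eq (denseRange_minHom (G := G)) ⟨_, norm_linearCombination_smul_le u⟩ c

theorem leftAct_minHom (u : fourierStieltjes G) (g : G × G) :
    leftAct u (minHom G g) = (u : G → ℂ) g.1 • minHom G g := by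
  simpa using leftAct_linearCombination u (Finsupp.single g 1)

theorem norm_leftAct_le (u : fourierStieltjes G) (v : minSquare G) :
    ‖leftAct u v‖ ≤ matNorm (Matrix.of fun _ _ : Unit => u) * ‖v‖ :=
  LinearMap.norm_extendOfNorm_apply_le (denseRange_minHom (G := G)) _
    (norm_linearCombination_smul_le u) v

theorem matNorm_leftAct_le (u : Matrix ι ι (fourierStieltjes G)) (v : Matrix κ κ (minSquare G)) :
    matNorm (Matrix.of fun p q : ι × κ => leftAct (u p.1 q.1) (v p.2 q.2))
      ≤ matNorm u * matNorm v := by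
  have h_dense : DenseRange fun c : Matrix κ κ (G × G →₀ ℂ) =>
      c.map (Finsupp.linearCombination ℂ (minHom G)) :=
    DenseRange.piMap fun _ => DenseRange.piMap fun _ => denseRange_minHom
  refine h_dense.induction_on v (isClosed_le ?_ ?_) fun c => ?_
  · refine (continuous_matNorm (minSquare G)).comp (continuous_matrix fun p q => ?_)
    exact (leftAct (u p.1 q.1)).continuous.comp (continuous_id.matrix_elem _ _)
  · exact continuous_const.mul (continuous_matNorm (minSquare G))
  · simp only [Matrix.map_apply, leftAct_linearCombination]
    exact matNorm_linearCombination_smul_le (universalRep G) u c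

variable (G) in
/-- `minFlip` as a bounded operator. -/
def minFlipL : minSquare G →L[ℂ] minSquare G :=
  ⟨(minFlip G : minSquare G →ₗ[ℂ] minSquare G), continuous_starAlgHom (minFlip G)⟩

/-- The action of `B(G)` on `C*(G) ⊗_min C*(G)` through the second leg,
`u · (ϖ(s) ⊗ ϖ(t)) = u(t) ϖ(s) ⊗ ϖ(t)`. -/
def rightAct (u : fourierStieltjes G) : minSquare G →L[ℂ] minSquare G :=
  minFlipL G ∘L leftAct u ∘L minFlipL G

theorem rightAct_apply (u : fourierStieltjes G) (v : minSquare G) :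
    rightAct u v = minFlip G (leftAct u (minFlip G v)) := rfl

theorem rightAct_minHom (u : fourierStieltjes G) (g : G × G) :
    rightAct u (minHom G g) = (u : G → ℂ) g.2 • minHom G g :=
  calc rightAct u (minHom G g) = minFlip G (leftAct u (minHom G g.swap)) :=
        congrArg (fun v => minFlip G (leftAct u v)) (minFlip_minHom g)
    _ = minFlip G ((u : G → ℂ) g.2 • minHom G g.swap) :=
        congrArg (minFlip G) (leftAct_minHom u g.swap)
    _ = (u : G → ℂ) g.2 • minFlip G (minHom G g.swap) := map_smul (minFlip G) _ _
    _ = (u : G → ℂ) g.2 • minHom G g :=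
        congrArg ((u : G → ℂ) g.2 • ·) (minFlip_minHom g.swap)

theorem matNorm_rightAct_le (u : Matrix ι ι (fourierStieltjes G)) (v : Matrix κ κ (minSquare G)) :
    matNorm (Matrix.of fun p q : ι × κ => rightAct (u p.1 q.1) (v p.2 q.2))
      ≤ matNorm u * matNorm v :=
  calc matNorm (Matrix.of fun p q : ι × κ => rightAct (u p.1 q.1) (v p.2 q.2))
      = matNorm ((Matrix.of fun p q : ι × κ =>
          leftAct (u p.1 q.1) (v.map (minFlip G) p.2 q.2)).map (minFlip G)) :=
        congrArg matNorm (Matrix.ext fun p q => rightAct_apply (u p.1 q.1) (v p.2 q.2))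
    _ ≤ matNorm (Matrix.of fun p q : ι × κ => leftAct (u p.1 q.1) (v.map (minFlip G) p.2 q.2)) :=
        matNorm_minFlip_le _
    _ ≤ matNorm u * matNorm (v.map (minFlip G)) := matNorm_leftAct_le u _
    _ ≤ matNorm u * matNorm v :=
        mul_le_mul_of_nonneg_left (matNorm_minFlip_le v) (dual_matNorm_nonneg _)

end ModuleAction

/-! ### Invariant functionals on modules over operator Connes-amenable algebras -/

section WeakStar

variable {V : Type*} [NormedAddCommGroup V] [NormedSpace ℂ V]

theorem continuous_weakStar_of_eval {X : Type*} {τ : TopologicalSpace X} {f : X → StrongDual ℂ V}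
    (h : ∀ v, Continuous fun x => f x v) : Continuous[τ, weakStar V] f :=
  continuous_induced_rng.2 (WeakDual.continuous_of_continuous_eval h)

theorem continuous_eval_weakStar (v : V) :
    Continuous[weakStar V, inferInstance] fun φ : StrongDual ℂ V => φ v :=
  @Continuous.comp _ _ _ (weakStar V) _ _ _ _ (WeakDual.eval_continuous v) continuous_induced_dom

end WeakStar

/-- A completely contractive action of the algebra `A` by commuting operators on `V`. -/
structure CommutingAction (A : Type*) [NonUnitalRing A] [Module ℂ A] [MatrixNorms A]
    (V : Type*) [NormedAddCommGroup V] [NormedSpace ℂ V] [MatrixNorms V] where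
  /-- the operator by which `a` acts -/
  act : A →ₗ[ℂ] V →L[ℂ] V
  act_mul : ∀ a b v, act (a * b) v = act a (act b v)
  act_comm : ∀ a b v, act a (act b v) = act b (act a v)
  matNorm_act_le : ∀ {ι κ : Type} [Fintype ι] [DecidableEq ι] [Fintype κ] [DecidableEq κ]
    (x : Matrix ι ι A) (v : Matrix κ κ V),
    matNorm (Matrix.of fun p q : ι × κ => act (x p.1 q.1) (v p.2 q.2)) ≤ matNorm x * matNorm v

namespace CommutingAction

variable {A : Type*} [NonUnitalRing A] [Module ℂ A] [MatrixNorms A]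
variable {V : Type*} [NormedAddCommGroup V] [NormedSpace ℂ V] [MatrixNorms V]

/-- The action on the dual space by the adjoint operators. -/
def dualAct (L : CommutingAction A V) : A →ₗ[ℂ] StrongDual ℂ V →ₗ[ℂ] StrongDual ℂ V :=
  LinearMap.mk₂ ℂ (fun a φ => φ.comp (L.act a))
    (fun a b φ => by ext v; simp) (fun c a φ => by ext v; simp)
    (fun a φ ψ => by ext v; simp) (fun c a φ => by ext v; simp)

@[simp]
theorem dualAct_apply (L : CommutingAction A V) (a : A) (φ : StrongDual ℂ V) (v : V) :
    L.dualAct a φ v = φ (L.act a v) := rfl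

theorem continuous_dualAct (L : CommutingAction A V) (a : A) :
    Continuous[weakStar V, weakStar V] (L.dualAct a) :=
  continuous_weakStar_of_eval (τ := weakStar V) fun v => continuous_eval_weakStar (L.act a v)

variable [IsOperatorSpace V]

theorem norm_functional_act_le (L : CommutingAction A V) (M : StrongDual ℂ V)
    {ι κ : Type} [Fintype ι] [DecidableEq ι] [Fintype κ] [DecidableEq κ]
    (x : Matrix ι ι A) (v : Matrix κ κ V) :
    ‖(Matrix.of fun p q : ι × κ => M (L.act (x p.1 q.1) (v p.2 q.2)) :
      Matrix (ι × κ) (ι × κ) ℂ)‖ ≤ ‖M‖ * (matNorm x * matNorm v) :=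
  (norm_map_functional_le M (Matrix.of fun p q : ι × κ => L.act (x p.1 q.1) (v p.2 q.2))).trans
    (mul_le_mul_of_nonneg_left (L.matNorm_act_le x v) (norm_nonneg _))

variable (hA : ∀ {ι : Type} [Fintype ι] [DecidableEq ι] (x : Matrix ι ι A), 0 ≤ matNorm x)
include hA

theorem isJointlyCompletelyBounded_dualAct (L : CommutingAction A V) :
    IsJointlyCompletelyBounded L.dualAct := by
  refine ⟨1, fun m n x φ => ?_⟩
  rw [one_mul]
  refine dual_matNorm_le (mul_nonneg (hA x) (dual_matNorm_nonneg φ)) fun N z => ?_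
  let e : (Fin m × Fin n) × Fin N → Fin n × (Fin m × Fin N) := fun p => (p.1.2, (p.1.1, p.2))
  have he : Function.Injective e := fun p q h => by
    simp only [e, Prod.mk.injEq] at h
    exact Prod.ext (Prod.ext h.2.1 h.1) h.2.2
  let xz := Matrix.of fun p q : Fin m × Fin N => L.act (x p.1 q.1) (z p.2 q.2)
  calc _ = ‖(matrixPairing φ xz).submatrix e e‖ := rfl
    _ ≤ ‖matrixPairing φ xz‖ := norm_submatrix_le he _
    _ ≤ matNorm φ * matNorm xz := norm_matrixPairing_le φ xz
    _ ≤ matNorm φ * (matNorm x * matNorm z) :=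
        mul_le_mul_of_nonneg_left (L.matNorm_act_le x z) (dual_matNorm_nonneg φ)
    _ = matNorm x * matNorm φ * matNorm z := by ring

/-- The dual of a space with two commuting actions of `A` is a bimodule. -/
def dualBimodule (L R : CommutingAction A V)
    (hLR : ∀ a b v, L.act a (R.act b v) = R.act b (L.act a v)) : DualOperatorBimodule A V where
  left := L.dualAct
  right := R.dualAct
  left_mul a b φ := by ext v; simp [L.act_mul, L.act_comm a b]
  right_mul a b φ := by ext v; simp [R.act_mul]
  left_right a b φ := by ext v; simp [hLR]
  left_cb := L.isJointlyCompletelyBounded_dualAct hA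
  right_cb := R.isJointlyCompletelyBounded_dualAct hA
  left_weakStar := L.continuous_dualAct
  right_weakStar := R.continuous_dualAct

variable (W : Submodule ℂ V) [IsClosed (W : Set V)]

/-- The action induced on the quotient by an invariant subspace. -/
def quotient (L : CommutingAction A V) (hW : ∀ a, ∀ w ∈ W, L.act a w ∈ W) :
    CommutingAction A (V ⧸ W) where
  act :=
    { toFun := fun a => W.liftQL (W.mkQL.comp (L.act a)) fun w hw => by
        simpa using hW a w hw
      map_add' := fun a b => by
        ext v; obtain ⟨v, rfl⟩ := W.mkQ_surjective v; simp
      map_smul' := fun c a => by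
        ext v; obtain ⟨v, rfl⟩ := W.mkQ_surjective v; simp }
  act_mul a b v := by
    obtain ⟨v, rfl⟩ := W.mkQ_surjective v
    simp [L.act_mul]
  act_comm a b v := by
    obtain ⟨v, rfl⟩ := W.mkQ_surjective v
    simp [L.act_comm a b]
  matNorm_act_le x v := by
    refine le_mul_quotient_matNorm (hA x) ?_
    rintro y rfl
    exact (quotient_matNorm_map_le W _).trans (L.matNorm_act_le x y)

end CommutingAction

section Balanced

variable {A : Type v} [NonUnitalRing A] [Module ℂ A] [MatrixNorms A]
variable {V : Type w} [NormedAddCommGroup V] [NormedSpace ℂ V] [MatrixNorms V]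

/-- The map `a ↦ M ∘ (L a - R a)` into `(V / W)^*`, for a functional `M` with
`M ∘ L a = M ∘ R a` on `W`. -/
def imbalance (L R : CommutingAction A V) (W : Submodule ℂ V) (M : StrongDual ℂ V)
    (hM : ∀ a, ∀ w ∈ W, M (L.act a w) = M (R.act a w)) : A →ₗ[ℂ] StrongDual ℂ (V ⧸ W) where
  toFun a := W.liftQL (M.comp (L.act a - R.act a)) fun w hw => by
    simpa [sub_eq_zero] using hM a w hw
  map_add' a b := by
    ext v; obtain ⟨v, rfl⟩ := W.mkQ_surjective v; simp; ring
  map_smul' c a := by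
    ext v; obtain ⟨v, rfl⟩ := W.mkQ_surjective v; simp [mul_sub]

variable {L R : CommutingAction A V} {W : Submodule ℂ V} {M : StrongDual ℂ V}

theorem imbalance_mkQ (hM : ∀ a, ∀ w ∈ W, M (L.act a w) = M (R.act a w)) (a : A) (v : V) :
    imbalance L R W M hM a (W.mkQ v) = M (L.act a v) - M (R.act a v) :=
  map_sub M _ _

theorem isCompletelyBounded_imbalance [IsOperatorSpace V] [IsClosed (W : Set V)]
    (hA : ∀ {ι : Type} [Fintype ι] [DecidableEq ι] (x : Matrix ι ι A), 0 ≤ matNorm x)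
    (hM : ∀ a, ∀ w ∈ W, M (L.act a w) = M (R.act a w)) :
    IsCompletelyBounded (imbalance L R W M hM) := by
  refine ⟨2 * ‖M‖, fun n x => dual_matNorm_le (mul_nonneg (by positivity) (hA x)) fun m z => ?_⟩
  refine le_mul_quotient_matNorm (mul_nonneg (by positivity) (hA x)) ?_
  rintro y rfl
  have h_sub : matrixPairing (x.map (imbalance L R W M hM)) (y.map W.mkQ)
      = (Matrix.of fun p q : Fin n × Fin m => M (L.act (x p.1 q.1) (y p.2 q.2)))
        - Matrix.of fun p q : Fin n × Fin m => M (R.act (x p.1 q.1) (y p.2 q.2)) :=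
    Matrix.ext fun p q => imbalance_mkQ hM _ _
  calc ‖matrixPairing (x.map (imbalance L R W M hM)) (y.map W.mkQ)‖
      ≤ ‖M‖ * (matNorm x * matNorm y) + ‖M‖ * (matNorm x * matNorm y) := by
        rw [h_sub]
        exact (norm_sub_le _ _).trans
          (add_le_add (L.norm_functional_act_le M x y) (R.norm_functional_act_le M x y))
    _ = 2 * ‖M‖ * matNorm x * matNorm y := by ring

theorem OperatorConnesAmenable.exists_balanced [CompleteSpace V] [IsOperatorSpace V]
    {τ : TopologicalSpace A} (hAm : OperatorConnesAmenable.{v, w} A τ)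
    (hA : ∀ {ι : Type} [Fintype ι] [DecidableEq ι] (x : Matrix ι ι A), 0 ≤ matNorm x)
    (hLR : ∀ a b v, L.act a (R.act b v) = R.act b (L.act a v))
    (hL : ∀ (ψ : StrongDual ℂ V) v, Continuous fun a => ψ (L.act a v))
    (hR : ∀ (ψ : StrongDual ℂ V) v, Continuous fun a => ψ (R.act a v))
    [IsClosed (W : Set V)]
    (hWL : ∀ a, ∀ w ∈ W, L.act a w ∈ W) (hWR : ∀ a, ∀ w ∈ W, R.act a w ∈ W)
    (hM : ∀ a, ∀ w ∈ W, M (L.act a w) = M (R.act a w)) :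
    ∃ M' : StrongDual ℂ V,
      (∀ w ∈ W, M' w = M w) ∧ ∀ a v, M' (L.act a v) = M' (R.act a v) := by
  let E := CommutingAction.dualBimodule hA (L.quotient hA W hWL) (R.quotient hA W hWR)
    fun a b => W.mkQ_surjective.forall.2 fun v => congrArg W.mkQ (hLR a b v)
  have h_normal : E.IsNormal τ := fun φ =>
    ⟨continuous_weakStar_of_eval (W.mkQ_surjective.forall.2 fun v => hL (φ.comp W.mkQL) v),
      continuous_weakStar_of_eval (W.mkQ_surjective.forall.2 fun v => hR (φ.comp W.mkQL) v)⟩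
  let D := imbalance L R W M hM
  have h_derivation (a b : A) : D (a * b) = E.left a (D b) + E.right b (D a) := by
    refine ContinuousLinearMap.ext (W.mkQ_surjective.forall.2 fun v => ?_)
    change D (a * b) (W.mkQ v) = D b (W.mkQ (L.act a v)) + D a (W.mkQ (R.act b v))
    simp only [D, imbalance_mkQ, L.act_mul, L.act_comm a b, R.act_mul, hLR]
    ring
  have h_continuous : Continuous[τ, weakStar (V ⧸ W)] D :=
    continuous_weakStar_of_eval (W.mkQ_surjective.forall.2 fun v => by
      simp only [D, imbalance_mkQ]
      exact (hL M v).sub (hR M v))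
  obtain ⟨N, hN⟩ := hAm (V ⧸ W) E h_normal D h_derivation
    (isCompletelyBounded_imbalance hA hM) h_continuous
  refine ⟨M - N.comp W.mkQL, fun w hw => ?_, fun a v => ?_⟩
  · have h_zero : W.mkQ w = 0 := by simpa using hw
    change M w - N (W.mkQ w) = M w
    rw [h_zero, map_zero, sub_zero]
  · have h_inner : D a (W.mkQ v) = N (W.mkQ (L.act a v)) - N (W.mkQ (R.act a v)) :=
      DFunLike.congr_fun (hN a) (W.mkQ v)
    rw [imbalance_mkQ] at h_inner
    change M _ - N (W.mkQ _) = M _ - N (W.mkQ _)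
    linear_combination h_inner

end Balanced

/-! ### Weak* continuity of the module actions -/

section WeakStarContinuity

variable {G : Type u} [Group G]

theorem norm_linearCombination_cstarHom (c : G →₀ ℂ) :
    ‖Finsupp.linearCombination ℂ (UnitaryRep.cstarHom (universalRep G)) c‖
      = ‖Finsupp.linearCombination ℂ (UnitaryRep.op (universalRep G)) c‖ := by
  rw [← UnitaryRep.coe_linearCombination_cstarHom]
  rfl

theorem fsToDual_linearCombination (u : fourierStieltjes G) (c : G →₀ ℂ) :
    fsToDual u (Finsupp.linearCombination ℂ (UnitaryRep.cstarHom (universalRep G)) c)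
      = Finsupp.linearCombination ℂ (u : G → ℂ) c :=
  (Finsupp.apply_linearCombination ℂ (fsToDual u).toLinearMap
    (UnitaryRep.cstarHom (universalRep G)) c).trans
    (congrArg (fun f : G → ℂ => Finsupp.linearCombination ℂ f c) (funext (fsToDual_apply u)))

/-- A coefficient function of a cyclic representation as an element of `B(G)`. -/
def fsCoeff (σ : CyclicRep G) (x y : σ.carrier) : fourierStieltjes G :=
  ⟨UnitaryRep.coeff σ.rep x y, _, σ.carrier, inferInstance, inferInstance, inferInstance,
    σ.rep, x, y, rfl, rfl⟩

theorem fsToDual_fsCoeff_linearCombination (σ : CyclicRep G) (x y : σ.carrier) (c : G →₀ ℂ) :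
    fsToDual (fsCoeff σ x y)
        (Finsupp.linearCombination ℂ (UnitaryRep.cstarHom (universalRep G)) c)
      = ⟪y, Finsupp.linearCombination ℂ (UnitaryRep.op σ.rep) c x⟫_ℂ := by
  rw [fsToDual_linearCombination]
  simp only [fsCoeff, Finsupp.linearCombination_apply, Finsupp.sum, sum_apply, smul_apply,
    UnitaryRep.op_apply, inner_sum, inner_smul_right, UnitaryRep.coeff, smul_eq_mul]

theorem norm_fsToDual_fsCoeff_le (σ : CyclicRep G) (x y : σ.carrier) :
    ‖fsToDual (fsCoeff σ x y)‖ ≤ ‖x‖ * ‖y‖ := by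
  refine ContinuousLinearMap.opNorm_le_bound _ (by positivity) fun a => ?_
  refine (UnitaryRep.denseRange_cstarHom (universalRep G)).induction_on a
    (isClosed_le (fsToDual (fsCoeff σ x y)).continuous.norm
      (continuous_const.mul continuous_norm)) fun c => ?_
  rw [fsToDual_fsCoeff_linearCombination, norm_linearCombination_cstarHom]
  calc ‖⟪y, Finsupp.linearCombination ℂ (UnitaryRep.op σ.rep) c x⟫_ℂ‖
      ≤ ‖y‖ * ‖Finsupp.linearCombination ℂ (UnitaryRep.op σ.rep) c x‖ := norm_inner_le_norm _ _
    _ ≤ ‖y‖ * (‖Finsupp.linearCombination ℂ (UnitaryRep.op (universalRep G)) c‖ * ‖x‖) := by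
        gcongr; exact norm_linearCombination_cyclicRep_le σ c x
    _ = ‖x‖ * ‖y‖ * ‖Finsupp.linearCombination ℂ (UnitaryRep.op (universalRep G)) c‖ := by ring

theorem norm_linearCombination_cstarHom_le (c : G →₀ ℂ) {C : ℝ} (hC : 0 ≤ C)
    (h : ∀ (σ : CyclicRep G) (x y : σ.carrier), ‖fsToDual (fsCoeff σ x y)
      (Finsupp.linearCombination ℂ (UnitaryRep.cstarHom (universalRep G)) c)‖
        ≤ C * ‖x‖ * ‖y‖) :
    ‖Finsupp.linearCombination ℂ (UnitaryRep.cstarHom (universalRep G)) c‖ ≤ C := by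
  rw [norm_linearCombination_cstarHom]
  let d : G → Matrix Unit Unit ℂ := fun s => Matrix.of fun _ _ => c s
  refine (norm_entry_le_norm_opMatrix (repMatrix (universalRep G) c.support d) () ()).trans
    (norm_repMatrix_universalRep_le _ d hC fun σ => (norm_opMatrix_le_sum _).trans ?_)
  simp only [Finset.univ_unique, Finset.sum_singleton]
  refine opNorm_le_of_norm_inner_le _ hC fun x y => ?_
  have h_coeff := h σ x y
  rwa [fsToDual_fsCoeff_linearCombination] at h_coeff

theorem matNorm_one_by_one_le (u : fourierStieltjes G) :
    matNorm (Matrix.of fun _ _ : Unit => u) ≤ ‖fsToDual u‖ := by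
  rw [fs_matNorm_def]
  exact dual_matNorm_le (norm_nonneg _) fun n x =>
    (norm_submatrix_le (f := fun p : Unit × Fin n => p.2) (fun _ _ h => Prod.ext rfl h)
      (x.map (fsToDual u))).trans (norm_map_functional_le _ x)

/-- On finite sums, the slice map `ψ ↦ (c ↦ ∑ c(s, t) ψ(ϖ(s) ⊗ ϖ(t)) ϖ(s))`, through which the
functional `u ↦ ψ(u · v)` on `B(G)` is represented by an element of `C*(G)`. -/
def finiteSlice (ψ : StrongDual ℂ (minSquare G)) : (G × G →₀ ℂ) →ₗ[ℂ] fullCStar G :=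
  Finsupp.linearCombination ℂ (UnitaryRep.cstarHom (universalRep G)) ∘ₗ
    Finsupp.linearCombination ℂ fun g => Finsupp.single g.1 (ψ (minHom G g))

theorem fsToDual_finiteSlice (ψ : StrongDual ℂ (minSquare G)) (u : fourierStieltjes G)
    (c : G × G →₀ ℂ) :
    fsToDual u (finiteSlice ψ c) = ψ (leftAct u (Finsupp.linearCombination ℂ (minHom G) c)) := by
  have h_eq : Finsupp.linearCombination ℂ (u : G → ℂ) ∘ₗ
      Finsupp.linearCombination ℂ (fun g => Finsupp.single g.1 (ψ (minHom G g)))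
      = ψ.toLinearMap ∘ₗ
        Finsupp.linearCombination ℂ (fun g : G × G => (u : G → ℂ) g.1 • minHom G g) := by
    refine Finsupp.lhom_ext' fun g => LinearMap.ext_ring ?_
    simp only [LinearMap.comp_apply, Finsupp.lsingle_apply, Finsupp.linearCombination_single,
      one_smul, smul_eq_mul, ContinuousLinearMap.coe_coe, map_smul]
    exact mul_comm _ _
  calc fsToDual u (finiteSlice ψ c) = _ := fsToDual_linearCombination u _
    _ = ψ (Finsupp.linearCombination ℂ (fun g : G × G => (u : G → ℂ) g.1 • minHom G g) c) :=
        LinearMap.congr_fun h_eq c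
    _ = ψ (leftAct u (Finsupp.linearCombination ℂ (minHom G) c)) :=
        congrArg ψ (leftAct_linearCombination u c).symm

theorem norm_finiteSlice_le (ψ : StrongDual ℂ (minSquare G)) (c : G × G →₀ ℂ) :
    ‖finiteSlice ψ c‖ ≤ ‖ψ‖ * ‖Finsupp.linearCombination ℂ (minHom G) c‖ := by
  let v : minSquare G := Finsupp.linearCombination ℂ (minHom G) c
  refine norm_linearCombination_cstarHom_le _ (C := ‖ψ‖ * ‖v‖) (by positivity) fun σ x y => ?_
  have h_coeff : matNorm (Matrix.of fun _ _ : Unit => fsCoeff σ x y) ≤ ‖x‖ * ‖y‖ :=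
    (matNorm_one_by_one_le _).trans (norm_fsToDual_fsCoeff_le σ x y)
  calc ‖fsToDual (fsCoeff σ x y) (finiteSlice ψ c)‖ = ‖ψ (leftAct (fsCoeff σ x y) v)‖ :=
        congrArg norm (fsToDual_finiteSlice ψ _ c)
    _ ≤ ‖ψ‖ * ‖leftAct (fsCoeff σ x y) v‖ := ψ.le_opNorm _
    _ ≤ ‖ψ‖ * (‖x‖ * ‖y‖ * ‖v‖) := mul_le_mul_of_nonneg_left ((norm_leftAct_le _ v).trans
        (mul_le_mul_of_nonneg_right h_coeff (norm_nonneg v))) (norm_nonneg ψ)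
    _ = ‖ψ‖ * ‖v‖ * ‖x‖ * ‖y‖ := by ring

theorem exists_functional_leftAct_eq (ψ : StrongDual ℂ (minSquare G)) (v : minSquare G) :
    ∃ a : fullCStar G, ∀ u : fourierStieltjes G, ψ (leftAct u v) = fsToDual u a := by
  let slice : minSquare G →L[ℂ] fullCStar G :=
    (finiteSlice ψ).extendOfNorm (Finsupp.linearCombination ℂ (minHom G))
  have h_slice (c : G × G →₀ ℂ) :
      slice (Finsupp.linearCombination ℂ (minHom G) c) = finiteSlice ψ c :=
    LinearMap.extendOfNorm_eq (denseRange_minHom (G := G)) ⟨_, norm_finiteSlice_le ψ⟩ c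
  have h_comp (u : fourierStieltjes G) : ψ ∘L leftAct u = fsToDual u ∘L slice := by
    refine ContinuousLinearMap.coeFn_injective ((denseRange_minHom (G := G)).equalizer
      (ψ ∘L leftAct u).continuous (fsToDual u ∘L slice).continuous (funext fun c => ?_))
    exact (fsToDual_finiteSlice ψ u c).symm.trans (congrArg (fsToDual u) (h_slice c).symm)
  exact ⟨slice v, fun u => DFunLike.congr_fun (h_comp u) v⟩

theorem continuous_fsToDual_apply (a : fullCStar G) :
    Continuous[fsWeakStar G, inferInstance] fun u : fourierStieltjes G => fsToDual u a :=
  @Continuous.comp _ _ _ (fsWeakStar G) (weakStar (fullCStar G)) _ _ _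
    (continuous_eval_weakStar a) continuous_induced_dom

theorem continuous_functional_leftAct (ψ : StrongDual ℂ (minSquare G)) (v : minSquare G) :
    Continuous[fsWeakStar G, inferInstance] fun u : fourierStieltjes G => ψ (leftAct u v) :=
  (exists_functional_leftAct_eq ψ v).elim fun a ha =>
    @Continuous.congr _ _ (fsWeakStar G) _ _ _ (continuous_fsToDual_apply a) fun u => (ha u).symm

theorem continuous_functional_rightAct (ψ : StrongDual ℂ (minSquare G)) (v : minSquare G) :
    Continuous[fsWeakStar G, inferInstance] fun u : fourierStieltjes G => ψ (rightAct u v) :=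
  continuous_functional_leftAct (ψ ∘L minFlipL G) (minFlip G v)

end WeakStarContinuity

/-! ### The Gelfand–Naimark–Segal construction for groups -/

section GNS

variable {Γ : Type*} [Group Γ] {A : Type*} [CStarAlgebra A]
variable {H : Type*} [NormedAddCommGroup H] [InnerProductSpace ℂ H] [CompleteSpace H]

theorem map_star_mul_linearCombination (f : Γ →* A) (π : Γ →* (H →L[ℂ] H))
    (hf : ∀ s, star (f s) = f s⁻¹) (hπ : ∀ s, star (π s) = π s⁻¹) (φ : StrongDual ℂ A) (ξ : H)
    (hφ : ∀ s, φ (f s) = ⟪ξ, π s ξ⟫_ℂ) (c d : Γ →₀ ℂ) :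
    φ (star (Finsupp.linearCombination ℂ f c) * Finsupp.linearCombination ℂ f d)
      = ⟪Finsupp.linearCombination ℂ π c ξ, Finsupp.linearCombination ℂ π d ξ⟫_ℂ := by
  have h_gram (s t : Γ) : φ (star (f s) * f t) = ⟪π s ξ, π t ξ⟫_ℂ :=
    calc φ (star (f s) * f t) = ⟪ξ, π (s⁻¹ * t) ξ⟫_ℂ := by rw [hf, ← map_mul, hφ]
      _ = ⟪ξ, ContinuousLinearMap.adjoint (π s) (π t ξ)⟫_ℂ := by
          rw [map_mul, ← hπ, ContinuousLinearMap.star_eq_adjoint, mul_apply_eq_comp]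
      _ = ⟪π s ξ, π t ξ⟫_ℂ := ContinuousLinearMap.adjoint_inner_right _ _ _
  simp only [Finsupp.linearCombination_apply, Finsupp.sum, star_sum, star_smul,
    Finset.sum_mul_sum, smul_mul_smul_comm, map_sum, map_smul, h_gram, sum_apply, smul_apply,
    sum_inner, inner_sum, inner_smul_left, inner_smul_right, smul_eq_mul, RCLike.star_def,
    mul_assoc]
  simp only [Finset.mul_sum]
  rw [Finset.sum_comm]
  exact Finset.sum_congr rfl fun t _ => Finset.sum_congr rfl fun s _ => mul_left_comm _ _ _

theorem map_star_mul_mul_le (φ : StrongDual ℂ A) (hφ : ∀ a, 0 ≤ φ (star a * a)) (a b : A) :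
    φ (star (a * b) * (a * b)) ≤ ‖a‖ ^ 2 * φ (star b * b) := by
  let _ := CStarAlgebra.spectralOrder A
  let _ := CStarAlgebra.spectralOrderedRing A
  have h_le : star b * (star a * a) * b ≤ ‖star a * a‖ • (star b * b) :=
    CStarAlgebra.star_left_conjugate_le_norm_smul (IsSelfAdjoint.star_mul_self a)
  obtain ⟨x, hx⟩ := CStarAlgebra.nonneg_iff_eq_star_mul_self.1 (sub_nonneg.2 h_le)
  have h_map_le : φ (star b * (star a * a) * b) ≤ φ (‖star a * a‖ • (star b * b)) := by
    rw [← sub_nonneg, ← map_sub, hx]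
    exact hφ x
  calc φ (star (a * b) * (a * b)) = φ (star b * (star a * a) * b) := by
        simp only [star_mul, mul_assoc]
    _ ≤ φ (‖star a * a‖ • (star b * b)) := h_map_le
    _ = ‖a‖ ^ 2 * φ (star b * b) := by
        rw [CStarRing.norm_star_mul_self, ← Complex.coe_smul, map_smul, smul_eq_mul, ← sq,
          Complex.ofReal_pow]

theorem exists_starAlgHom_of_functional (f : Γ →* A) (π : Γ →* (H →L[ℂ] H))
    (hf : ∀ s, star (f s) = f s⁻¹) (hπ : ∀ s, star (π s) = π s⁻¹)
    (hd : DenseRange (Finsupp.linearCombination ℂ f)) (φ : StrongDual ℂ A) (ξ : H)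
    (hφ : ∀ s, φ (f s) = ⟪ξ, π s ξ⟫_ℂ)
    (hξ : DenseRange fun c => Finsupp.linearCombination ℂ π c ξ) :
    ∃ Φ : A →⋆ₐ[ℂ] (H →L[ℂ] H), ∀ s, Φ (f s) = π s := by
  have h_sq (c : Γ →₀ ℂ) :
      φ (star (Finsupp.linearCombination ℂ f c) * Finsupp.linearCombination ℂ f c)
        = ((‖Finsupp.linearCombination ℂ π c ξ‖ ^ 2 : ℝ) : ℂ) := by
    rw [map_star_mul_linearCombination f π hf hπ φ ξ hφ, inner_self_eq_norm_sq_to_K]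
    norm_cast
  have h_pos (a : A) : 0 ≤ φ (star a * a) :=
    hd.induction_on a (isClosed_le continuous_const (by fun_prop)) fun c => by
      rw [h_sq]
      exact Complex.zero_le_real.2 (sq_nonneg _)
  refine exists_starAlgHom_of_norm_le f π hf hπ hd fun c => ?_
  refine ContinuousLinearMap.opNorm_le_bound _ (norm_nonneg _) fun x => ?_
  refine hξ.induction_on x (isClosed_le (by fun_prop) (by fun_prop)) fun d => ?_
  have h_le := map_star_mul_mul_le φ h_pos
    (Finsupp.linearCombination ℂ f c) (Finsupp.linearCombination ℂ f d)
  rw [← linearCombination_coeff_mul, h_sq, h_sq, linearCombination_coeff_mul] at h_le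
  refine le_of_sq_le_sq ?_ (by positivity)
  rw [mul_pow]
  exact_mod_cast h_le

theorem exists_isState_of_starAlgHom {K : Type*} [NormedAddCommGroup K] [InnerProductSpace ℂ K]
    [CompleteSpace K] {B : StarSubalgebra ℂ (K →L[ℂ] K)} [IsClosed (B : Set (K →L[ℂ] K))]
    (Φ : B →⋆ₐ[ℂ] (H →L[ℂ] H)) (ξ : H) (hξ : ‖ξ‖ = 1) :
    ∃ φ : StrongDual ℂ B, IsState φ ∧ ∀ a, φ a = ⟪ξ, Φ a ξ⟫_ℂ := by
  have h_bound (a : B) : ‖⟪ξ, Φ a ξ⟫_ℂ‖ ≤ 1 * ‖a‖ :=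
    calc ‖⟪ξ, Φ a ξ⟫_ℂ‖ ≤ ‖Φ a‖ * ‖ξ‖ * ‖ξ‖ := norm_inner_apply_le (Φ a) ξ ξ
      _ ≤ 1 * ‖a‖ := by
          rw [hξ, mul_one, mul_one, one_mul]
          exact NonUnitalStarAlgHom.norm_apply_le Φ a
  let φ : StrongDual ℂ B := LinearMap.mkContinuous
    { toFun a := ⟪ξ, Φ a ξ⟫_ℂ
      map_add' a b := by rw [map_add, add_apply, inner_add_right]
      map_smul' c a := by rw [map_smul, smul_apply, inner_smul_right]; rfl } 1 h_bound
  refine ⟨φ, ⟨fun a => ?_, le_antisymm (LinearMap.mkContinuous_norm_le _ zero_le_one _) ?_⟩,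
    fun a => rfl⟩
  · calc (0 : ℂ) ≤ ((‖Φ a ξ‖ ^ 2 : ℝ) : ℂ) := Complex.zero_le_real.2 (sq_nonneg _)
      _ = ⟪Φ a ξ, Φ a ξ⟫_ℂ := by rw [inner_self_eq_norm_sq_to_K]; norm_cast
      _ = ⟪ξ, Φ (star a * a) ξ⟫_ℂ := by
          rw [map_mul, map_star, mul_apply_eq_comp, ContinuousLinearMap.star_eq_adjoint,
            ContinuousLinearMap.adjoint_inner_right]
  · have h_map_one : φ 1 = 1 := by
      change ⟪ξ, Φ 1 ξ⟫_ℂ = 1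
      rw [map_one, one_apply_eq_self, inner_self_eq_norm_sq_to_K, hξ]
      norm_num
    calc 1 = ‖φ 1‖ := by rw [h_map_one, norm_one]
      _ ≤ ‖φ‖ * ‖(1 : B)‖ := φ.le_opNorm 1
      _ ≤ ‖φ‖ := mul_le_of_le_one_right (norm_nonneg _) ContinuousLinearMap.norm_id_le

end GNS

/-! ### The factorization property -/

section Factorization

variable {G : Type u} [Group G]

variable (G) in
/-- The representation `(s, t) ↦ λ(s) ρ(t)` of `G × G` on `ℓ²(G)`. -/
def biregular : G × G →* (lp (fun _ : G => ℂ) 2 →L[ℂ] lp (fun _ : G => ℂ) 2) where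
  toFun g := UnitaryRep.op (leftRegular G) g.1 * UnitaryRep.op (rightRegular G) g.2
  map_one' := by ext f x; simp
  map_mul' g h := by
    ext f x
    simp [leftRegular, rightRegular, lpComp, mul_assoc]

theorem biregular_apply_apply (g : G × G) (f : lp (fun _ : G => ℂ) 2) (x : G) :
    biregular G g f x = f (g.1⁻¹ * x * g.2) := rfl

theorem star_biregular (g : G × G) : star (biregular G g) = biregular G g⁻¹ := by
  change star (UnitaryRep.op (leftRegular G) g.1 * UnitaryRep.op (rightRegular G) g.2) = _
  rw [star_mul, UnitaryRep.star_op, UnitaryRep.star_op]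
  ext f x
  exact congrArg f (mul_assoc g.1⁻¹⁻¹ x g.2⁻¹).symm

open Classical in
variable (G) in
/-- The point mass at the identity, the vector state of which is `1_Δ` on `G × G`. -/
def pointMassOne : lp (fun _ : G => ℂ) 2 := lp.single 2 1 1

open Classical in
theorem pointMassOne_apply (x : G) : pointMassOne G x = if x = 1 then 1 else 0 := by
  rw [pointMassOne, lp.single_apply, Pi.single_apply]

open Classical in
theorem inner_biregular_pointMassOne (g : G × G) :
    ⟪pointMassOne G, biregular G g (pointMassOne G)⟫_ℂ = if g.1 = g.2 then 1 else 0 := by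
  conv_lhs => rw [pointMassOne, lp.inner_single_left]
  rw [← pointMassOne, biregular_apply_apply, pointMassOne_apply]
  simp [inv_mul_eq_one]

theorem denseRange_biregular_pointMassOne : DenseRange fun c : G × G →₀ ℂ =>
    Finsupp.linearCombination ℂ (biregular G) c (pointMassOne G) := by
  classical
  intro f
  refine mem_closure_of_tendsto (lp.hasSum_single (p := 2) (by simp) f)
    (Filter.Eventually.of_forall fun S => ⟨∑ s ∈ S, Finsupp.single (s, 1) (f s), ?_⟩)
  simp only [map_sum, Finsupp.linearCombination_single, sum_apply, smul_apply]
  refine Finset.sum_congr rfl fun s _ => ?_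
  ext x
  simp only [lp.coeFn_smul, Pi.smul_apply, biregular_apply_apply, pointMassOne_apply,
    lp.single_apply, Pi.single_apply, mul_one, inv_mul_eq_one, eq_comm (a := s), smul_eq_mul]
  split_ifs
  · exact mul_one _
  · exact mul_zero _

open Classical in
theorem factorizationProperty_of_functional (φ : StrongDual ℂ (minSquare G))
    (hφ : ∀ g, φ (minHom G g) = if g.1 = g.2 then 1 else 0) : FactorizationProperty G := by
  obtain ⟨Φ, hΦ⟩ := exists_starAlgHom_of_functional (minHom G) (biregular G)
    (star_minTensorHom _ _) star_biregular denseRange_minHom φ (pointMassOne G)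
    (fun g => (hφ g).trans (inner_biregular_pointMassOne g).symm) denseRange_biregular_pointMassOne
  exact ⟨Φ, fun s t => hΦ (s, t)⟩

theorem FactorizationProperty.diagonalExtendsToState (h : FactorizationProperty G) :
    DiagonalExtendsToState G := by
  obtain ⟨Φ, hΦ⟩ := h
  obtain ⟨φ, h_state, hφ⟩ := exists_isState_of_starAlgHom Φ (pointMassOne G)
    (by simp [pointMassOne])
  refine ⟨φ, h_state, fun s t => (hφ _).trans ?_⟩
  rw [hΦ]
  exact inner_biregular_pointMassOne (s, t)

theorem DiagonalExtendsToState.factorizationProperty (h : DiagonalExtendsToState G) :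
    FactorizationProperty G :=
  h.elim fun φ hφ => factorizationProperty_of_functional φ fun g => hφ.2 g.1 g.2

end Factorization

/-! ### Operator Connes-amenability implies the factorization property -/

section Eigenvectors

variable {A : Type*} [NonUnitalRing A] [Module ℂ A] [MatrixNorms A]
variable {V : Type*} [NormedAddCommGroup V] [NormedSpace ℂ V] [MatrixNorms V]

/-- The action of `A` on `V` for which the vectors `e i`, which have dense span (`he`), are joint
eigenvectors with eigenvalues `χ a i`. -/
def CommutingAction.ofEigenvectors {I : Type*} (e : I → V)
    (he : ∀ f g : V →L[ℂ] V, (∀ i, f (e i) = g (e i)) → f = g)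
    (χ : A →ₗ[ℂ] I → ℂ) (hχ : ∀ a b, χ (a * b) = χ a * χ b)
    (T : A → V →L[ℂ] V) (hT : ∀ a i, T a (e i) = χ a i • e i)
    (hn : ∀ {ι κ : Type} [Fintype ι] [DecidableEq ι] [Fintype κ] [DecidableEq κ]
      (x : Matrix ι ι A) (v : Matrix κ κ V),
      matNorm (Matrix.of fun p q : ι × κ => T (x p.1 q.1) (v p.2 q.2)) ≤ matNorm x * matNorm v) :
    CommutingAction A V where
  act :=
    { toFun := T
      map_add' := fun a b => he _ _ fun i => by simp [hT, add_smul]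
      map_smul' := fun c a => he _ _ fun i => by simp [hT, mul_smul] }
  act_mul a b v := DFunLike.congr_fun (he (T (a * b)) (T a ∘L T b) fun i => by
    simp [hT, hχ, mul_smul, smul_comm (χ a i)]) v
  act_comm a b v := DFunLike.congr_fun (he (T a ∘L T b) (T b ∘L T a) fun i => by
    simp [hT, smul_comm (χ a i)]) v
  matNorm_act_le := hn

/-- The restriction of an action along a completely isometric homomorphism. -/
def CommutingAction.comap {B : Type*} [NonUnitalRing B] [Module ℂ B] [MatrixNorms B]
    (L : CommutingAction B V) (j : A →ₗ[ℂ] B) (hj : ∀ a b, j (a * b) = j a * j b)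
    (hn : ∀ {ι : Type} [Fintype ι] [DecidableEq ι] (x : Matrix ι ι A),
      matNorm (x.map j) = matNorm x) : CommutingAction A V where
  act := L.act ∘ₗ j
  act_mul a b v := (congrArg (L.act · v) (hj a b)).trans (L.act_mul (j a) (j b) v)
  act_comm a b v := L.act_comm (j a) (j b) v
  matNorm_act_le x v :=
    (L.matNorm_act_le (x.map j) v).trans_eq (congrArg (· * matNorm v) (hn x))

end Eigenvectors

open Classical in
theorem OperatorConnesAmenable.exists_diagonal {A : Type v} [NonUnitalRing A] [Module ℂ A]
    [MatrixNorms A] {τ : TopologicalSpace A} {V : Type w} [NormedAddCommGroup V] [NormedSpace ℂ V]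
    [CompleteSpace V] [MatrixNorms V] [IsOperatorSpace V]
    (hAm : OperatorConnesAmenable.{v, w} A τ)
    (hA : ∀ {ι : Type} [Fintype ι] [DecidableEq ι] (x : Matrix ι ι A), 0 ≤ matNorm x)
    {I : Type*} {e : I × I → V} (he : ∀ f g : V →L[ℂ] V, (∀ i, f (e i) = g (e i)) → f = g)
    {χ : A → I → ℂ} (hδ : ∀ s, ∃ a, ∀ t, χ a t = if s = t then 1 else 0)
    {L R : CommutingAction A V} (hLe : ∀ a i, L.act a (e i) = χ a i.1 • e i)
    (hRe : ∀ a i, R.act a (e i) = χ a i.2 • e i)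
    (hL : ∀ (ψ : StrongDual ℂ V) v, Continuous fun a => ψ (L.act a v))
    (hR : ∀ (ψ : StrongDual ℂ V) v, Continuous fun a => ψ (R.act a v))
    {M₀ : StrongDual ℂ V} (hM₀ : ∀ i, M₀ (e i) = 1) :
    ∃ M : StrongDual ℂ V, ∀ i, M (e i) = if i.1 = i.2 then 1 else 0 := by
  let S : Set V := Set.range fun s => e (s, s)
  let W : Submodule ℂ V := (Submodule.span ℂ S).topologicalClosure
  have : IsClosed (W : Set V) := Submodule.isClosed_topologicalClosure _
  have h_comm (a b : A) (v : V) : L.act a (R.act b v) = R.act b (L.act a v) :=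
    DFunLike.congr_fun (he (L.act a ∘L R.act b) (R.act b ∘L L.act a) fun i => by
      simp [hLe, hRe, smul_comm (χ a i.1)]) v
  have h_invariant (a : A) : ∀ w ∈ W, L.act a w ∈ W := by
    have h_span : Submodule.span ℂ S ≤ (Submodule.span ℂ S).comap (L.act a).toLinearMap := by
      refine Submodule.span_le.2 ?_
      rintro _ ⟨s, rfl⟩
      change L.act a (e (s, s)) ∈ Submodule.span ℂ S
      rw [hLe]
      exact Submodule.smul_mem _ _ (Submodule.subset_span ⟨s, rfl⟩)
    exact Set.MapsTo.closure h_span (L.act a).continuous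
  have h_agree (a : A) : ∀ w ∈ W, L.act a w = R.act a w :=
    ContinuousLinearMap.eqOn_closure_span <| by
      rintro _ ⟨s, rfl⟩
      rw [hLe, hRe]
  obtain ⟨M, hM_eq, hM_balanced⟩ := hAm.exists_balanced hA h_comm hL hR h_invariant
    (fun a w hw => h_agree a w hw ▸ h_invariant a w hw)
    (fun a w hw => congrArg M₀ (h_agree a w hw))
  refine ⟨M, fun ⟨s, t⟩ => ?_⟩
  by_cases hst : s = t
  · subst hst
    rw [if_pos rfl, ← hM₀ (s, s)]
    exact hM_eq _ (Submodule.le_topologicalClosure _ (Submodule.subset_span ⟨s, rfl⟩))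
  · obtain ⟨a, ha⟩ := hδ s
    have h_balanced := hM_balanced a (e (s, t))
    rw [hLe, hRe, ha, ha, if_pos rfl, if_neg hst, one_smul, zero_smul, map_zero] at h_balanced
    rw [h_balanced, if_neg hst]

section Main

variable {G : Type u} [Group G]

variable (G) in
/-- The trivial representation. -/
def trivialCyclicRep : CyclicRep G where
  carrier := EuclideanSpace ℂ PUnit.{u + 1}
  rep := 1
  cyclic := by
    refine ⟨EuclideanSpace.single PUnit.unit 1, eq_top_iff.2 fun x _ => ?_⟩
    refine Submodule.le_topologicalClosure _ ?_
    have h_smul : x = x PUnit.unit • (1 : UnitaryRep G (EuclideanSpace ℂ PUnit.{u + 1})) 1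
        (EuclideanSpace.single PUnit.unit 1) := by
      ext i
      simp
    rw [h_smul]
    exact Submodule.smul_mem _ _ (Submodule.subset_span ⟨1, rfl⟩)

theorem UnitaryRep.hilbertSum_single {I : Type*} [DecidableEq I] {E : I → Type*}
    [∀ i, NormedAddCommGroup (E i)] [∀ i, InnerProductSpace ℂ (E i)] (π : ∀ i, UnitaryRep G (E i))
    (s : G) (i : I) (x : E i) :
    UnitaryRep.hilbertSum π s (lp.single 2 i x) = lp.single 2 i (π i s x) := by
  refine lp.ext (funext fun j => ?_)
  change π j s (lp.single 2 i x j) = lp.single 2 i (π i s x) j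
  obtain rfl | h := eq_or_ne j i
  · rw [lp.single_apply_self, lp.single_apply_self]
  · rw [lp.single_apply_ne _ _ _ h, lp.single_apply_ne _ _ _ h, map_zero]

theorem exists_invariant_universalRep :
    ∃ e : lp (fun σ : CyclicRep G => σ.carrier) 2, ‖e‖ = 1 ∧ ∀ s, universalRep G s e = e := by
  classical
  refine ⟨lp.single 2 (trivialCyclicRep G) (EuclideanSpace.single PUnit.unit (1 : ℂ)), ?_,
    fun s => UnitaryRep.hilbertSum_single _ _ _ _⟩
  exact (lp.norm_single (by simp) _ _).trans ((PiLp.norm_single 2 _ _ _).trans norm_one)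

theorem exists_functional_minTensorHom_eq_one {H : Type*} [NormedAddCommGroup H]
    [InnerProductSpace ℂ H] [CompleteSpace H] (π : UnitaryRep G H) {ξ : H} (h_norm : ‖ξ‖ = 1)
    (hξ : ∀ s, π s ξ = ξ) :
    ∃ M : StrongDual ℂ (minTensor (UnitaryRep.cstar π) (UnitaryRep.cstar π)),
      ∀ g, M (minTensorHom π π g) = 1 := by
  let η := HilbertTensor.incl H H (ξ ⊗ₜ[ℂ] ξ)
  refine ⟨(innerSL ℂ η ∘L ContinuousLinearMap.apply ℂ _ η) ∘L
    (minTensor (UnitaryRep.cstar π) (UnitaryRep.cstar π)).toSubalgebra.toSubmodule.subtypeL,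
    fun g => ?_⟩
  have h_invariant : tensorHom π π g η = η := by
    rw [tensorHom_apply, opTensor_tmul, UnitaryRep.op_apply, UnitaryRep.op_apply, hξ, hξ]
  calc ⟪η, tensorHom π π g η⟫_ℂ = ⟪η, η⟫_ℂ := by rw [h_invariant]
    _ = 1 := by
        rw [LinearIsometry.inner_map_map, TensorProduct.inner_tmul, inner_self_eq_norm_sq_to_K,
          h_norm]
        simp

variable (G) in
/-- `leftAct` as a completely contractive action of `B(G)`. -/
def leftAction : CommutingAction (fourierStieltjes G) (minSquare G) :=
  .ofEigenvectors (minHom G) (fun _ _ => minSquare_clm_ext)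
    (LinearMap.funLeft ℂ ℂ Prod.fst ∘ₗ (fourierStieltjes G).toSubmodule.subtype)
    (fun _ _ => rfl) leftAct leftAct_minHom matNorm_leftAct_le

variable (G) in
/-- `rightAct` as a completely contractive action of `B(G)`. -/
def rightAction : CommutingAction (fourierStieltjes G) (minSquare G) :=
  .ofEigenvectors (minHom G) (fun _ _ => minSquare_clm_ext)
    (LinearMap.funLeft ℂ ℂ Prod.snd ∘ₗ (fourierStieltjes G).toSubmodule.subtype)
    (fun _ _ => rfl) rightAct rightAct_minHom matNorm_rightAct_le

open Classical in
theorem OperatorConnesAmenable.factorizationProperty {A : Type v} [NonUnitalRing A] [Module ℂ A]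
    [MatrixNorms A] {τ : TopologicalSpace A} (hAm : OperatorConnesAmenable.{v, u + 1} A τ)
    (j : A →ₗ[ℂ] fourierStieltjes G) (hj : ∀ a b, j (a * b) = j a * j b)
    (hn : ∀ {ι : Type} [Fintype ι] [DecidableEq ι] (x : Matrix ι ι A),
      matNorm (x.map j) = matNorm x)
    (hτ : Continuous[τ, fsWeakStar G] j)
    (hδ : ∀ s, ∃ a, ∀ t, (j a : G → ℂ) t = if s = t then 1 else 0) :
    FactorizationProperty G := by
  have hA {ι : Type} [Fintype ι] [DecidableEq ι] (x : Matrix ι ι A) : 0 ≤ matNorm x :=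
    (dual_matNorm_nonneg ((x.map j).map fsToDual)).trans_eq (hn x)
  obtain ⟨e, he_norm, he⟩ := exists_invariant_universalRep (G := G)
  obtain ⟨M₀, hM₀⟩ := exists_functional_minTensorHom_eq_one (universalRep G) he_norm he
  obtain ⟨M, hM⟩ := hAm.exists_diagonal hA (fun _ _ => minSquare_clm_ext) hδ
    (L := (leftAction G).comap j hj hn) (R := (rightAction G).comap j hj hn)
    (fun a => leftAct_minHom (j a)) (fun a => rightAct_minHom (j a))
    (fun ψ v => @Continuous.comp _ _ _ τ (fsWeakStar G) _ _ _
      (continuous_functional_leftAct ψ v) hτ)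
    (fun ψ v => @Continuous.comp _ _ _ τ (fsWeakStar G) _ _ _
      (continuous_functional_rightAct ψ v) hτ) hM₀
  exact factorizationProperty_of_functional M hM

open Classical in
theorem coeff_leftRegular_single (s t : G) :
    UnitaryRep.coeff (leftRegular G) (pointMassOne G) (lp.single 2 s (1 : ℂ)) t
      = if s = t then 1 else 0 := by
  have h_apply : (leftRegular G t (pointMassOne G) : G → ℂ) s = pointMassOne G (t⁻¹ * s) := rfl
  rw [UnitaryRep.coeff, lp.inner_single_left, h_apply, pointMassOne_apply]
  simp [inv_mul_eq_one, eq_comm]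

theorem mem_fourierAlgebra_of_coeff {f : fourierStieltjes G} {ξ η : lp (fun _ : G => ℂ) 2}
    (h : (f : G → ℂ) = UnitaryRep.coeff (leftRegular G) ξ η) : f ∈ fourierAlgebra G := by
  refine fun ε hε => ⟨f, Submodule.subset_span ⟨ξ, η, h⟩, lt_of_le_of_lt ?_ hε⟩
  refine csInf_le ⟨0, ?_⟩ ⟨lp (fun _ : G => ℂ) 2, inferInstance, inferInstance, inferInstance,
    leftRegular G, 0, 0, ?_, by simp⟩
  · rintro _ ⟨H, _, _, _, π, x, y, _, rfl⟩
    positivity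
  · funext s
    simp [UnitaryRep.coeff]

open Classical in
theorem exists_mem_fourierAlgebra_eq_single (s : G) :
    ∃ f ∈ fourierAlgebra G, ∀ t, (f : G → ℂ) t = if s = t then 1 else 0 :=
  ⟨⟨UnitaryRep.coeff (leftRegular G) (pointMassOne G) (lp.single 2 s (1 : ℂ)), _,
    lp (fun _ : G => ℂ) 2, inferInstance, inferInstance, inferInstance, leftRegular G, _, _, rfl,
    rfl⟩, mem_fourierAlgebra_of_coeff rfl, coeff_leftRegular_single s⟩

open Classical in
theorem theorem4p2_general :
    (∀ B : NonUnitalSubalgebra ℂ (fourierStieltjes G),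
      (∀ s, ∃ f ∈ B, ∀ t, (f : G → ℂ) t = if s = t then 1 else 0) →
      OperatorConnesAmenable.{u, u + 1} B (fsSubWeakStar B) →
      FactorizationProperty G) ∧
    (FactorizationProperty G ↔ DiagonalExtendsToState G) ∧
    (¬ FactorizationProperty G →
      ¬ OperatorConnesAmenable.{u, u + 1} (fourierStieltjes G) (fsWeakStar G)) := by
  refine ⟨fun B hδ hAm => ?_, ⟨fun h => h.diagonalExtendsToState,
    fun h => h.factorizationProperty⟩, fun h hAm => h ?_⟩
  · exact hAm.factorizationProperty (NonUnitalSubalgebra.toSubmodule B).subtype (fun _ _ => rfl)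
      (fun _ => rfl) continuous_induced_dom fun s =>
        (hδ s).elim fun f hf => ⟨⟨f, hf.1⟩, hf.2⟩
  · exact hAm.factorizationProperty LinearMap.id (fun _ _ => rfl) (fun _ => rfl)
      (@continuous_id _ (fsWeakStar G)) fun s =>
        (exists_mem_fourierAlgebra_eq_single s).imp fun _ hf => hf.2

end Main

end

theorem theorem4p2 {G : Type u} [Group G] :
    (∀ B : NonUnitalSubalgebra ℂ (fourierStieltjes G),
      IsClosed[fsWeakStar G] (B : Set (fourierStieltjes G)) →
      fourierAlgebra G ⊆ (B : Set (fourierStieltjes G)) →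
      OperatorConnesAmenable.{u, u + 1} B (fsSubWeakStar B) →
      FactorizationProperty G) ∧
    (FactorizationProperty G ↔ DiagonalExtendsToState G) ∧
    (¬ FactorizationProperty G →
      ¬ OperatorConnesAmenable.{u, u + 1} (fourierStieltjes G) (fsWeakStar G)) := by
  exact ⟨fun B _ hB => theorem4p2_general.1 B fun s =>
    (exists_mem_fourierAlgebra_eq_single s).imp fun _ hf => ⟨hB hf.1, hf.2⟩,
    theorem4p2_general.2⟩
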